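/- Let $r\ge 3$ be an integer and let $A\in\mathbb C$ be a primitive $4r$-th root of unity, or, if $r$ is odd, a primitive $2r$-th or a primitive $r$-th root of unity. Put $d=-A^2-A^{-2}$. The Temperley–Lieb category $\mathrm{TL}_d$ is the $\mathbb C$-linear strict monoidal category with objects $0,1,2,\dots$, in which $\mathrm{Hom}(m,n)$ is the complex vector space with basis the isotopy classes of loop-free planar diagrams (non-crossing pairings) with $m$ bottom and $n$ top end points; composition is vertical stacking, where each closed loop is replaced by the factor $d$, and $\otimes$ is juxtaposition. Let $1_n$ be the identity of $n$ and let $U_i\in\mathrm{End}(n)$, $1\le i<n$, be the diagram with a cap and a cup at the positions $i,i+1$ and vertical strands elsewhere. A tensor ideal of $\mathrm{TL}_d$ is a class of morphisms that is closed under linear combinations within each $\mathrm{Hom}(m,n)$ and under composition and tensor product, on either side, with arbitrary morphisms. It is nonzero if it contains a nonzero morphism and proper if it does not contain all morphisms; $\langle x\rangle$ denotes the smallest tensor ideal that contains $x$. Let $\Delta_0=1$, $\Delta_1=d$, $\Delta_{n+1}=d\Delta_n-\Delta_{n-1}$. Define $p_0=1_0$, $p_1=1_1$ and, for $k\ge1$,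 $$p_{k+1}=p_k\otimes 1_1-\mu_k\,(p_k\otimes 1_1)\,U_k\,(p_k\otimes 1_1),\qquad \mu_k=\frac{\Delta_{k-1}}{\Delta_k},$$ with the convention $\mu_k=0$ if $\Delta_k=0$. Call $p\in\mathrm{End}(k)$ a Jones–Wenzl idempotent if $p^2=p\ne0$ and $U_ip=pU_i=0$ for $1\le i\le k-1$. Then: 1. $p_{r-1}$ is a Jones–Wenzl idempotent. 2. $\mathrm{TL}_d$ has exactly one proper nonzero tensor ideal, namely $\langle p_{r-1}\rangle$. 3. $\langle p_k\rangle=\langle p_{r-1}\rangle$ for every $k\ge r-1$, and $\langle p\rangle=\langle p_{r-1}\rangle$ for every Jones–Wenzl idempotent $p\in\mathrm{End}(k)$ with $k\ge r-1$. 4. The quotient category $\mathrm{TLJ}_d=\mathrm{TL}_d/\langle p_{r-1}\rangle$ (same objects, quotient Hom spaces) is semisimple: every linear functor from it to finite-dimensional complex vector spaces is a direct sum of irreducible ones, where a functor is irreducible if it is nonzero and has no invariant families of subspaces other than zero and itself. -/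

import Mathlib

open CategoryTheory

noncomputable section

/-! ### Connectivities of diagrams

A diagram in a rectangle with bottom end points `α` and top end points `β` is recorded by its
connectivity: the equivalence relation on `α ⊕ β` of lying on the same arc. -/

namespace Conn

variable {α β γ δ : Type}

/-- The equivalence relation on all the points (the outer ones `α ⊕ γ` and the middle ones `β`)
of the vertical stack of `f` (below) and `g` (above): it is generated by the relations `f`
and `g`. Its classes are the components of the stacked picture. -/
def glue (f : Setoid (α ⊕ β)) (g : Setoid (β ⊕ γ)) : Setoid ((α ⊕ γ) ⊕ β) :=
  sInf {s | f ≤ s.comap (Sum.elim (fun a => Sum.inl (Sum.inl a)) Sum.inr) ∧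
    g ≤ s.comap (Sum.elim Sum.inr (fun c => Sum.inl (Sum.inr c)))}

/-- The connectivity of the stack of `f` (below) and `g` (above). -/
def comp (f : Setoid (α ⊕ β)) (g : Setoid (β ⊕ γ)) : Setoid (α ⊕ γ) :=
  (glue f g).comap Sum.inl

/-- The components of a picture that do not reach the outer points. -/
def Inner {X Y : Type} (G : Setoid (X ⊕ Y)) : Type :=
  {c : Quotient G // ∀ x : X, (Quotient.mk G (Sum.inl x)) ≠ c}

/-- The number of closed loops of the stack of `f` and `g`: the components of the stack that
contain middle points only. -/
def loops (f : Setoid (α ⊕ β)) (g : Setoid (β ⊕ γ)) : ℕ := Nat.card (Inner (glue f g))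

/-- Vertical strands. -/
def one (α : Type) : Setoid (α ⊕ α) := Setoid.ker (Sum.elim id id)

/-- Disjoint union of equivalence relations. -/
def disj {X Y : Type} (f : Setoid X) (g : Setoid Y) : Setoid (X ⊕ Y) where
  r := Sum.LiftRel f g
  iseqv :=
    { refl := by rintro (x | y) <;> simp [Setoid.refl]
      symm := by
        rintro _ _ (h | h)
        · exact .inl (f.symm h)
        · exact .inr (g.symm h)
      trans := by
        rintro _ _ _ (h | h) (h' | h')
        · exact .inl (f.trans h h')
        · exact .inr (g.trans h h') }

/-- Juxtaposition: `f` on the left, `g` on the right. -/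
def tensor {m n m' n' : ℕ} (f : Setoid (Fin m ⊕ Fin n)) (g : Setoid (Fin m' ⊕ Fin n')) :
    Setoid (Fin (m + m') ⊕ Fin (n + n')) :=
  (disj f g).comap
    ((Equiv.sumCongr finSumFinEquiv.symm finSumFinEquiv.symm).trans
      (Equiv.sumSumSumComm (Fin m) (Fin m') (Fin n) (Fin n')))

/-! Stacking is associative and unital, loops included. This is read off from counting the
two-colourings of the components. -/

open Classical in
/-- The matrix of `f`: its entry at a colouring of the end points is `1` if the colouring is
constant on components, and `0` otherwise. -/
def mat (f : Setoid (α ⊕ β)) : Matrix (α → Bool) (β → Bool) ℕ :=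
  fun a b => if f ≤ Setoid.ker (Sum.elim a b) then 1 else 0

theorem glue_le_ker (f : Setoid (α ⊕ β)) (g : Setoid (β ⊕ γ)) (a : α → Bool) (b : β → Bool)
    (c : γ → Bool) : glue f g ≤ Setoid.ker (Sum.elim (Sum.elim a c) b) ↔
      f ≤ Setoid.ker (Sum.elim a b) ∧ g ≤ Setoid.ker (Sum.elim b c) := by
  have h1 : (Setoid.ker (Sum.elim (Sum.elim a c) b)).comap
      (Sum.elim (fun a => Sum.inl (Sum.inl a)) Sum.inr) = Setoid.ker (Sum.elim a b) := by
    ext x y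
    rcases x with x | x <;> rcases y with y | y <;> rfl
  have h2 : (Setoid.ker (Sum.elim (Sum.elim a c) b)).comap
      (Sum.elim Sum.inr (fun c => Sum.inl (Sum.inr c))) = Setoid.ker (Sum.elim b c) := by
    ext x y
    rcases x with x | x <;> rcases y with y | y <;> rfl
  constructor
  · intro h
    have hf : f ≤ (glue f g).comap (Sum.elim (fun a => Sum.inl (Sum.inl a)) Sum.inr) := by
      intro x y hxy s hs
      exact hs.1 hxy
    have hg : g ≤ (glue f g).comap (Sum.elim Sum.inr (fun c => Sum.inl (Sum.inr c))) := by
      intro x y hxy s hs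
      exact hs.2 hxy
    rw [← h1, ← h2]
    exact ⟨fun x y hxy => h (hf hxy), fun x y hxy => h (hg hxy)⟩
  · rintro ⟨hf, hg⟩
    refine sInf_le ⟨?_, ?_⟩
    · rw [h1]; exact hf
    · rw [h2]; exact hg

open Classical in
/-- The colourings of the middle points that extend an admissible colouring of the outer points
are the colourings of the inner components. -/
def extEquiv {X Y : Type} (G : Setoid (X ⊕ Y)) (u : X → Bool)
    (hu : G.comap Sum.inl ≤ Setoid.ker u) :
    {v : Y → Bool // G ≤ Setoid.ker (Sum.elim u v)} ≃ (Inner G → Bool) where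
  toFun v c := Quotient.lift (Sum.elim u v.1) (fun _ _ h => v.2 h) c.1
  invFun w :=
    let F : Quotient G → Bool := fun q =>
      if h : ∃ x : X, Quotient.mk G (Sum.inl x) = q then u h.choose
      else w ⟨q, fun x hx => h ⟨x, hx⟩⟩
    ⟨fun y => F (Quotient.mk G (Sum.inr y)), by
      have hF : ∀ z, Sum.elim u (fun y => F (Quotient.mk G (Sum.inr y))) z
          = F (Quotient.mk G z) := by
        rintro (x | y)
        · have h : ∃ x' : X, Quotient.mk G (Sum.inl x') = Quotient.mk G (Sum.inl x) := ⟨x, rfl⟩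
          have h' : F (Quotient.mk G (Sum.inl x)) = u h.choose := dif_pos h
          rw [h']
          have h2 : u h.choose = u x := hu (show G _ _ from Quotient.exact h.choose_spec)
          exact h2.symm
        · rfl
      intro z z' hz
      change Sum.elim _ _ z = Sum.elim _ _ z'
      rw [hF, hF, Quotient.sound hz]⟩
  left_inv := by
    rintro ⟨v, hv⟩
    ext y
    dsimp only
    split_ifs with h
    · exact hv (Quotient.exact h.choose_spec)
    · rfl
  right_inv := by
    intro w
    funext ⟨q, hq⟩
    induction q using Quotient.inductionOn with
    | h z =>
      rcases z with x | y
      · exact absurd rfl (hq x)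
      · have h : ¬ ∃ x : X, Quotient.mk G (Sum.inl x) = Quotient.mk G (Sum.inr y) :=
          fun ⟨x, hx⟩ => hq x hx
        simp [h]

open Classical in
theorem card_ext {X Y : Type} [Finite X] [Fintype Y] (G : Setoid (X ⊕ Y)) (u : X → Bool) :
    (∑ v : Y → Bool, if G ≤ Setoid.ker (Sum.elim u v) then 1 else 0) =
      2 ^ Nat.card (Inner G) * if G.comap Sum.inl ≤ Setoid.ker u then 1 else 0 := by
  have : Finite (Inner G) := Subtype.finite
  split_ifs with hu
  · rw [← Finset.card_filter, ← Fintype.card_subtype, ← Nat.card_eq_fintype_card,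
      Nat.card_congr (extEquiv G u hu), Nat.card_fun]
    simp
  · rw [mul_zero]
    refine Finset.sum_eq_zero fun v _ => if_neg fun h => hu ?_
    intro x y hxy
    exact h hxy

theorem mat_mul [Fintype α] [Fintype β] [Fintype γ] [DecidableEq β]
    (f : Setoid (α ⊕ β)) (g : Setoid (β ⊕ γ)) :
    mat f * mat g = 2 ^ loops f g • mat (comp f g) := by
  ext a c
  classical
  have h := card_ext (glue f g) (Sum.elim a c)
  simp only [glue_le_ker] at h
  have e : (mat f * mat g) a c = ∑ b : β → Bool,
      if f ≤ Setoid.ker (Sum.elim a b) ∧ g ≤ Setoid.ker (Sum.elim b c) then 1 else 0 := by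
    rw [Matrix.mul_apply]
    refine Finset.sum_congr rfl fun b _ => ?_
    by_cases h1 : f ≤ Setoid.ker (Sum.elim a b) <;>
      by_cases h2 : g ≤ Setoid.ker (Sum.elim b c) <;> simp [mat, h1, h2]
  rw [e]
  convert h using 1
  · exact Finset.sum_congr (Finset.ext fun _ => by simp) fun b _ => by congr
  · rfl

theorem mat_one [Fintype α] [DecidableEq α] : mat (one α) = 1 := by
  ext a b
  have : one α ≤ Setoid.ker (Sum.elim a b) ↔ a = b := by
    constructor
    · intro h
      ext1 x
      exact h (show one α (Sum.inl x) (Sum.inr x) from rfl)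
    · rintro rfl x y hxy
      have e : ∀ z : α ⊕ α, Sum.elim a a z = a (Sum.elim id id z) := by rintro (z | z) <;> rfl
      change Sum.elim a a x = Sum.elim a a y
      rw [e, e]
      exact congrArg a hxy
  simp [mat, this, Matrix.one_apply]

theorem mat_inj {f g : Setoid (α ⊕ β)} {i j : ℕ} (h : 2 ^ i • mat f = 2 ^ j • mat g) :
    f = g ∧ i = j := by
  classical
  have key : ∀ u : α ⊕ β → Bool, 2 ^ i * (if f ≤ Setoid.ker u then 1 else 0) =
      2 ^ j * (if g ≤ Setoid.ker u then 1 else 0) := by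
    intro u
    have := congrFun (congrFun h (u ∘ Sum.inl)) (u ∘ Sum.inr)
    simpa [mat, Matrix.smul_apply] using this
  have hij : i = j := by
    have := key (fun _ => true)
    have e : ∀ s : Setoid (α ⊕ β), s ≤ Setoid.ker (fun _ => true) := fun s x y _ => rfl
    rw [if_pos (e f), if_pos (e g), mul_one, mul_one] at this
    exact Nat.pow_right_injective le_rfl this
  refine ⟨?_, hij⟩
  subst hij
  have key' : ∀ u : α ⊕ β → Bool, f ≤ Setoid.ker u ↔ g ≤ Setoid.ker u := by
    intro u
    have := Nat.eq_of_mul_eq_mul_left (by positivity) (key u)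
    by_cases h1 : f ≤ Setoid.ker u <;> by_cases h2 : g ≤ Setoid.ker u <;> simp_all
  have le : ∀ s t : Setoid (α ⊕ β), (∀ u : α ⊕ β → Bool, t ≤ Setoid.ker u → s ≤ Setoid.ker u) →
      s ≤ t := by
    intro s t hst x y hxy
    have := hst (fun z => decide (t x z)) (fun z w hzw => by
      change decide _ = decide _
      exact decide_eq_decide.2 ⟨fun h => t.trans h hzw, fun h => t.trans h (t.symm hzw)⟩) hxy
    have h2 : decide (t x x) = decide (t x y) := this
    exact (decide_eq_decide.1 h2).1 (t.refl x)
  exact le_antisymm (le _ _ fun u => (key' u).2) (le _ _ fun u => (key' u).1)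

theorem assoc [Fintype α] [Fintype β] [Fintype γ] [Fintype δ] [DecidableEq β] [DecidableEq γ]
    (f : Setoid (α ⊕ β)) (g : Setoid (β ⊕ γ)) (h : Setoid (γ ⊕ δ)) :
    comp (comp f g) h = comp f (comp g h) ∧
      loops f g + loops (comp f g) h = loops g h + loops f (comp g h) := by
  apply mat_inj
  rw [pow_add, pow_add, mul_smul, mul_smul, ← mat_mul, ← mat_mul, ← Matrix.smul_mul,
    ← Matrix.mul_smul, ← mat_mul, ← mat_mul, Matrix.mul_assoc]

theorem one_comp [Fintype α] [Fintype β] [DecidableEq α] (f : Setoid (α ⊕ β)) :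
    comp (one α) f = f ∧ loops (one α) f = 0 := by
  apply mat_inj
  rw [← mat_mul, mat_one, pow_zero, one_smul, Matrix.one_mul]

theorem comp_one [Fintype α] [Fintype β] [DecidableEq β] (f : Setoid (α ⊕ β)) :
    comp f (one β) = f ∧ loops f (one β) = 0 := by
  apply mat_inj
  rw [← mat_mul, mat_one, pow_zero, one_smul, Matrix.mul_one]

end Conn

/-! ### The Temperley-Lieb category -/

/-- The connectivities of planar diagrams: those obtained from vertical strands, the cup and the
cap by vertical stacking and juxtaposition. (A loop-free multicurve in the rectangle is cut by
horizontal lines into such pieces, and it is determined up to isotopy by its connectivity.) -/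
inductive IsPlanar : ∀ {m n : ℕ}, Setoid (Fin m ⊕ Fin n) → Prop
  | one (n : ℕ) : IsPlanar (Conn.one (Fin n))
  | cup : IsPlanar (⊤ : Setoid (Fin 0 ⊕ Fin 2))
  | cap : IsPlanar (⊤ : Setoid (Fin 2 ⊕ Fin 0))
  | comp {m n k : ℕ} {f : Setoid (Fin m ⊕ Fin n)} {g : Setoid (Fin n ⊕ Fin k)} :
      IsPlanar f → IsPlanar g → IsPlanar (Conn.comp f g)
  | tensor {m n m' n' : ℕ} {f : Setoid (Fin m ⊕ Fin n)} {g : Setoid (Fin m' ⊕ Fin n')} :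
      IsPlanar f → IsPlanar g → IsPlanar (Conn.tensor f g)

/-- Temperley-Lieb diagrams without closed loops, up to isotopy, with `m` end points at the
bottom and `n` at the top. -/
def TLDiagram (m n : ℕ) : Type := {f : Setoid (Fin m ⊕ Fin n) // IsPlanar f}

/-- Formal linear combinations of Temperley-Lieb diagrams. -/
abbrev TLHom (m n : ℕ) : Type := TLDiagram m n →₀ ℂ

namespace TLDiagram

def one (n : ℕ) : TLDiagram n n := ⟨_, .one n⟩
def cup : TLDiagram 0 2 := ⟨_, .cup⟩
def cap : TLDiagram 2 0 := ⟨_, .cap⟩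
def comp {m n k : ℕ} (f : TLDiagram m n) (g : TLDiagram n k) : TLDiagram m k :=
  ⟨_, .comp f.2 g.2⟩
def tensor {m n m' n' : ℕ} (f : TLDiagram m n) (g : TLDiagram m' n') :
    TLDiagram (m + m') (n + n') :=
  ⟨_, .tensor f.2 g.2⟩
/-- The number of closed loops that arise when `g` is stacked on top of `f`. -/
def loops {m n k : ℕ} (f : TLDiagram m n) (g : TLDiagram n k) : ℕ := Conn.loops f.1 g.1

end TLDiagram

namespace TL

def one (n : ℕ) : TLHom n n := Finsupp.single (TLDiagram.one n) 1
def cup : TLHom 0 2 := Finsupp.single TLDiagram.cup 1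
def cap : TLHom 2 0 := Finsupp.single TLDiagram.cap 1

/-- Composition as a bilinear map. -/
def compHom (d : ℂ) (m n k : ℕ) : TLHom m n →ₗ[ℂ] TLHom n k →ₗ[ℂ] TLHom m k :=
  Finsupp.linearCombination ℂ fun f => Finsupp.linearCombination ℂ fun g =>
    Finsupp.single (f.comp g) (d ^ f.loops g)

/-- Composition, first `x` and then `y`: the bilinear extension of stacking `g` on top of `f`,
where every closed loop is replaced by the factor `d`. -/
def comp (d : ℂ) {m n k : ℕ} (x : TLHom m n) (y : TLHom n k) : TLHom m k :=
  compHom d m n k x y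

/-- The tensor product: the bilinear extension of juxtaposition. -/
def tensor {m n m' n' : ℕ} (x : TLHom m n) (y : TLHom m' n') : TLHom (m + m') (n + n') :=
  (Finsupp.linearCombination ℂ fun f : TLDiagram m n =>
    Finsupp.linearCombination ℂ fun g : TLDiagram m' n' =>
      (Finsupp.single (f.tensor g) 1 : TLHom (m + m') (n + n'))) x y

theorem comp_single (d : ℂ) {m n k : ℕ} (f : TLDiagram m n) (g : TLDiagram n k) (a b : ℂ) :
    comp d (Finsupp.single f a) (Finsupp.single g b) =
      Finsupp.single (f.comp g) (a * b * d ^ f.loops g) := by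
  rw [comp, compHom, Finsupp.linearCombination_single, LinearMap.smul_apply,
    Finsupp.linearCombination_single, Finsupp.smul_single, Finsupp.smul_single, smul_eq_mul,
    smul_eq_mul, mul_assoc]

theorem comp_add (d : ℂ) {m n k : ℕ} (x : TLHom m n) (y y' : TLHom n k) :
    comp d x (y + y') = comp d x y + comp d x y' := map_add _ _ _

theorem add_comp (d : ℂ) {m n k : ℕ} (x x' : TLHom m n) (y : TLHom n k) :
    comp d (x + x') y = comp d x y + comp d x' y := LinearMap.map_add₂ _ _ _ _

theorem comp_smul (d c : ℂ) {m n k : ℕ} (x : TLHom m n) (y : TLHom n k) :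
    comp d x (c • y) = c • comp d x y := map_smul _ _ _

theorem smul_comp (d c : ℂ) {m n k : ℕ} (x : TLHom m n) (y : TLHom n k) :
    comp d (c • x) y = c • comp d x y := LinearMap.map_smul₂ _ _ _ _

theorem zero_comp (d : ℂ) {m n k : ℕ} (y : TLHom n k) : comp d (0 : TLHom m n) y = 0 :=
  LinearMap.map_zero₂ _ _

theorem comp_zero (d : ℂ) {m n k : ℕ} (x : TLHom m n) : comp d x (0 : TLHom n k) = 0 :=
  map_zero _

theorem one_comp (d : ℂ) {m n : ℕ} (x : TLHom m n) : comp d (one m) x = x := by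
  induction x using Finsupp.induction_linear with
  | zero => exact comp_zero d _
  | add x y hx hy => rw [comp_add, hx, hy]
  | single f a =>
    obtain ⟨h1, h2⟩ := Conn.one_comp f.1
    have e1 : (TLDiagram.one m).comp f = f := Subtype.ext h1
    have e2 : (TLDiagram.one m).loops f = 0 := h2
    rw [one, comp_single, e1, e2]
    simp

theorem comp_one (d : ℂ) {m n : ℕ} (x : TLHom m n) : comp d x (one n) = x := by
  induction x using Finsupp.induction_linear with
  | zero => exact zero_comp d _
  | add x y hx hy => rw [add_comp, hx, hy]
  | single f a =>
    obtain ⟨h1, h2⟩ := Conn.comp_one f.1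
    have e1 : f.comp (TLDiagram.one n) = f := Subtype.ext h1
    have e2 : f.loops (TLDiagram.one n) = 0 := h2
    rw [one, comp_single, e1, e2]
    simp

theorem assoc (d : ℂ) {m n k l : ℕ} (x : TLHom m n) (y : TLHom n k) (z : TLHom k l) :
    comp d (comp d x y) z = comp d x (comp d y z) := by
  induction x using Finsupp.induction_linear with
  | zero => simp only [zero_comp]
  | add x x' hx hx' => simp only [add_comp, hx, hx']
  | single f a =>
    induction y using Finsupp.induction_linear with
    | zero => simp only [zero_comp, comp_zero]
    | add y y' hy hy' => simp only [add_comp, comp_add, hy, hy']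
    | single g b =>
      induction z using Finsupp.induction_linear with
      | zero => simp only [comp_zero]
      | add z z' hz hz' => simp only [comp_add, hz, hz']
      | single h c =>
        obtain ⟨h1, h2⟩ := Conn.assoc f.1 g.1 h.1
        have e1 : (f.comp g).comp h = f.comp (g.comp h) := Subtype.ext h1
        have e2 : f.loops g + (f.comp g).loops h = g.loops h + f.loops (g.comp h) := h2
        simp only [comp_single, e1]
        congr 1
        have e3 : d ^ f.loops g * d ^ (f.comp g).loops h
            = d ^ g.loops h * d ^ f.loops (g.comp h) := by
          rw [← pow_add, ← pow_add, e2]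
        linear_combination a * b * c * e3

end TL

/-- The Temperley-Lieb category with loop value `d`: the objects are the numbers of end points,
the morphisms are the formal linear combinations of diagrams. -/
def TLCat (_d : ℂ) : Type := ℕ

instance (d : ℂ) : Category (TLCat d) where
  Hom m n := TLHom m n
  id m := TL.one m
  comp x y := TL.comp d x y
  id_comp x := TL.one_comp d x
  comp_id x := TL.comp_one d x
  assoc x y z := TL.assoc d x y z

instance (d : ℂ) : Preadditive (TLCat d) where
  homGroup m n := inferInstanceAs (AddCommGroup (TLHom m n))
  add_comp _ _ _ x x' y := TL.add_comp d x x' y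
  comp_add _ _ _ x y y' := TL.comp_add d x y y'

instance (d : ℂ) : Linear ℂ (TLCat d) where
  homModule m n := inferInstanceAs (Module ℂ (TLHom m n))
  smul_comp _ _ _ c x y := TL.smul_comp d c x y
  comp_smul _ _ _ x c y := TL.comp_smul d c x y

/-! ### Tensor ideals and quotients -/

/-- A tensor ideal of the Temperley-Lieb category: a class of morphisms that is closed under
addition, under composition with arbitrary morphisms, and under tensor products with arbitrary
morphisms, on both sides. -/
@[ext]
structure TLIdeal (d : ℂ) where
  hom (m n : ℕ) : Submodule ℂ (TLHom m n)
  comp_mem_left {m n k : ℕ} (x : TLHom m n) {y : TLHom n k} : y ∈ hom n k →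
    TL.comp d x y ∈ hom m k
  comp_mem_right {m n k : ℕ} {x : TLHom m n} (y : TLHom n k) : x ∈ hom m n →
    TL.comp d x y ∈ hom m k
  tensor_mem_left {m n m' n' : ℕ} (x : TLHom m n) {y : TLHom m' n'} : y ∈ hom m' n' →
    TL.tensor x y ∈ hom (m + m') (n + n')
  tensor_mem_right {m n m' n' : ℕ} {x : TLHom m n} (y : TLHom m' n') : x ∈ hom m n →
    TL.tensor x y ∈ hom (m + m') (n + n')

namespace TLIdeal

variable {d : ℂ}

/-- The ideal contains a nonzero morphism. -/
def IsNonzero (I : TLIdeal d) : Prop := ∃ (m n : ℕ) (x : TLHom m n), x ∈ I.hom m n ∧ x ≠ 0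

/-- The ideal does not contain all morphisms. -/
def IsProper (I : TLIdeal d) : Prop := ∃ (m n : ℕ) (x : TLHom m n), x ∉ I.hom m n

variable (d) in
/-- The smallest tensor ideal that contains `p`. -/
def generated {a b : ℕ} (p : TLHom a b) : TLIdeal d where
  hom m n := ⨅ (I : TLIdeal d) (_ : p ∈ I.hom a b), I.hom m n
  comp_mem_left x y hy := by
    simp only [Submodule.mem_iInf] at hy ⊢
    exact fun I hI => I.comp_mem_left x (hy I hI)
  comp_mem_right y hx := by
    simp only [Submodule.mem_iInf] at hx ⊢
    exact fun I hI => I.comp_mem_right y (hx I hI)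
  tensor_mem_left x y hy := by
    simp only [Submodule.mem_iInf] at hy ⊢
    exact fun I hI => I.tensor_mem_left x (hy I hI)
  tensor_mem_right y hx := by
    simp only [Submodule.mem_iInf] at hx ⊢
    exact fun I hI => I.tensor_mem_right y (hx I hI)

/-- The quotient of a space of morphisms by the morphisms in the ideal. -/
abbrev QHom (I : TLIdeal d) (m n : ℕ) : Type := TLHom m n ⧸ I.hom m n

/-- The class of a morphism in the quotient. -/
def cls (I : TLIdeal d) {m n : ℕ} (x : TLHom m n) : I.QHom m n := Submodule.Quotient.mk x

/-- Composition in the quotient: `qcomp (cls x) (cls y) = cls (comp x y)`. -/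
def qcomp (I : TLIdeal d) {m n k : ℕ} (x : I.QHom m n) (y : I.QHom n k) : I.QHom m k :=
  Quotient.liftOn₂' x y (fun x y => I.cls (TL.comp d x y)) fun x y x' y' hx hy => by
    rw [Submodule.quotientRel_def] at hx hy
    refine (Submodule.Quotient.eq _).2 ?_
    have h : TL.comp d x y - TL.comp d x' y' =
        TL.comp d (x - x') y + TL.comp d x' (y - y') := by
      have h1 : TL.comp d (x - x') y = TL.comp d x y - TL.comp d x' y :=
        LinearMap.map_sub₂ _ _ _ _
      have h2 : TL.comp d x' (y - y') = TL.comp d x' y - TL.comp d x' y' := map_sub _ _ _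
      rw [h1, h2]
      abel
    rw [h]
    exact add_mem (I.comp_mem_right _ hx) (I.comp_mem_left _ hy)

/-- The quotient category by the ideal `I`: the same objects, and the quotients of the spaces of
morphisms. -/
def Quot (_I : TLIdeal d) : Type := ℕ

instance (I : TLIdeal d) : Category I.Quot where
  Hom m n := I.QHom m n
  id m := I.cls (TL.one m)
  comp x y := I.qcomp x y
  id_comp x := by
    induction x using Submodule.Quotient.induction_on with
    | H x => exact congrArg I.cls (TL.one_comp d x)
  comp_id x := by
    induction x using Submodule.Quotient.induction_on with
    | H x => exact congrArg I.cls (TL.comp_one d x)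
  assoc x y z := by
    induction x using Submodule.Quotient.induction_on with
    | H x =>
      induction y using Submodule.Quotient.induction_on with
      | H y =>
        induction z using Submodule.Quotient.induction_on with
        | H z => exact congrArg I.cls (TL.assoc d x y z)

instance (I : TLIdeal d) : Preadditive I.Quot where
  homGroup m n := inferInstanceAs (AddCommGroup (I.QHom m n))
  add_comp _ _ _ x x' y := by
    induction x using Submodule.Quotient.induction_on with
    | H x =>
      induction x' using Submodule.Quotient.induction_on with
      | H x' =>
        induction y using Submodule.Quotient.induction_on with
        | H y => exact congrArg I.cls (TL.add_comp d x x' y)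
  comp_add _ _ _ x y y' := by
    induction x using Submodule.Quotient.induction_on with
    | H x =>
      induction y using Submodule.Quotient.induction_on with
      | H y =>
        induction y' using Submodule.Quotient.induction_on with
        | H y' => exact congrArg I.cls (TL.comp_add d x y y')

instance (I : TLIdeal d) : Linear ℂ I.Quot where
  homModule m n := inferInstanceAs (Module ℂ (I.QHom m n))
  smul_comp _ _ _ c x y := by
    induction x using Submodule.Quotient.induction_on with
    | H x =>
      induction y using Submodule.Quotient.induction_on with
      | H y => exact congrArg I.cls (TL.smul_comp d c x y)
  comp_smul _ _ _ x c y := by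
    induction x using Submodule.Quotient.induction_on with
    | H x =>
      induction y using Submodule.Quotient.induction_on with
      | H y => exact congrArg I.cls (TL.comp_smul d c x y)

end TLIdeal

/-! ### Semisimple linear categories -/

section Semisimple

variable {C : Type} [Category.{0} C]

/-- A subrepresentation of a representation `F` of `C`: a family of subspaces that is invariant
under all morphisms. -/
structure Subrep (F : C ⥤ ModuleCat.{0} ℂ) where
  space (X : C) : Submodule ℂ (F.obj X)
  map_mem {X Y : C} (f : X ⟶ Y) {v : F.obj X} : v ∈ space X → (F.map f).hom v ∈ space Y

/-- The subrepresentation `S` is irreducible: it is not zero, and a subrepresentation inside it is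
zero or all of it. -/
def Subrep.IsIrreducible {F : C ⥤ ModuleCat.{0} ℂ} (S : Subrep F) : Prop :=
  (∃ X, S.space X ≠ ⊥) ∧
    ∀ T : Subrep F, (∀ X, T.space X ≤ S.space X) →
      (∀ X, T.space X = ⊥) ∨ ∀ X, T.space X = S.space X

variable (C) in
/-- A linear category is semisimple if each of its representations, that is, each linear functor
to finite-dimensional vector spaces, is a direct sum of irreducible ones. -/
def IsSemisimpleLinearCategory [Preadditive C] [Linear ℂ C] : Prop :=
  ∀ (F : C ⥤ ModuleCat.{0} ℂ) [F.Additive] [F.Linear ℂ], (∀ X, FiniteDimensional ℂ (F.obj X)) →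
    ∃ (ι : Type) (S : ι → Subrep F), (∀ i, (S i).IsIrreducible) ∧
      ∀ X, iSupIndep (fun i => (S i).space X) ∧ ⨆ i, (S i).space X = ⊤

end Semisimple

/-! ### Jones-Wenzl projectors -/

namespace TL

/-- The Chebyshev polynomials, evaluated at `d`. -/
def cheb (d : ℂ) : ℕ → ℂ
  | 0 => 1
  | 1 => d
  | n + 2 => d * cheb d (n + 1) - cheb d n

/-- The cap followed by the cup, a diagram on two strands. -/
def capCup (d : ℂ) : TLHom 2 2 := comp d cap cup

/-- The generators `U` of the Temperley-Lieb algebra on `n = a + 2 + b` strands: `a` vertical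
strands, then the cap and the cup, then `b` vertical strands. -/
def U (d : ℂ) (a b : ℕ) {n : ℕ} (h : a + 2 + b = n) : TLHom n n :=
  h ▸ tensor (tensor (one a) (capCup d)) (one b)

/-- The recursively defined Jones-Wenzl projectors. The coefficient of the recursion is a quotient
of Chebyshev polynomials at `d`; by the convention on division by zero it is `0` where the
denominator vanishes. -/
def jw (d : ℂ) : (k : ℕ) → TLHom k k
  | 0 => one 0
  | 1 => one 1
  | k + 2 =>
    let q : TLHom (k + 1 + 1) (k + 1 + 1) := tensor (jw d (k + 1)) (one 1)
    q - (cheb d k / cheb d (k + 1)) • comp d (comp d q (U d k 0 rfl)) q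

/-- The characterization of the Jones-Wenzl projector on `k` strands: a nonzero idempotent that
is annihilated by all the generators `U`. -/
def IsJonesWenzl (d : ℂ) {k : ℕ} (p : TLHom k k) : Prop :=
  p ≠ 0 ∧ comp d p p = p ∧
    ∀ (a b : ℕ) (h : a + 2 + b = k), comp d (U d a b h) p = 0 ∧ comp d p (U d a b h) = 0

end TL

end

/-!
Put `t = -A ^ 2`, so that `d = t + t⁻¹` and `t ^ 2` is a primitive `r`-th root of unity, and write
`s = r - 1`. The Chebyshev values satisfy `cheb d k ≠ 0` for `k < s` and `cheb d s = 0`. Let `J` be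
the tensor ideal generated by the projector `jw d s`.

Diagrams are computed with through the colouring matrices `Conn.mat`: these determine a diagram,
and turn stacking into matrix multiplication with each loop contributing a factor `2`. An identity
between stacks of diagrams, loop numbers included, is thus an identity between matrices of natural
numbers. Every diagram has a normal form in which all caps lie below all cups
(`TLDiagram.isNormal`). Hence a morphism that is annihilated by all caps sees only the coefficient
of the vertical strands (`TL.TopKilled.comp_end`), and the usual induction with partial traces shows
that `jw d k` is annihilated by caps and cups for `k ≤ s`.

*Every nonzero ideal contains `jw d s`* (`TLIdeal.jw_mem`). Bending strands, take a nonzero morphism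
`x : 0 → 2n` of the ideal with `n` minimal; all caps annihilate it. If `n ≤ s`, bending back gives
a nonzero multiple of `jw d n` in the ideal. For `n < s`, partial traces then produce `one 0`, and
the ideal is everything. The case `r ≤ n` is impossible (`TL.eq_zero_of_topKilled`): the spaces
of morphisms `0 → 2n` embed into the tensor powers of the plane on which quantum `SL₂` acts
(`TL.coordMap`, `TL.eq_zero_of_coordMap`). There `x` is determined by one coordinate `c`, because a
cap at neighbouring points relates their two orientations. A sum of coordinates over the words with
`r` letters `true` among the first `n + r`, weighted by inversions, vanishes on each diagram,
because some arc joins neighbours there and its two orientations cancel. On `x` the same sum is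
`c` times the Gaussian binomial coefficient of `n + r` over `r` at the root of unity `(t ^ 2)⁻¹`,
which is not zero (`TL.gauss_ne_zero`). So `c = 0`.

*`J` is proper* (`TLIdeal.isProper_generated_jw`). The morphisms that are orthogonal to everything
under the Markov trace form a tensor ideal; it does not contain `one 0`, but it contains `jw d s`,
whose trace is `cheb d s = 0`.

*Every proper ideal lies in `J`, and the quotient is semisimple.* Modulo `J`, each identity is a sum
of morphisms that factor through `jw d k` with `k < s` (`TLIdeal.one_mem_factored`). Between
`jw d k` and `jw d l` there is nothing for `k ≠ l`, and only the multiples of `jw d k` for `k = l`.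
So a proper ideal vanishes modulo `J` (`TLIdeal.IsProper.le`), and the `jw d k` behave like pairwise
nonisomorphic simple objects: a representation is the direct sum of the subrepresentations that are
generated by the vectors of bases of its multiplicity spaces (`TLIdeal.isSemisimple_quot`).
-/

noncomputable section

/-! ### Colourings of end points -/

namespace Word

/-- The order embedding of `n` points into `n + 2` points that misses the points `i` and
`i + 1`. -/
def skip {n : ℕ} (i : ℕ) (k : Fin n) : Fin (n + 2) :=
  ⟨if k.1 < i then k.1 else k.1 + 2, by split_ifs <;> omega⟩

/-- The colouring that arises from `c` by inserting two new points at the positions `i` and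
`i + 1`, coloured `p` and `q`. -/
def ins {X : Type} {n i : ℕ} (h : i ≤ n) (p q : X) (c : Fin n → X) (k : Fin (n + 2)) : X :=
  if h1 : k.1 < i then c ⟨k.1, by omega⟩
  else if h2 : k.1 = i then p
  else if h3 : k.1 = i + 1 then q
  else c ⟨k.1 - 2, by omega⟩

variable {X : Type} {n i : ℕ}

@[simp] theorem ins_skip (h : i ≤ n) (p q : X) (c : Fin n → X) (k : Fin n) :
    ins h p q c (skip i k) = c k := by
  by_cases hk : k.1 < i
  · simp [ins, skip, hk]
  · have h1 : ¬ k.1 + 2 < i := by omega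
    have h2 : ¬ k.1 + 2 = i := by omega
    have h3 : ¬ k.1 + 2 = i + 1 := by omega
    simp [ins, skip, hk, h1, h2, h3]

theorem ins_comp_skip (h : i ≤ n) (p q : X) (c : Fin n → X) : ins h p q c ∘ skip i = c :=
  funext fun _ => ins_skip ..

theorem ins_left (h : i ≤ n) (p q : X) (c : Fin n → X) (h' : i < n + 2) :
    ins h p q c ⟨i, h'⟩ = p := by
  simp [ins]

theorem ins_right (h : i ≤ n) (p q : X) (c : Fin n → X) (h' : i + 1 < n + 2) :
    ins h p q c ⟨i + 1, h'⟩ = q := by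
  simp [ins]

theorem ins_eq (h : i ≤ n) (b : Fin (n + 2) → X) (h1 : i < n + 2) (h2 : i + 1 < n + 2) :
    ins h (b ⟨i, h1⟩) (b ⟨i + 1, h2⟩) (b ∘ skip i) = b := by
  funext k
  unfold ins
  split_ifs with h1 h2 h3
  · simp only [Function.comp_apply, skip, h1]; simp
  · exact congrArg b (Fin.ext h2.symm)
  · exact congrArg b (Fin.ext h3.symm)
  · have : ¬ k.1 - 2 < i := by omega
    simp only [Function.comp_apply, skip, this]
    exact congrArg b (Fin.ext (by simp; omega))

/-- A colouring of `n + 2` points consists of the colours of the points `i` and `i + 1` and of a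
colouring of the others. -/
def insEquiv (h : i ≤ n) : (X × X) × (Fin n → X) ≃ (Fin (n + 2) → X) where
  toFun x := ins h x.1.1 x.1.2 x.2
  invFun b := ((b ⟨i, by omega⟩, b ⟨i + 1, by omega⟩), b ∘ skip i)
  left_inv x := by
    simp only [ins_left, ins_right, ins_comp_skip]
  right_inv b := ins_eq h b _ _

theorem sum_ins {R : Type*} [AddCommMonoid R] (h : i ≤ n) (F : (Fin (n + 2) → Bool) → R) :
    ∑ b, F b = ∑ p, ∑ q, ∑ c, F (ins h p q c) := by
  rw [← (insEquiv h).sum_comp, Fintype.sum_prod_type, Fintype.sum_prod_type]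
  rfl

/-- The positions `i` and `i + 1`, then the others. -/
@[to_additive]
theorem prod_skip {R : Type*} [CommMonoid R] (h : i ≤ n) (F : Fin (n + 2) → R) :
    ∏ k, F k = F ⟨i, by omega⟩ * F ⟨i + 1, by omega⟩ * ∏ k, F (skip i k) := by
  rw [Fin.prod_univ_succAbove F ⟨i, by omega⟩, Fin.prod_univ_succAbove _ ⟨i, by omega⟩, mul_assoc]
  have e1 : (⟨i, by omega⟩ : Fin (n + 2)).succAbove ⟨i, by omega⟩ = ⟨i + 1, by omega⟩ := by
    simp [Fin.succAbove]
  rw [e1]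
  congr 2
  refine Finset.prod_congr rfl fun k _ => congrArg F (Fin.ext ?_)
  by_cases hk : k.1 < i
  · simp [Fin.succAbove, skip, hk, Fin.lt_def]
  · have : ¬ k.1 + 1 < i := by omega
    simp [Fin.succAbove, skip, hk, Fin.lt_def, this]

/-- Insertion of two neighbouring points, weighted by `M`, into a function on colourings. -/
def cupOp {R : Type*} [CommSemiring R] (h : i ≤ n) (M : Bool → Bool → R)
    (v : (Fin n → Bool) → R) (b : Fin (n + 2) → Bool) : R :=
  M (b ⟨i, by omega⟩) (b ⟨i + 1, by omega⟩) * v (b ∘ skip i)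

/-- Contraction of two neighbouring points, weighted by `M`, in a function on colourings. -/
def capOp {R : Type*} [CommSemiring R] (h : i ≤ n) (M : Bool → Bool → R)
    (v : (Fin (n + 2) → Bool) → R) (c : Fin n → Bool) : R :=
  ∑ p, ∑ q, M p q * v (ins h p q c)

section relations

variable {R : Type*} [CommSemiring R] (M M' : Bool → Bool → R)

theorem capOp_cupOp_self (h : i ≤ n) (v : (Fin n → Bool) → R) :
    capOp h M' (cupOp h M v) = (∑ p, ∑ q, M' p q * M p q) • v := by
  funext c
  simp only [capOp, cupOp, ins_left, ins_right, ins_comp_skip, Pi.smul_apply, smul_eq_mul,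
    Finset.sum_mul, mul_assoc]

/-- A zigzag of an insertion and a contraction is straight if the two weights are inverse
matrices. -/
theorem capOp_succ_cupOp (hM : ∀ p q, ∑ s, M p s * M' s q = if p = q then 1 else 0)
    (h : i + 1 ≤ n) (v : (Fin n → Bool) → R) :
    capOp h M' (cupOp (by omega : i ≤ n) M v) = v := by
  funext c
  have key : ∀ p q, cupOp (by omega : i ≤ n) M v (ins h p q c) =
      M (c ⟨i, by omega⟩) p * v (Function.update c ⟨i, by omega⟩ q) := by
    intro p q
    unfold cupOp
    congr 1
    · congr 1 <;> simp [ins]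
    · congr 1
      funext k
      by_cases hk : k.1 < i
      · have : k.1 ≠ i := by omega
        have h3 : k.1 < i + 1 := by omega
        simp [skip, ins, hk, Fin.ext_iff, this, h3]
      · by_cases hk2 : k.1 = i
        · simp [skip, ins, Function.update_apply, Fin.ext_iff, hk2]
        · have h4 : ¬ k.1 + 2 < i + 1 := by omega
          have h5 : ¬ k.1 + 2 = i + 1 := by omega
          have h6 : ¬ k.1 = i := by omega
          simp [skip, ins, Fin.ext_iff, hk, h4, h5, h6]
  simp only [capOp, key]
  rw [Finset.sum_comm]
  have : ∀ q, ∑ p, M' p q * (M (c ⟨i, by omega⟩) p * v (Function.update c ⟨i, by omega⟩ q)) =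
      (if c ⟨i, by omega⟩ = q then 1 else 0) * v (Function.update c ⟨i, by omega⟩ q) := by
    intro q
    rw [← hM, Finset.sum_mul]
    exact Finset.sum_congr rfl fun p _ => by ring
  simp only [this, ite_mul, one_mul, zero_mul, Finset.sum_ite_eq, Finset.mem_univ, if_true,
    Function.update_eq_self]

theorem capOp_cupOp_succ (hM : ∀ p q, ∑ s, M' p s * M s q = if p = q then 1 else 0)
    (h : i + 1 ≤ n) (v : (Fin n → Bool) → R) :
    capOp (by omega : i ≤ n) M' (cupOp h M v) = v := by
  funext c
  have key : ∀ p q, cupOp h M v (ins (by omega : i ≤ n) p q c) =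
      M q (c ⟨i, by omega⟩) * v (Function.update c ⟨i, by omega⟩ p) := by
    intro p q
    unfold cupOp
    congr 1
    · congr 1
      · simp [ins]
      · have h1 : ¬ i + 1 + 1 < i := by omega
        have h2 : ¬ i + 1 + 1 = i := by omega
        simp [ins, h1, h2]
    · congr 1
      funext k
      by_cases hk : k.1 < i
      · have : k.1 ≠ i := by omega
        have h3 : k.1 < i + 1 := by omega
        simp [skip, ins, hk, Fin.ext_iff, this, h3]
      · by_cases hk2 : k.1 = i
        · simp [skip, ins, Function.update_apply, Fin.ext_iff, hk2]
        · have h4 : ¬ k.1 + 2 < i := by omega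
          have h5 : ¬ k.1 + 2 = i := by omega
          have h6 : ¬ k.1 = i := by omega
          have h7 : ¬ k.1 + 2 = i + 1 := by omega
          have h8 : ¬ k.1 < i + 1 := by omega
          simp [skip, ins, Fin.ext_iff, h4, h5, h6, h7, h8]
  simp only [capOp, key]
  have : ∀ p, ∑ q, M' p q * (M q (c ⟨i, by omega⟩) * v (Function.update c ⟨i, by omega⟩ p)) =
      (if p = c ⟨i, by omega⟩ then 1 else 0) * v (Function.update c ⟨i, by omega⟩ p) := by
    intro q
    rw [← hM, Finset.sum_mul]
    exact Finset.sum_congr rfl fun p _ => by ring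
  simp only [this, ite_mul, one_mul, zero_mul, Finset.sum_ite_eq', Finset.mem_univ, if_true,
    Function.update_eq_self]

theorem skip_skip {j : ℕ} (hij : i ≤ j) (k : Fin n) :
    skip (j + 2) (skip i k) = skip i (skip j k) := by
  apply Fin.ext
  simp only [skip]
  split_ifs <;> omega

theorem eq_ins (h : i ≤ n) {p q : X} {c : Fin n → X} {b : Fin (n + 2) → X}
    (h1 : b ⟨i, by omega⟩ = p) (h2 : b ⟨i + 1, by omega⟩ = q) (h3 : b ∘ skip i = c) :
    b = ins h p q c := by
  rw [← h1, ← h2, ← h3, ins_eq h b]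

theorem cupOp_cupOp {j : ℕ} (hij : i ≤ j) (hj : j ≤ n) (v : (Fin n → Bool) → R) :
    cupOp (by omega : j + 2 ≤ n + 2) M (cupOp (by omega : i ≤ n) M v) =
      cupOp (by omega : i ≤ n + 2) M (cupOp hj M v) := by
  funext b
  have h1 : i < j + 2 := by omega
  have h2 : i + 1 < j + 2 := by omega
  have h3 : ¬ j < i := by omega
  have h4 : ¬ j + 1 < i := by omega
  have e : (b ∘ skip (j + 2)) ∘ skip i = (b ∘ skip i) ∘ skip (n := n) j := by
    funext k
    simp only [Function.comp_apply, skip_skip hij]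
  unfold cupOp
  rw [e]
  simp only [Function.comp_apply, skip, h1, h2, h3, h4, if_true, if_false]
  ring

/-- Insertions and contractions at disjoint pairs of positions commute. -/
theorem capOp_far_right_cupOp {j : ℕ} (hij : i ≤ j) (hj : j ≤ n)
    (v : (Fin (n + 2) → Bool) → R) :
    capOp (by omega : j + 2 ≤ n + 2) M' (cupOp (by omega : i ≤ n + 2) M v) =
      cupOp (by omega : i ≤ n) M (capOp hj M' v) := by
  funext c
  have key : ∀ p q, cupOp (by omega : i ≤ n + 2) M v (ins (by omega : j + 2 ≤ n + 2) p q c) =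
      M (c ⟨i, by omega⟩) (c ⟨i + 1, by omega⟩) * v (ins hj p q (c ∘ skip i)) := by
    intro p q
    have h1 : i < j + 2 := by omega
    have h2 : i + 1 < j + 2 := by omega
    unfold cupOp
    congr 1
    · simp [ins, h1, h2]
    · congr 1
      refine eq_ins hj ?_ ?_ ?_
      · have h3 : ¬ j < i := by omega
        simp [ins, skip, h3]
      · have h3 : ¬ j + 1 < i := by omega
        simp [ins, skip, h3]
      · funext k
        simp only [Function.comp_apply, ← skip_skip hij, ins_skip]
  unfold capOp
  simp only [key]
  simp only [cupOp, Finset.mul_sum]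
  exact Finset.sum_congr rfl fun p _ => Finset.sum_congr rfl fun q _ => by ring

theorem capOp_cupOp_far_right {j : ℕ} (hij : i ≤ j) (hj : j ≤ n)
    (v : (Fin (n + 2) → Bool) → R) :
    capOp (by omega : i ≤ n + 2) M' (cupOp (by omega : j + 2 ≤ n + 2) M v) =
      cupOp hj M (capOp (by omega : i ≤ n) M' v) := by
  funext c
  have key : ∀ p q, cupOp (by omega : j + 2 ≤ n + 2) M v (ins (by omega : i ≤ n + 2) p q c) =
      M (c ⟨j, by omega⟩) (c ⟨j + 1, by omega⟩) *
        v (ins (by omega : i ≤ n) p q (c ∘ skip j)) := by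
    intro p q
    have h1 : ¬ j + 2 < i := by omega
    have h2 : ¬ j + 2 + 1 < i := by omega
    have h3 : ¬ j + 2 = i := by omega
    have h4 : ¬ j + 2 + 1 = i := by omega
    have h5 : ¬ j + 2 = i + 1 := by omega
    have h6 : ¬ j + 2 = i := by omega
    unfold cupOp
    congr 1
    · simp [ins, h1, h2, h3, h4, h5]
    · congr 1
      refine eq_ins _ ?_ ?_ ?_
      · have h3 : i < j + 2 := by omega
        simp [ins, skip, h3]
      · have h3 : i + 1 < j + 2 := by omega
        simp [ins, skip, h3]
      · funext k
        simp only [Function.comp_apply, skip_skip hij, ins_skip]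
  unfold capOp
  simp only [key]
  simp only [cupOp, Finset.mul_sum]
  exact Finset.sum_congr rfl fun p _ => Finset.sum_congr rfl fun q _ => by ring

end relations

end Word

/-! ### The colouring matrices of elementary diagrams -/

namespace Conn

open Word

/-- The weight of an arc for unoriented colourings: both ends have the same colour. -/
def same (p q : Bool) : ℕ := if p = q then 1 else 0

theorem sum_same_same (p q : Bool) : ∑ s, same p s * same s q = if p = q then 1 else 0 := by
  cases p <;> cases q <;> rfl

theorem sum_same_sq : ∑ p, ∑ q, same p q * same p q = 2 := by decide

open Classical in
theorem mat_apply {α β : Type} (f : Setoid (α ⊕ β)) (a : α → Bool) (b : β → Bool) :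
    mat f a b = if f ≤ Setoid.ker (Sum.elim a b) then 1 else 0 := rfl

theorem tensor_le_ker {m n m' n' : ℕ} (f : Setoid (Fin m ⊕ Fin n)) (g : Setoid (Fin m' ⊕ Fin n'))
    (a : Fin (m + m') → Bool) (b : Fin (n + n') → Bool) :
    tensor f g ≤ Setoid.ker (Sum.elim a b) ↔
      f ≤ Setoid.ker (Sum.elim (a ∘ Fin.castAdd m') (b ∘ Fin.castAdd n')) ∧
      g ≤ Setoid.ker (Sum.elim (a ∘ Fin.natAdd m) (b ∘ Fin.natAdd n)) := by
  set e := (Equiv.sumCongr finSumFinEquiv.symm finSumFinEquiv.symm).trans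
    (Equiv.sumSumSumComm (Fin m) (Fin m') (Fin n) (Fin n')) with he
  have key : ∀ x y, tensor f g x y ↔ Sum.LiftRel f g (e x) (e y) := fun _ _ => Iff.rfl
  have hl : ∀ x, e (Sum.map (Fin.castAdd m') (Fin.castAdd n') x) = Sum.inl x := by
    rintro (x | x) <;> simp [he]
  have hr : ∀ x, e (Sum.map (Fin.natAdd m) (Fin.natAdd n) x) = Sum.inr x := by
    rintro (x | x) <;> simp [he]
  constructor
  · intro h
    constructor
    · intro x y hxy
      have := h ((key (Sum.map _ _ x) (Sum.map _ _ y)).2 (by rw [hl x, hl y]; exact .inl hxy))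
      rcases x with x | x <;> rcases y with y | y <;> exact this
    · intro x y hxy
      have := h ((key (Sum.map _ _ x) (Sum.map _ _ y)).2 (by rw [hr x, hr y]; exact .inr hxy))
      rcases x with x | x <;> rcases y with y | y <;> exact this
  · rintro ⟨hf, hg⟩ x y hxy
    have h' := (key x y).1 hxy
    obtain ⟨x, rfl⟩ := e.symm.surjective x
    obtain ⟨y, rfl⟩ := e.symm.surjective y
    rw [e.apply_symm_apply, e.apply_symm_apply] at h'
    rcases h' with ⟨h'⟩ | ⟨h'⟩
    · rename_i x y
      have := hf h'
      rcases x with x | x <;> rcases y with y | y <;> exact this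
    · rename_i x y
      have := hg h'
      rcases x with x | x <;> rcases y with y | y <;> exact this

theorem mat_tensor {m n m' n' : ℕ} (f : Setoid (Fin m ⊕ Fin n)) (g : Setoid (Fin m' ⊕ Fin n'))
    (a : Fin (m + m') → Bool) (b : Fin (n + n') → Bool) :
    mat (tensor f g) a b = mat f (a ∘ Fin.castAdd m') (b ∘ Fin.castAdd n') *
      mat g (a ∘ Fin.natAdd m) (b ∘ Fin.natAdd n) := by
  classical
  simp only [mat_apply, tensor_le_ker, ite_and]
  split_ifs <;> rfl

theorem sum_append {R : Type*} [AddCommMonoid R] {m n : ℕ} (F : (Fin (m + n) → Bool) → R) :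
    ∑ b, F b = ∑ b1, ∑ b2, F (Fin.append b1 b2) := by
  rw [← (Fin.appendEquiv m n).sum_comp, Fintype.sum_prod_type]
  rfl

/-- The interchange law for colouring matrices. -/
theorem mat_tensor_mul {m n k m' n' k' : ℕ} (f : Setoid (Fin m ⊕ Fin n))
    (g : Setoid (Fin m' ⊕ Fin n')) (f' : Setoid (Fin n ⊕ Fin k)) (g' : Setoid (Fin n' ⊕ Fin k')) :
    mat (tensor f g) * mat (tensor f' g') =
      2 ^ (loops f f' + loops g g') • mat (tensor (comp f f') (comp g g')) := by
  ext a c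
  have h1 := congrFun (congrFun (mat_mul f f') (a ∘ Fin.castAdd m')) (c ∘ Fin.castAdd k')
  have h2 := congrFun (congrFun (mat_mul g g') (a ∘ Fin.natAdd m)) (c ∘ Fin.natAdd k)
  rw [Matrix.mul_apply, sum_append]
  simp only [mat_tensor, Matrix.smul_apply, smul_eq_mul]
  rw [pow_add, mul_mul_mul_comm, ← smul_eq_mul (2 ^ loops f f'), ← smul_eq_mul (2 ^ loops g g'),
    ← Matrix.smul_apply, ← Matrix.smul_apply, ← h1, ← h2, Matrix.mul_apply, Matrix.mul_apply,
    Finset.sum_mul_sum]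
  refine Finset.sum_congr rfl fun b1 _ => Finset.sum_congr rfl fun b2 _ => ?_
  have e1 : Fin.append b1 b2 ∘ Fin.castAdd n' = b1 := by funext; simp
  have e2 : Fin.append b1 b2 ∘ Fin.natAdd n = b2 := by funext; simp
  rw [e1, e2]
  ring

/-- The cup at the positions `i` and `i + 1`, with vertical strands elsewhere. -/
def cupAt (n i : ℕ) : Setoid (Fin n ⊕ Fin (n + 2)) :=
  Setoid.ker (Sum.elim (fun k => (skip i k).1) (fun k => if k.1 = i + 1 then i else k.1))

/-- The cap at the positions `i` and `i + 1`, with vertical strands elsewhere. -/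
def capAt (n i : ℕ) : Setoid (Fin (n + 2) ⊕ Fin n) :=
  (cupAt n i).comap Sum.swap

theorem cupAt_le_ker {n i : ℕ} (h : i ≤ n) (a : Fin n → Bool) (b : Fin (n + 2) → Bool) :
    cupAt n i ≤ Setoid.ker (Sum.elim a b) ↔
      b ⟨i, by omega⟩ = b ⟨i + 1, by omega⟩ ∧ a = b ∘ skip i := by
  constructor
  · intro hle
    constructor
    · have : cupAt n i (Sum.inr ⟨i, by omega⟩) (Sum.inr ⟨i + 1, by omega⟩) := by
        change (if i = i + 1 then i else i) = if i + 1 = i + 1 then i else i + 1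
        simp
      exact hle this
    · funext k
      have : cupAt n i (Sum.inl k) (Sum.inr (skip i k)) := by
        change (skip i k).1 = if (skip i k).1 = i + 1 then i else (skip i k).1
        simp only [skip]
        split_ifs <;> omega
      exact hle this
  · rintro ⟨h1, rfl⟩
    have key : ∀ x : Fin n ⊕ Fin (n + 2), ∃ y : Fin (n + 2),
        Sum.elim (fun k => (skip i k).1) (fun k => if k.1 = i + 1 then i else k.1) x = y.1 ∧
        Sum.elim (b ∘ skip i) b x = b y := by
      rintro (x | x)
      · exact ⟨skip i x, rfl, rfl⟩
      · by_cases hx : x.1 = i + 1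
        · refine ⟨⟨i, by omega⟩, by simp [hx], ?_⟩
          rw [h1]
          exact congrArg b (Fin.ext hx)
        · exact ⟨x, by simp [hx], rfl⟩
    intro x y hxy
    obtain ⟨x', hx1, hx2⟩ := key x
    obtain ⟨y', hy1, hy2⟩ := key y
    have : x' = y' := Fin.ext (by rw [← hx1, ← hy1]; exact hxy)
    change Sum.elim _ _ x = Sum.elim _ _ y
    rw [hx2, hy2, this]

theorem mat_cupAt {n i : ℕ} (h : i ≤ n) (a : Fin n → Bool) (b : Fin (n + 2) → Bool) :
    mat (cupAt n i) a b = same (b ⟨i, by omega⟩) (b ⟨i + 1, by omega⟩) *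
      if a = b ∘ skip i then 1 else 0 := by
  classical
  simp only [mat_apply, cupAt_le_ker h, same, ite_and]
  split_ifs <;> rfl

theorem mat_comap_swap {α β : Type} (f : Setoid (α ⊕ β)) (a : α → Bool) (b : β → Bool) :
    mat (f.comap Sum.swap) b a = mat f a b := by
  classical
  have : f.comap Sum.swap ≤ Setoid.ker (Sum.elim b a) ↔ f ≤ Setoid.ker (Sum.elim a b) := by
    constructor
    · intro h x y hxy
      have h' : f.comap Sum.swap (Sum.swap x) (Sum.swap y) := by
        simpa [Setoid.comap_rel] using hxy
      have := h h'
      rcases x with x | x <;> rcases y with y | y <;> exact this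
    · intro h x y hxy
      have := h hxy
      rcases x with x | x <;> rcases y with y | y <;> exact this
  simp only [mat_apply, this]

theorem mat_capAt {n i : ℕ} (h : i ≤ n) (a : Fin (n + 2) → Bool) (b : Fin n → Bool) :
    mat (capAt n i) a b = same (a ⟨i, by omega⟩) (a ⟨i + 1, by omega⟩) *
      if b = a ∘ skip i then 1 else 0 := by
  rw [capAt, mat_comap_swap, mat_cupAt h]

theorem mul_mat_cupAt {α : Type} {n i : ℕ} (h : i ≤ n) (M : Matrix α (Fin n → Bool) ℕ) (a : α) :
    (M * mat (cupAt n i)) a = cupOp h same (M a) := by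
  funext b
  rw [Matrix.mul_apply]
  simp only [mat_cupAt h, cupOp, mul_ite, mul_one, mul_zero, Finset.sum_ite_eq', Finset.mem_univ,
    if_true]
  exact mul_comm _ _

theorem mul_mat_capAt {α : Type} {n i : ℕ} (h : i ≤ n) (M : Matrix α (Fin (n + 2) → Bool) ℕ)
    (a : α) : (M * mat (capAt n i)) a = capOp h same (M a) := by
  funext c
  rw [Matrix.mul_apply, sum_ins h]
  simp only [mat_capAt h, capOp, ins_left, ins_right, ins_comp_skip, mul_ite, mul_one, mul_zero,
    Finset.sum_ite_eq, Finset.mem_univ, if_true]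
  exact Finset.sum_congr rfl fun p _ => Finset.sum_congr rfl fun q _ => mul_comm _ _

theorem mat_cupAt_mul_capAt {n i : ℕ} (h : i ≤ n) : mat (cupAt n i) * mat (capAt n i) = 2 • 1 := by
  rw [← Matrix.one_mul (mat (cupAt n i))]
  ext a : 1
  rw [mul_mat_capAt h, mul_mat_cupAt h, capOp_cupOp_self, sum_same_sq]
  rfl

theorem mat_cupAt_mul_capAt_succ {n i : ℕ} (h : i + 1 ≤ n) :
    mat (cupAt n i) * mat (capAt n (i + 1)) = 1 := by
  rw [← Matrix.one_mul (mat (cupAt n i))]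
  ext a : 1
  rw [mul_mat_capAt h, mul_mat_cupAt (by omega), capOp_succ_cupOp _ _ sum_same_same]

theorem mat_cupAt_succ_mul_capAt {n i : ℕ} (h : i + 1 ≤ n) :
    mat (cupAt n (i + 1)) * mat (capAt n i) = 1 := by
  rw [← Matrix.one_mul (mat (cupAt n (i + 1)))]
  ext a : 1
  rw [mul_mat_capAt (by omega), mul_mat_cupAt h, capOp_cupOp_succ _ _ sum_same_same]

theorem mat_cupAt_mul_cupAt {n i j : ℕ} (hij : i ≤ j) (hj : j ≤ n) :
    mat (cupAt n i) * mat (cupAt (n + 2) (j + 2)) = mat (cupAt n j) * mat (cupAt (n + 2) i) := by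
  rw [← Matrix.one_mul (mat (cupAt n i)), ← Matrix.one_mul (mat (cupAt n j))]
  ext a : 1
  rw [mul_mat_cupAt (by omega), mul_mat_cupAt (by omega), mul_mat_cupAt (by omega),
    mul_mat_cupAt (by omega), cupOp_cupOp same hij hj]

theorem mat_cupAt_mul_capAt_far_right {n i j : ℕ} (hij : i ≤ j) (hj : j ≤ n) :
    mat (cupAt (n + 2) i) * mat (capAt (n + 2) (j + 2)) = mat (capAt n j) * mat (cupAt n i) := by
  rw [← Matrix.one_mul (mat (cupAt (n + 2) i)), ← Matrix.one_mul (mat (capAt n j))]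
  ext a : 1
  rw [mul_mat_capAt (by omega), mul_mat_cupAt (by omega), mul_mat_cupAt (by omega),
    mul_mat_capAt (by omega), capOp_far_right_cupOp same same hij hj]

theorem mat_cupAt_far_right_mul_capAt {n i j : ℕ} (hij : i ≤ j) (hj : j ≤ n) :
    mat (cupAt (n + 2) (j + 2)) * mat (capAt (n + 2) i) = mat (capAt n i) * mat (cupAt n j) := by
  rw [← Matrix.one_mul (mat (cupAt (n + 2) (j + 2))), ← Matrix.one_mul (mat (capAt n i))]
  ext a : 1
  rw [mul_mat_capAt (by omega), mul_mat_cupAt (by omega), mul_mat_cupAt (by omega),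
    mul_mat_capAt (by omega), capOp_cupOp_far_right same same hij hj]

theorem tensor_one_cupAt (k : ℕ) {n i : ℕ} (h : i ≤ n) :
    tensor (one (Fin k)) (cupAt n i) = cupAt (k + n) (k + i) := by
  refine (mat_inj (i := 0) (j := 0) ?_).1
  rw [pow_zero, one_smul, one_smul]
  ext a b
  refine Eq.trans ?_ (mat_cupAt (n := k + n) (i := k + i) (by omega) a b).symm
  rw [mat_tensor, mat_cupAt h, mat_one, Matrix.one_apply]
  have e : a = b ∘ skip (k + i) ↔ a ∘ Fin.castAdd n = b ∘ Fin.castAdd (n + 2) ∧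
      a ∘ Fin.natAdd k = (b ∘ Fin.natAdd k) ∘ skip i := by
    constructor
    · rintro rfl
      constructor
      · funext x
        have : x.1 < k + i := by omega
        simp only [Function.comp_apply, skip, Fin.val_castAdd, this, if_true]
        rfl
      · funext x
        simp only [Function.comp_apply, skip, Fin.val_natAdd]
        congr 1
        apply Fin.ext
        simp only [Fin.val_natAdd]
        split_ifs <;> omega
    · rintro ⟨h1, h2⟩
      funext x
      refine Fin.addCases (fun x => ?_) (fun x => ?_) x
      · have := congrFun h1 x
        simp only [Function.comp_apply] at this ⊢
        rw [this]
        congr 1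
        apply Fin.ext
        have : x.1 < k + i := by omega
        simp [skip, this]
      · have := congrFun h2 x
        simp only [Function.comp_apply] at this ⊢
        rw [this]
        congr 1
        apply Fin.ext
        simp only [skip, Fin.val_natAdd]
        split_ifs <;> omega
  have e2 : same ((b ∘ Fin.natAdd k) ⟨i, by omega⟩) ((b ∘ Fin.natAdd k) ⟨i + 1, by omega⟩) =
      same (b ⟨k + i, by omega⟩) (b ⟨k + i + 1, by omega⟩) := rfl
  rw [e2]
  simp only [e, ite_and]
  split_ifs <;> simp

theorem mat_tensor_one_one {m n : ℕ} (f : Setoid (Fin m ⊕ Fin n)) (a : Fin (m + 1) → Bool)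
    (b : Fin (n + 1) → Bool) :
    mat (tensor f (one (Fin 1))) a b = mat f (a ∘ Fin.castSucc) (b ∘ Fin.castSucc) *
      if a (Fin.last m) = b (Fin.last n) then 1 else 0 := by
  rw [mat_tensor, mat_one, Matrix.one_apply]
  congr 1
  have : a ∘ Fin.natAdd m = b ∘ Fin.natAdd n ↔ a (Fin.last m) = b (Fin.last n) := by
    rw [funext_iff, Fin.forall_fin_one]
    rfl
  simp only [this]

theorem tensor_cupAt_one {n i : ℕ} (h : i ≤ n) :
    tensor (cupAt n i) (one (Fin 1)) = cupAt (n + 1) i := by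
  refine (mat_inj (i := 0) (j := 0) ?_).1
  rw [pow_zero, one_smul, one_smul]
  ext a b
  refine (mat_tensor_one_one (cupAt n i) a b).trans ?_
  rw [mat_cupAt h]
  refine Eq.trans ?_ (mat_cupAt (n := n + 1) (i := i) (by omega) a b).symm
  have e : a = b ∘ skip i ↔ a ∘ Fin.castSucc = (b ∘ Fin.castSucc) ∘ skip i ∧
      a (Fin.last n) = b (Fin.last (n + 2)) := by
    have hl : skip i (Fin.last n) = Fin.last (n + 2) := by
      apply Fin.ext
      have : ¬ n < i := by omega
      simp [skip, this]
    have hc : ∀ x : Fin n, skip i (Fin.castSucc x) = Fin.castSucc (skip i x) := fun _ => rfl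
    rw [funext_iff, Fin.forall_fin_succ', funext_iff]
    simp only [Function.comp_apply, hl, hc]
  have e2 : same ((b ∘ Fin.castSucc) ⟨i, by omega⟩) ((b ∘ Fin.castSucc) ⟨i + 1, by omega⟩) =
      same (b ⟨i, by omega⟩) (b ⟨i + 1, by omega⟩) := rfl
  rw [e2]
  simp only [e, ite_and]
  split_ifs <;> simp

end Conn

/-! ### Normal forms of diagrams -/

namespace Conn

theorem eq_of_mat {α β : Type} {f g : Setoid (α ⊕ β)} (h : mat f = mat g) : f = g :=
  (mat_inj (i := 0) (j := 0) (by rw [h])).1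

/-- A stack of diagrams and its number of loops can be read off from the product of the matrices. -/
theorem comp_of_mat {α β γ : Type} [Fintype α] [Fintype β] [Fintype γ] [DecidableEq β]
    {f : Setoid (α ⊕ β)} {g : Setoid (β ⊕ γ)} {h : Setoid (α ⊕ γ)} {l : ℕ}
    (e : mat f * mat g = 2 ^ l • mat h) : comp f g = h ∧ loops f g = l :=
  mat_inj (by rw [← mat_mul, e])

theorem comp_of_mat_mul {α β γ δ : Type} [Fintype α] [Fintype β] [Fintype γ] [Fintype δ]
    [DecidableEq β] [DecidableEq δ] {f : Setoid (α ⊕ β)} {g : Setoid (β ⊕ γ)}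
    {f' : Setoid (α ⊕ δ)} {g' : Setoid (δ ⊕ γ)}
    (e : mat f * mat g = mat f' * mat g') : comp f g = comp f' g' ∧ loops f g = loops f' g' :=
  mat_inj (by rw [← mat_mul, e, mat_mul])

theorem mat_swap {α β : Type} (f : Setoid (α ⊕ β)) :
    mat (f.comap Sum.swap) = (mat f).transpose := by
  ext b a
  rw [mat_comap_swap]
  rfl

theorem comp_swap {α β γ : Type} [Fintype α] [Fintype β] [Fintype γ] [DecidableEq β]
    (f : Setoid (α ⊕ β)) (g : Setoid (β ⊕ γ)) :
    comp (g.comap Sum.swap) (f.comap Sum.swap) = (comp f g).comap Sum.swap :=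
  (comp_of_mat (l := loops f g) (by
    rw [mat_swap, mat_swap, mat_swap, ← Matrix.transpose_mul, mat_mul, Matrix.transpose_smul])).1

theorem tensor_swap {m n m' n' : ℕ} (f : Setoid (Fin m ⊕ Fin n)) (g : Setoid (Fin m' ⊕ Fin n')) :
    tensor (f.comap Sum.swap) (g.comap Sum.swap) = (tensor f g).comap Sum.swap := by
  apply eq_of_mat
  ext b a
  rw [mat_tensor, mat_comap_swap, mat_comap_swap, mat_comap_swap, mat_tensor]

theorem one_swap (α : Type) [Fintype α] [DecidableEq α] : (one α).comap Sum.swap = one α := by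
  apply eq_of_mat
  rw [mat_swap, mat_one, Matrix.transpose_one]

theorem tensor_comp {m n k m' n' k' : ℕ} (f : Setoid (Fin m ⊕ Fin n))
    (g : Setoid (Fin m' ⊕ Fin n')) (f' : Setoid (Fin n ⊕ Fin k)) (g' : Setoid (Fin n' ⊕ Fin k')) :
    comp (tensor f g) (tensor f' g') = tensor (comp f f') (comp g g') ∧
      loops (tensor f g) (tensor f' g') = loops f f' + loops g g' :=
  comp_of_mat (mat_tensor_mul f g f' g')

theorem tensor_one_one (m n : ℕ) : tensor (one (Fin m)) (one (Fin n)) = one (Fin (m + n)) := by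
  apply eq_of_mat
  ext a b
  rw [mat_tensor, mat_one, mat_one, mat_one]
  simp only [Matrix.one_apply]
  have : a = b ↔ a ∘ Fin.castAdd n = b ∘ Fin.castAdd n ∧ a ∘ Fin.natAdd m = b ∘ Fin.natAdd m := by
    constructor
    · rintro rfl; exact ⟨rfl, rfl⟩
    · rintro ⟨h1, h2⟩
      funext x
      exact Fin.addCases (fun x => congrFun h1 x) (fun x => congrFun h2 x) x
  simp only [this, ite_and]
  split_ifs <;> simp

theorem tensor_one_zero {m n : ℕ} (f : Setoid (Fin m ⊕ Fin n)) :
    tensor f (one (Fin 0)) = f := by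
  apply eq_of_mat
  ext a b
  refine (mat_tensor f (one (Fin 0)) a b).trans ?_
  rw [mat_one, Subsingleton.elim (a ∘ Fin.natAdd m) (b ∘ Fin.natAdd n), Matrix.one_apply_eq,
    mul_one]
  rfl

theorem tensor_one_succ {m n : ℕ} (f : Setoid (Fin m ⊕ Fin n)) (k : ℕ) :
    tensor f (one (Fin (k + 1))) = tensor (tensor f (one (Fin k))) (one (Fin 1)) := by
  apply eq_of_mat
  ext a b
  rw [mat_tensor]
  refine Eq.trans ?_ (mat_tensor_one_one (tensor f (one (Fin k))) a b).symm
  rw [mat_tensor, mat_one, mat_one, mul_assoc, Matrix.one_apply, Matrix.one_apply]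
  congr 1
  have : a ∘ Fin.natAdd m = b ∘ Fin.natAdd n ↔
      (a ∘ Fin.castSucc) ∘ Fin.natAdd m = (b ∘ Fin.castSucc) ∘ Fin.natAdd n ∧
      a (Fin.last (m + k)) = b (Fin.last (n + k)) := by
    rw [funext_iff, Fin.forall_fin_succ', funext_iff]
    rfl
  simp only [this, ite_and]
  split_ifs <;> simp

theorem mat_const {α β : Type} (f : Setoid (α ⊕ β)) : mat f (fun _ => true) (fun _ => true) = 1 := by
  classical
  rw [mat_apply, if_pos]
  rintro (x | x) (y | y) _ <;> rfl

/-- A cup on top closes no loop: a monochromatic entry of the product of the matrices is `1`. -/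
theorem loops_cupAt {α : Type} [Fintype α] {n i : ℕ} (f : Setoid (α ⊕ Fin n)) (h : i ≤ n) :
    loops f (cupAt n i) = 0 := by
  have e := congrFun (congrFun (mat_mul f (cupAt n i)) (fun _ => true)) (fun _ => true)
  rw [mul_mat_cupAt h, Matrix.smul_apply, mat_const, Word.cupOp] at e
  have h1 : mat f (fun _ => true) ((fun _ => true) ∘ Word.skip i) = 1 := mat_const f
  rw [h1] at e
  exact Nat.pow_right_injective le_rfl (by simpa [same] using e.symm)

theorem cupAt_zero : cupAt 0 0 = ⊤ := by
  ext x y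
  refine ⟨fun _ => trivial, fun _ => ?_⟩
  rcases x with x | x
  · exact x.elim0
  rcases y with y | y
  · exact y.elim0
  change (if x.1 = 1 then 0 else x.1) = if y.1 = 1 then 0 else y.1
  split_ifs <;> omega

end Conn

theorem IsPlanar.swap {m n : ℕ} {f : Setoid (Fin m ⊕ Fin n)} (h : IsPlanar f) :
    IsPlanar (f.comap Sum.swap) := by
  induction h with
  | one n => rw [Conn.one_swap]; exact .one n
  | cup => exact .cap
  | cap => exact .cup
  | comp _ _ h1 h2 => rw [← Conn.comp_swap]; exact .comp h2 h1
  | tensor _ _ h1 h2 => rw [← Conn.tensor_swap]; exact .tensor h1 h2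

theorem isPlanar_cupAt (i b : ℕ) : IsPlanar (Conn.cupAt (i + b) i) := by
  induction b with
  | zero =>
    have h := Conn.tensor_one_cupAt i (le_refl 0)
    have h2 : IsPlanar (Conn.tensor (Conn.one (Fin i)) (Conn.cupAt 0 0)) := by
      rw [Conn.cupAt_zero]
      exact .tensor (.one i) .cup
    rw [h] at h2
    exact h2
  | succ b ih =>
    have h := Conn.tensor_cupAt_one (Nat.le_add_right i b)
    have h2 := IsPlanar.tensor ih (.one 1)
    rw [h] at h2
    exact h2

namespace TLDiagram

/-- The cup at the positions `i` and `i + 1`. -/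
def cupAt (n i : ℕ) (h : i ≤ n) : TLDiagram n (n + 2) :=
  ⟨Conn.cupAt n i, by obtain ⟨b, rfl⟩ := Nat.exists_eq_add_of_le h; exact isPlanar_cupAt i b⟩

/-- The cap at the positions `i` and `i + 1`. -/
def capAt (n i : ℕ) (h : i ≤ n) : TLDiagram (n + 2) n :=
  ⟨Conn.capAt n i, (cupAt n i h).2.swap⟩

/-- Reflection in a horizontal line. -/
def swap {m n : ℕ} (f : TLDiagram m n) : TLDiagram n m := ⟨_, f.2.swap⟩

theorem swap_swap {m n : ℕ} (f : TLDiagram m n) : f.swap.swap = f := by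
  apply Subtype.ext
  apply Conn.eq_of_mat
  change Conn.mat ((f.1.comap Sum.swap).comap Sum.swap) = _
  rw [Conn.mat_swap, Conn.mat_swap, Matrix.transpose_transpose]

theorem comp_assoc {m n k l : ℕ} (f : TLDiagram m n) (g : TLDiagram n k) (h : TLDiagram k l) :
    (f.comp g).comp h = f.comp (g.comp h) :=
  Subtype.ext (Conn.assoc f.1 g.1 h.1).1

theorem one_comp {m n : ℕ} (f : TLDiagram m n) : (one m).comp f = f :=
  Subtype.ext (Conn.one_comp f.1).1

theorem comp_one {m n : ℕ} (f : TLDiagram m n) : f.comp (one n) = f :=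
  Subtype.ext (Conn.comp_one f.1).1

theorem swap_comp {m n k : ℕ} (f : TLDiagram m n) (g : TLDiagram n k) :
    (f.comp g).swap = g.swap.comp f.swap :=
  Subtype.ext (Conn.comp_swap f.1 g.1).symm

theorem swap_one (n : ℕ) : (one n).swap = one n := Subtype.ext (Conn.one_swap _)

theorem comp_tensor {m n k m' n' k' : ℕ} (f : TLDiagram m n) (g : TLDiagram m' n')
    (f' : TLDiagram n k) (g' : TLDiagram n' k') :
    (f.tensor g).comp (f'.tensor g') = (f.comp f').tensor (g.comp g') :=
  Subtype.ext (Conn.tensor_comp f.1 g.1 f'.1 g'.1).1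

theorem tensor_one_zero {m n : ℕ} (f : TLDiagram m n) : f.tensor (one 0) = f :=
  Subtype.ext (Conn.tensor_one_zero f.1)

theorem tensor_one_succ {m n : ℕ} (f : TLDiagram m n) (k : ℕ) :
    f.tensor (one (k + 1)) = (f.tensor (one k)).tensor (one 1) :=
  Subtype.ext (Conn.tensor_one_succ f.1 k)

theorem one_tensor_one (m n : ℕ) : (one m).tensor (one n) = one (m + n) :=
  Subtype.ext (Conn.tensor_one_one m n)

theorem one_tensor_cupAt (k : ℕ) {n i : ℕ} (h : i ≤ n) :
    (one k).tensor (cupAt n i h) = cupAt (k + n) (k + i) (by omega) :=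
  Subtype.ext (Conn.tensor_one_cupAt k h)

theorem cupAt_tensor_one {n i : ℕ} (h : i ≤ n) :
    (cupAt n i h).tensor (one 1) = cupAt (n + 1) i (by omega) :=
  Subtype.ext (Conn.tensor_cupAt_one h)

theorem swap_tensor {m n m' n' : ℕ} (f : TLDiagram m n) (g : TLDiagram m' n') :
    (f.tensor g).swap = f.swap.tensor g.swap :=
  Subtype.ext (Conn.tensor_swap f.1 g.1).symm

theorem swap_cupAt {n i : ℕ} (h : i ≤ n) : (cupAt n i h).swap = capAt n i h := rfl

theorem swap_capAt {n i : ℕ} (h : i ≤ n) : (capAt n i h).swap = cupAt n i h :=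
  swap_swap (cupAt n i h)

theorem one_tensor_capAt (k : ℕ) {n i : ℕ} (h : i ≤ n) :
    (one k).tensor (capAt n i h) = capAt (k + n) (k + i) (by omega) := by
  have := congrArg swap (one_tensor_cupAt k h)
  rwa [swap_tensor, swap_one, swap_cupAt] at this

theorem capAt_tensor_one {n i : ℕ} (h : i ≤ n) :
    (capAt n i h).tensor (one 1) = capAt (n + 1) i (by omega) := by
  have := congrArg swap (cupAt_tensor_one h)
  rwa [swap_tensor, swap_one, swap_cupAt] at this

theorem cupAt_zero : cupAt 0 0 le_rfl = cup := Subtype.ext Conn.cupAt_zero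

theorem capAt_zero : capAt 0 0 le_rfl = cap := by
  rw [← swap_cupAt, cupAt_zero]
  rfl

theorem cupAt_comp_cupAt {n i j : ℕ} (hij : i ≤ j) (hj : j ≤ n) :
    (cupAt n i (by omega)).comp (cupAt (n + 2) (j + 2) (by omega)) =
      (cupAt n j hj).comp (cupAt (n + 2) i (by omega)) :=
  Subtype.ext (Conn.comp_of_mat_mul (Conn.mat_cupAt_mul_cupAt hij hj)).1

/-- Diagrams that are built from elementary cups and caps. -/
inductive Gen : ∀ {m n : ℕ}, TLDiagram m n → Prop
  | one (n : ℕ) : Gen (one n)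
  | cup {m n i : ℕ} {f : TLDiagram m n} (h : i ≤ n) : Gen f → Gen (f.comp (cupAt n i h))
  | cap {m n i : ℕ} {f : TLDiagram m (n + 2)} (h : i ≤ n) : Gen f → Gen (f.comp (capAt n i h))

theorem Gen.comp {m n k : ℕ} {f : TLDiagram m n} {g : TLDiagram n k} (hf : Gen f) (hg : Gen g) :
    Gen (f.comp g) := by
  induction hg with
  | one => rwa [comp_one]
  | cup h _ ih => rw [← comp_assoc]; exact .cup h ih
  | cap h _ ih => rw [← comp_assoc]; exact .cap h ih

theorem Gen.tensor_one_one {m n : ℕ} {f : TLDiagram m n} (hf : Gen f) :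
    Gen (f.tensor (TLDiagram.one 1)) := by
  induction hf with
  | one => rw [one_tensor_one]; exact .one _
  | cup h _ ih =>
    rw [← comp_one (TLDiagram.one 1), ← comp_tensor, cupAt_tensor_one]
    exact .cup _ ih
  | cap h _ ih =>
    rw [← comp_one (TLDiagram.one 1), ← comp_tensor, capAt_tensor_one]
    exact .cap _ ih

theorem Gen.tensor_one {m n : ℕ} {f : TLDiagram m n} (hf : Gen f) (k : ℕ) :
    Gen (f.tensor (TLDiagram.one k)) := by
  induction k with
  | zero => rwa [tensor_one_zero]
  | succ k ih => rw [tensor_one_succ]; exact ih.tensor_one_one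

theorem Gen.one_tensor {m n : ℕ} {f : TLDiagram m n} (hf : Gen f) (k : ℕ) :
    Gen ((TLDiagram.one k).tensor f) := by
  induction hf with
  | one => rw [one_tensor_one]; exact .one _
  | cup h _ ih =>
    rw [← comp_one (TLDiagram.one k), ← comp_tensor, one_tensor_cupAt]
    exact .cup _ ih
  | cap h _ ih =>
    rw [← comp_one (TLDiagram.one k), ← comp_tensor, one_tensor_capAt]
    exact .cap _ ih

theorem gen {m n : ℕ} (f : TLDiagram m n) : Gen f := by
  obtain ⟨f, hf⟩ := f
  induction hf with
  | one n => exact .one n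
  | cup =>
    have := Gen.cup le_rfl (.one 0)
    rw [one_comp, cupAt_zero] at this
    exact this
  | cap =>
    have := Gen.cap le_rfl (.one 2)
    rw [one_comp, capAt_zero] at this
    exact this
  | comp hf hg ihf ihg => exact ihf.comp ihg
  | @tensor m n m' n' f g hf hg ihf ihg =>
    let F : TLDiagram m n := ⟨f, hf⟩
    let G : TLDiagram m' n' := ⟨g, hg⟩
    have e := comp_tensor F (TLDiagram.one m') (TLDiagram.one n) G
    rw [comp_one, one_comp] at e
    have := (ihf.tensor_one m').comp (ihg.one_tensor n)
    rw [e] at this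
    exact this

/-- Diagrams that are built from caps only. -/
inductive CapOnly : ∀ {m n : ℕ}, TLDiagram m n → Prop
  | one (n : ℕ) : CapOnly (one n)
  | cap {m n i : ℕ} {f : TLDiagram m (n + 2)} (h : i ≤ n) : CapOnly f →
      CapOnly (f.comp (capAt n i h))

/-- Diagrams that are built by first using caps and then cups. -/
inductive IsNormal : ∀ {m n : ℕ}, TLDiagram m n → Prop
  | base {m n : ℕ} {f : TLDiagram m n} : CapOnly f → IsNormal f
  | cup {m n i : ℕ} {f : TLDiagram m n} (h : i ≤ n) : IsNormal f → IsNormal (f.comp (cupAt n i h))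

/-- A cup below a cap disappears or moves above it: the rewriting step behind the normal form. -/
theorem comp_cupAt_comp_capAt {n i j : ℕ} (hi : i ≤ n) (hj : j ≤ n) :
    (cupAt n i hi).comp (capAt n j hj) = one n ∨
      ∃ (n' i' j' : ℕ) (hi' : i' ≤ n') (hj' : j' ≤ n') (e : n' + 2 = n),
        (cupAt n i hi).comp (capAt n j hj) =
          e ▸ (capAt n' j' hj').comp (cupAt n' i' hi') := by
  rcases lt_trichotomy i j with h | rfl | h
  · obtain rfl | h := Nat.eq_or_lt_of_le (Nat.succ_le_of_lt h)
    · exact .inl (Subtype.ext (Conn.comp_of_mat (l := 0) (by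
        rw [pow_zero, one_smul]
        exact (Conn.mat_cupAt_mul_capAt_succ hj).trans Conn.mat_one.symm)).1)
    · right
      obtain ⟨j, rfl⟩ := Nat.exists_eq_add_of_le' (show 2 ≤ j by omega)
      obtain ⟨n, rfl⟩ := Nat.exists_eq_add_of_le' (show 2 ≤ n by omega)
      exact ⟨n, i, j, by omega, by omega, rfl, Subtype.ext (Conn.comp_of_mat_mul
        (Conn.mat_cupAt_mul_capAt_far_right (by omega) (by omega))).1⟩
  · exact .inl (Subtype.ext (Conn.comp_of_mat (l := 1) (by
        rw [pow_one]
        exact (Conn.mat_cupAt_mul_capAt hj).trans (by rw [← Conn.mat_one]; rfl))).1)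
  · obtain rfl | h := Nat.eq_or_lt_of_le (Nat.succ_le_of_lt h)
    · exact .inl (Subtype.ext (Conn.comp_of_mat (l := 0) (by
        rw [pow_zero, one_smul]
        exact (Conn.mat_cupAt_succ_mul_capAt hi).trans Conn.mat_one.symm)).1)
    · right
      obtain ⟨i, rfl⟩ := Nat.exists_eq_add_of_le' (show 2 ≤ i by omega)
      obtain ⟨n, rfl⟩ := Nat.exists_eq_add_of_le' (show 2 ≤ n by omega)
      exact ⟨n, i, j, by omega, by omega, rfl, Subtype.ext (Conn.comp_of_mat_mul
        (Conn.mat_cupAt_far_right_mul_capAt (by omega) (by omega))).1⟩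

theorem IsNormal.cap {m n : ℕ} {f : TLDiagram m n} (hf : IsNormal f) :
    ∀ {n' j : ℕ} (e : n = n' + 2) (h : j ≤ n'), IsNormal ((e ▸ f).comp (capAt n' j h)) := by
  induction hf with
  | base hf => rintro n' j rfl h; exact .base (.cap h hf)
  | @cup n i f h hf ih =>
    intro n' j e hj
    obtain rfl : n = n' := by omega
    change IsNormal ((f.comp (cupAt n i h)).comp (capAt n j hj))
    rw [comp_assoc]
    rcases comp_cupAt_comp_capAt h hj with h1 | ⟨n', i', j', hi', hj', rfl, h1⟩
    · rwa [h1, comp_one]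
    · rw [h1]
      change IsNormal (f.comp ((capAt n' j' hj').comp (cupAt n' i' hi')))
      rw [← comp_assoc]
      exact .cup _ (ih rfl _)

theorem isNormal {m n : ℕ} (f : TLDiagram m n) : IsNormal f := by
  induction f.gen with
  | one => exact .base (.one _)
  | cup h _ ih => exact .cup h ih
  | cap h _ ih => exact ih.cap rfl h

theorem CapOnly.eq_one_or_lt {m n : ℕ} {f : TLDiagram m n} (hf : CapOnly f) :
    (∃ e : m = n, f = e ▸ TLDiagram.one m) ∨ n < m := by
  induction hf with
  | one => exact .inl ⟨rfl, rfl⟩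
  | cap h _ ih =>
    right
    rcases ih with ⟨rfl, -⟩ | h <;> omega

end TLDiagram

/-! ### Linear combinations of diagrams -/

namespace TL

/-- A diagram as a morphism. -/
def dia {m n : ℕ} (f : TLDiagram m n) : TLHom m n := Finsupp.single f 1

/-- The cup at the positions `i` and `i + 1`. -/
def cupAt (n i : ℕ) (h : i ≤ n) : TLHom n (n + 2) := dia (.cupAt n i h)

/-- The cap at the positions `i` and `i + 1`. -/
def capAt (n i : ℕ) (h : i ≤ n) : TLHom (n + 2) n := dia (.capAt n i h)

theorem dia_induction {m n : ℕ} {P : TLHom m n → Prop} (x : TLHom m n) (h0 : P 0)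
    (hadd : ∀ x y, P x → P y → P (x + y)) (hsmul : ∀ (c : ℂ) x, P x → P (c • x))
    (hd : ∀ f, P (dia f)) : P x := by
  induction x using Finsupp.induction_linear with
  | zero => exact h0
  | add x y hx hy => exact hadd x y hx hy
  | single f a =>
    have := hsmul a _ (hd f)
    rwa [dia, Finsupp.smul_single, smul_eq_mul, mul_one] at this

theorem dia_comp (d : ℂ) {m n k : ℕ} (f : TLDiagram m n) (g : TLDiagram n k) :
    comp d (dia f) (dia g) = d ^ f.loops g • dia (f.comp g) := by
  rw [dia, dia, comp_single, dia, Finsupp.smul_single, smul_eq_mul]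
  ring_nf

theorem comp_sub (d : ℂ) {m n k : ℕ} (x : TLHom m n) (y y' : TLHom n k) :
    comp d x (y - y') = comp d x y - comp d x y' := map_sub _ _ _

theorem sub_comp (d : ℂ) {m n k : ℕ} (x x' : TLHom m n) (y : TLHom n k) :
    comp d (x - x') y = comp d x y - comp d x' y := LinearMap.map_sub₂ _ _ _ _

/-- The tensor product as a bilinear map. -/
def tensorHom (m n m' n' : ℕ) : TLHom m n →ₗ[ℂ] TLHom m' n' →ₗ[ℂ] TLHom (m + m') (n + n') :=
  Finsupp.linearCombination ℂ fun f : TLDiagram m n =>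
    Finsupp.linearCombination ℂ fun g : TLDiagram m' n' =>
      (Finsupp.single (f.tensor g) 1 : TLHom (m + m') (n + n'))

section tensor

variable {m n m' n' : ℕ}

theorem tensor_eq (x : TLHom m n) (y : TLHom m' n') : tensor x y = tensorHom m n m' n' x y := rfl

theorem tensor_add (x : TLHom m n) (y y' : TLHom m' n') :
    tensor x (y + y') = tensor x y + tensor x y' := by simp only [tensor_eq, map_add]

theorem add_tensor (x x' : TLHom m n) (y : TLHom m' n') :
    tensor (x + x') y = tensor x y + tensor x' y := by simp only [tensor_eq, LinearMap.map_add₂]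

theorem tensor_smul (c : ℂ) (x : TLHom m n) (y : TLHom m' n') :
    tensor x (c • y) = c • tensor x y := by simp only [tensor_eq, map_smul]

theorem smul_tensor (c : ℂ) (x : TLHom m n) (y : TLHom m' n') :
    tensor (c • x) y = c • tensor x y := by simp only [tensor_eq, LinearMap.map_smul₂]

theorem tensor_zero (x : TLHom m n) : tensor x (0 : TLHom m' n') = 0 := by
  simp only [tensor_eq, map_zero]

theorem zero_tensor (y : TLHom m' n') : tensor (0 : TLHom m n) y = 0 := by
  simp only [tensor_eq, LinearMap.map_zero₂]

theorem dia_tensor (f : TLDiagram m n) (g : TLDiagram m' n') :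
    tensor (dia f) (dia g) = dia (f.tensor g) := by
  simp [tensor_eq, tensorHom, dia]

theorem one_eq (n : ℕ) : one n = dia (.one n) := rfl

theorem one_tensor_one (m n : ℕ) : tensor (one m) (one n) = one (m + n) := by
  rw [one_eq, one_eq, dia_tensor, TLDiagram.one_tensor_one, one_eq]

theorem tensor_one_zero (x : TLHom m n) : tensor x (one 0) = x := by
  induction x using dia_induction with
  | h0 => exact zero_tensor _
  | hadd x y hx hy => rw [add_tensor, hx, hy]
  | hsmul c x hx => rw [smul_tensor, hx]
  | hd f => rw [one_eq, dia_tensor, TLDiagram.tensor_one_zero]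

theorem tensor_one_succ (x : TLHom m n) (k : ℕ) :
    tensor x (one (k + 1)) = tensor (tensor x (one k)) (one 1) := by
  induction x using dia_induction with
  | h0 => simp only [zero_tensor]
  | hadd x y hx hy => simp only [add_tensor, hx, hy]
  | hsmul c x hx => simp only [smul_tensor, hx]
  | hd f =>
    rw [one_eq, dia_tensor, TLDiagram.tensor_one_succ, one_eq, dia_tensor, one_eq, dia_tensor]

/-- The interchange law. -/
theorem comp_tensor (d : ℂ) {k k' : ℕ} (x : TLHom m n) (y : TLHom m' n') (x' : TLHom n k)
    (y' : TLHom n' k') :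
    comp d (tensor x y) (tensor x' y') = tensor (comp d x x') (comp d y y') := by
  induction x using dia_induction with
  | h0 => simp only [zero_tensor, zero_comp]
  | hadd x z hx hz => simp only [add_tensor, add_comp, hx, hz]
  | hsmul c x hx => simp only [smul_tensor, smul_comp, hx]
  | hd f =>
  induction y using dia_induction with
  | h0 => simp only [tensor_zero, zero_comp]
  | hadd x z hx hz => simp only [tensor_add, add_comp, hx, hz]
  | hsmul c x hx => simp only [tensor_smul, smul_comp, hx]
  | hd g =>
  induction x' using dia_induction with
  | h0 => simp only [zero_tensor, comp_zero]
  | hadd x z hx hz => simp only [add_tensor, comp_add, hx, hz]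
  | hsmul c x hx => simp only [smul_tensor, comp_smul, hx]
  | hd f' =>
  induction y' using dia_induction with
  | h0 => simp only [tensor_zero, comp_zero]
  | hadd x z hx hz => simp only [tensor_add, comp_add, hx, hz]
  | hsmul c x hx => simp only [tensor_smul, comp_smul, hx]
  | hd g' =>
  have hl : (f.tensor g).loops (f'.tensor g') = f.loops f' + g.loops g' :=
    (Conn.tensor_comp f.1 g.1 f'.1 g'.1).2
  rw [dia_tensor, dia_tensor, dia_comp, dia_comp, dia_comp, TLDiagram.comp_tensor, hl,
    smul_tensor, tensor_smul, dia_tensor, smul_smul, pow_add]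

end tensor

/-- A vertical strand on the right. -/
def addStrand {m n : ℕ} : TLHom m n →ₗ[ℂ] TLHom (m + 1) (n + 1) :=
  (tensorHom m n 1 1).flip (one 1)

theorem addStrand_apply {m n : ℕ} (x : TLHom m n) : addStrand x = tensor x (one 1) := rfl

theorem addStrand_comp (d : ℂ) {m n k : ℕ} (x : TLHom m n) (y : TLHom n k) :
    addStrand (comp d x y) = comp d (addStrand x) (addStrand y) := by
  simp only [addStrand_apply, comp_tensor, one_comp]

theorem addStrand_one (n : ℕ) : addStrand (one n) = one (n + 1) := one_tensor_one n 1

theorem addStrand_dia {m n : ℕ} (f : TLDiagram m n) :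
    addStrand (dia f) = dia (f.tensor (.one 1)) := dia_tensor _ _

theorem addStrand_cupAt {n i : ℕ} (h : i ≤ n) :
    addStrand (cupAt n i h) = cupAt (n + 1) i (by omega) := by
  rw [cupAt, addStrand_dia, TLDiagram.cupAt_tensor_one]
  rfl

theorem addStrand_capAt {n i : ℕ} (h : i ≤ n) :
    addStrand (capAt n i h) = capAt (n + 1) i (by omega) := by
  rw [capAt, addStrand_dia, TLDiagram.capAt_tensor_one]
  rfl

section relations

variable (d : ℂ) {n i j : ℕ}

theorem cupAt_comp_capAt_self (h : i ≤ n) :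
    comp d (cupAt n i h) (capAt n i h) = d • one n := by
  obtain ⟨h1, h2⟩ := Conn.comp_of_mat (f := Conn.cupAt n i) (g := Conn.capAt n i) (l := 1)
    (h := Conn.one (Fin n)) (by
      rw [pow_one]
      exact (Conn.mat_cupAt_mul_capAt h).trans (by rw [← Conn.mat_one]))
  have e1 : (TLDiagram.cupAt n i h).comp (.capAt n i h) = .one n := Subtype.ext h1
  have e2 : (TLDiagram.cupAt n i h).loops (.capAt n i h) = 1 := h2
  rw [cupAt, capAt, dia_comp, e1, e2, pow_one, one_eq]

theorem cupAt_comp_capAt_succ (h : i + 1 ≤ n) :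
    comp d (cupAt n i (by omega)) (capAt n (i + 1) h) = one n := by
  obtain ⟨h1, h2⟩ := Conn.comp_of_mat (f := Conn.cupAt n i) (g := Conn.capAt n (i + 1)) (l := 0)
    (h := Conn.one (Fin n)) (by
      rw [pow_zero, one_smul]
      exact (Conn.mat_cupAt_mul_capAt_succ h).trans Conn.mat_one.symm)
  have e1 : (TLDiagram.cupAt n i (by omega)).comp (.capAt n (i + 1) h) = .one n := Subtype.ext h1
  have e2 : (TLDiagram.cupAt n i (by omega)).loops (.capAt n (i + 1) h) = 0 := h2
  rw [cupAt, capAt, dia_comp, e1, e2, pow_zero, one_smul, one_eq]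

theorem cupAt_succ_comp_capAt (h : i + 1 ≤ n) :
    comp d (cupAt n (i + 1) h) (capAt n i (by omega)) = one n := by
  obtain ⟨h1, h2⟩ := Conn.comp_of_mat (f := Conn.cupAt n (i + 1)) (g := Conn.capAt n i) (l := 0)
    (h := Conn.one (Fin n)) (by
      rw [pow_zero, one_smul]
      exact (Conn.mat_cupAt_succ_mul_capAt h).trans Conn.mat_one.symm)
  have e1 : (TLDiagram.cupAt n (i + 1) h).comp (.capAt n i (by omega)) = .one n := Subtype.ext h1
  have e2 : (TLDiagram.cupAt n (i + 1) h).loops (.capAt n i (by omega)) = 0 := h2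
  rw [cupAt, capAt, dia_comp, e1, e2, pow_zero, one_smul, one_eq]

theorem dia_comp_eq {m n k l : ℕ} {f : TLDiagram m n} {g : TLDiagram n k} {f' : TLDiagram m l}
    {g' : TLDiagram l k}
    (e : Conn.mat f.1 * Conn.mat g.1 = Conn.mat f'.1 * Conn.mat g'.1) :
    comp d (dia f) (dia g) = comp d (dia f') (dia g') := by
  obtain ⟨h1, h2⟩ := Conn.comp_of_mat_mul e
  have e1 : f.comp g = f'.comp g' := Subtype.ext h1
  have e2 : f.loops g = f'.loops g' := h2
  rw [dia_comp, dia_comp, e1, e2]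

theorem cupAt_comp_capAt_far_right (hij : i ≤ j) (hj : j ≤ n) :
    comp d (cupAt (n + 2) i (by omega)) (capAt (n + 2) (j + 2) (by omega)) =
      comp d (capAt n j hj) (cupAt n i (by omega)) :=
  dia_comp_eq d (Conn.mat_cupAt_mul_capAt_far_right hij hj)

theorem cupAt_far_right_comp_capAt (hij : i ≤ j) (hj : j ≤ n) :
    comp d (cupAt (n + 2) (j + 2) (by omega)) (capAt (n + 2) i (by omega)) =
      comp d (capAt n i (by omega)) (cupAt n j hj) :=
  dia_comp_eq d (Conn.mat_cupAt_far_right_mul_capAt hij hj)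

end relations

theorem dia_comp_cupAt (d : ℂ) {m n i : ℕ} (f : TLDiagram m n) (h : i ≤ n) :
    comp d (dia f) (cupAt n i h) = dia (f.comp (.cupAt n i h)) := by
  have hl : f.loops (.cupAt n i h) = 0 := Conn.loops_cupAt f.1 h
  rw [cupAt, dia_comp, hl, pow_zero, one_smul]

/-! ### Reflection -/

/-- Reflection in a horizontal line. -/
def swap {m n : ℕ} : TLHom m n →ₗ[ℂ] TLHom n m :=
  Finsupp.lmapDomain ℂ ℂ TLDiagram.swap

theorem swap_dia {m n : ℕ} (f : TLDiagram m n) : swap (dia f) = dia f.swap := by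
  simp [swap, dia]

theorem swap_one (n : ℕ) : swap (one n) = one n := by
  rw [one_eq, swap_dia, TLDiagram.swap_one]

theorem swap_cupAt {n i : ℕ} (h : i ≤ n) : swap (cupAt n i h) = capAt n i h := by
  rw [cupAt, swap_dia, TLDiagram.swap_cupAt]; rfl

theorem swap_capAt {n i : ℕ} (h : i ≤ n) : swap (capAt n i h) = cupAt n i h := by
  rw [capAt, swap_dia, TLDiagram.swap_capAt]; rfl

theorem swap_swap {m n : ℕ} (x : TLHom m n) : swap (swap x) = x := by
  induction x using dia_induction with
  | h0 => simp
  | hadd x y hx hy => rw [map_add, map_add, hx, hy]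
  | hsmul c x hx => rw [map_smul, map_smul, hx]
  | hd f => rw [swap_dia, swap_dia, TLDiagram.swap_swap]

theorem swap_comp (d : ℂ) {m n k : ℕ} (x : TLHom m n) (y : TLHom n k) :
    swap (comp d x y) = comp d (swap y) (swap x) := by
  induction x using dia_induction with
  | h0 => simp only [zero_comp, comp_zero, map_zero]
  | hadd x z hx hz => simp only [add_comp, comp_add, map_add, hx, hz]
  | hsmul c x hx => simp only [smul_comp, comp_smul, map_smul, hx]
  | hd f =>
  induction y using dia_induction with
  | h0 => simp only [zero_comp, comp_zero, map_zero]
  | hadd x z hx hz => simp only [add_comp, comp_add, map_add, hx, hz]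
  | hsmul c x hx => simp only [smul_comp, comp_smul, map_smul, hx]
  | hd g =>
  have hl : g.swap.loops f.swap = f.loops g :=
    (Conn.comp_of_mat (f := g.1.comap Sum.swap) (g := f.1.comap Sum.swap)
      (h := (Conn.comp f.1 g.1).comap Sum.swap) (l := Conn.loops f.1 g.1) (by
        rw [Conn.mat_swap, Conn.mat_swap, Conn.mat_swap, ← Matrix.transpose_mul, Conn.mat_mul,
          Matrix.transpose_smul])).2
  rw [dia_comp, map_smul, swap_dia, swap_dia, swap_dia, dia_comp, TLDiagram.swap_comp, hl]

theorem swap_addStrand {m n : ℕ} (x : TLHom m n) : swap (addStrand x) = addStrand (swap x) := by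
  induction x using dia_induction with
  | h0 => simp
  | hadd x y hx hy => rw [map_add, map_add, map_add, map_add, hx, hy]
  | hsmul c x hx => rw [map_smul, map_smul, map_smul, map_smul, hx]
  | hd f =>
    rw [swap_dia, addStrand_dia, swap_dia, addStrand_dia, TLDiagram.swap_tensor,
      TLDiagram.swap_one]

/-! ### The cap and the cup on the last two strands -/

theorem tensor_cap (k : ℕ) : tensor (one k) cap = capAt k k le_rfl := by
  have h := TLDiagram.one_tensor_capAt k (le_refl 0)
  have h2 : cap = dia .cap := rfl
  rw [one_eq, h2, dia_tensor, capAt, ← TLDiagram.capAt_zero]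
  exact congrArg dia h

theorem tensor_cup (k : ℕ) : tensor (one k) cup = cupAt k k le_rfl := by
  rw [← swap_capAt, ← tensor_cap]
  have h := TLDiagram.one_tensor_cupAt k (le_refl 0)
  have h2 : cup = dia .cup := rfl
  rw [tensor_cap, swap_capAt, one_eq, h2, dia_tensor, cupAt, ← TLDiagram.cupAt_zero]
  exact congrArg dia h

theorem addStrand_addStrand_comp_capAt (d : ℂ) {m k : ℕ} (x : TLHom m k) :
    comp d (addStrand (addStrand x)) (capAt k k le_rfl) = comp d (capAt m m le_rfl) x := by
  have h1 : addStrand (addStrand x) = tensor x (one 2) := (tensor_one_succ x 1).symm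
  rw [h1, ← tensor_cap, ← tensor_cap]
  refine (comp_tensor d x (one 2) (one k) cap).trans ?_
  rw [comp_one, one_comp]
  have h2 := comp_tensor d (one m) cap x (one 0)
  rw [comp_one, one_comp, tensor_one_zero] at h2
  exact h2.symm

theorem cupAt_comp_addStrand_addStrand (d : ℂ) {m k : ℕ} (x : TLHom m k) :
    comp d (cupAt m m le_rfl) (addStrand (addStrand x)) = comp d x (cupAt k k le_rfl) := by
  have h := congrArg swap (addStrand_addStrand_comp_capAt d (swap x))
  rwa [swap_comp, swap_comp, swap_addStrand, swap_addStrand, swap_swap, swap_capAt,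
    swap_capAt] at h

end TL

/-! ### Morphisms that are annihilated by caps and cups -/

/-- A diagram that is not built from caps only has a cup at the top, and this is seen by its
matrix. -/
theorem TLDiagram.capOnly_or {m n : ℕ} (f : TLDiagram m n) :
    CapOnly f ∨ ∃ (i : ℕ) (hi : i + 1 < n), ∀ a b, b ⟨i, by omega⟩ ≠ b ⟨i + 1, hi⟩ →
      Conn.mat f.1 a b = 0 := by
  cases f.isNormal with
  | base h => exact .inl h
  | @cup n i f h hf =>
    refine .inr ⟨i, by omega, fun a b hb => ?_⟩
    have e := congrFun (congrFun (Conn.mat_mul f.1 (Conn.cupAt n i)) a) b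
    rw [Conn.mul_mat_cupAt h, Conn.loops_cupAt f.1 h, pow_zero, one_smul] at e
    refine Eq.trans e.symm ?_
    rw [Word.cupOp, Conn.same, if_neg hb, zero_mul]

theorem TLDiagram.comp_ne_one {n k : ℕ} {f : TLDiagram n k} {g : TLDiagram k n}
    (hf : ¬ CapOnly f.swap) : f.comp g ≠ one n := by
  obtain ⟨i, hi, h⟩ := f.swap.capOnly_or.resolve_left hf
  intro e
  let a : Fin n → Bool := fun k => decide (k.1 = i)
  have ha : a ⟨i, by omega⟩ ≠ a ⟨i + 1, hi⟩ := by simp [a]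
  have e2 := congrFun (congrFun (Conn.mat_mul f.1 g.1) a) a
  have e3 : Conn.comp f.1 g.1 = Conn.one (Fin n) := congrArg Subtype.val e
  rw [e3, Conn.mat_one, Matrix.smul_apply, Matrix.one_apply_eq, Matrix.mul_apply] at e2
  have h0 : ∑ j, Conn.mat f.1 a j * Conn.mat g.1 j a = 0 := by
    refine Finset.sum_eq_zero fun j _ => ?_
    have : Conn.mat f.1 a j = 0 := by
      rw [← h j a ha]
      exact (Conn.mat_comap_swap f.1 a j).symm
    rw [this, zero_mul]
  rw [h0] at e2
  rw [smul_eq_mul, mul_one] at e2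
  exact pow_ne_zero (M₀ := ℕ) (Conn.loops f.1 g.1) two_ne_zero e2.symm

theorem TLDiagram.CapOnly.eq_one {n : ℕ} {f : TLDiagram n n} (hf : CapOnly f) :
    f = TLDiagram.one n := by
  rcases hf.eq_one_or_lt with ⟨_, h⟩ | h
  · exact h
  · omega

theorem TLDiagram.eq_of_tensor_one {m n : ℕ} {f g : TLDiagram m n}
    (h : f.tensor (one 1) = g.tensor (one 1)) : f = g := by
  apply Subtype.ext
  apply Conn.eq_of_mat
  ext a b
  have h1 : Conn.tensor f.1 (Conn.one (Fin 1)) = Conn.tensor g.1 (Conn.one (Fin 1)) :=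
    congrArg Subtype.val h
  have h2 := Conn.mat_tensor_one_one f.1 (Fin.snoc a true) (Fin.snoc b true)
  rw [h1, Conn.mat_tensor_one_one] at h2
  simp only [Fin.snoc_comp_castSucc, Fin.snoc_last, if_true, mul_one] at h2
  exact h2.symm

namespace TL

/-- The coefficient of the vertical strands. -/
def coeff {n : ℕ} : TLHom n n →ₗ[ℂ] ℂ := Finsupp.lapply (TLDiagram.one n)

theorem coeff_one (n : ℕ) : coeff (one n) = 1 := by simp [coeff, one]

theorem coeff_dia {n : ℕ} {f : TLDiagram n n} (h : f ≠ .one n) : coeff (dia f) = 0 := by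
  simp [coeff, dia, h]

theorem coeff_swap {n : ℕ} (x : TLHom n n) : coeff (swap x) = coeff x := by
  induction x using dia_induction with
  | h0 => simp
  | hadd x y hx hy => rw [map_add, map_add, map_add, hx, hy]
  | hsmul c x hx => rw [map_smul, map_smul, map_smul, hx]
  | hd f =>
    rw [swap_dia]
    by_cases h : f = .one n
    · rw [h, TLDiagram.swap_one]
    · rw [coeff_dia h, coeff_dia]
      intro h2
      apply h
      rw [← f.swap_swap, h2, TLDiagram.swap_one]

theorem coeff_addStrand {n : ℕ} (x : TLHom n n) : coeff (addStrand x) = coeff x := by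
  induction x using dia_induction with
  | h0 => simp
  | hadd x y hx hy => rw [map_add, map_add, map_add, hx, hy]
  | hsmul c x hx => rw [map_smul, map_smul, map_smul, hx]
  | hd f =>
    by_cases h : f = .one n
    · rw [h, ← one_eq, addStrand_one, coeff_one, coeff_one]
    · rw [addStrand_dia, coeff_dia h, coeff_dia]
      intro h2
      rw [← TLDiagram.one_tensor_one] at h2
      exact h (TLDiagram.eq_of_tensor_one h2)

/-- A diagram that passes through fewer strands is not the identity. -/
theorem coeff_comp_of_lt (d : ℂ) {n k : ℕ} (h : k < n) (x : TLHom n k) (y : TLHom k n) :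
    coeff (comp d x y) = 0 := by
  induction x using dia_induction with
  | h0 => simp [zero_comp]
  | hadd x z hx hz => rw [add_comp, map_add, hx, hz, add_zero]
  | hsmul c x hx => rw [smul_comp, map_smul, hx, smul_zero]
  | hd f =>
  induction y using dia_induction with
  | h0 => simp [comp_zero]
  | hadd x z hx hz => rw [comp_add, map_add, hx, hz, add_zero]
  | hsmul c x hx => rw [comp_smul, map_smul, hx, smul_zero]
  | hd g =>
  rw [dia_comp, map_smul, coeff_dia, smul_zero]
  apply TLDiagram.comp_ne_one
  intro hf
  rcases hf.eq_one_or_lt with ⟨e, -⟩ | h <;> omega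

/-- The morphism `p` is annihilated by attaching any cup at the bottom. The number of lower end
points of `p` is a variable, rewritten as `n' + 2`, so that the notion applies to all of them. -/
def BotKilled (d : ℂ) {n k : ℕ} (p : TLHom n k) : Prop :=
  ∀ (n' i : ℕ) (h : i ≤ n') (e : n = n' + 2), comp d (cupAt n' i h) (e ▸ p) = 0

/-- The morphism `p` is annihilated by attaching any cap at the top. -/
def TopKilled (d : ℂ) {k n : ℕ} (p : TLHom k n) : Prop :=
  ∀ (n' i : ℕ) (h : i ≤ n') (e : n = n' + 2), comp d (e ▸ p) (capAt n' i h) = 0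

variable {d : ℂ}

theorem TopKilled.swap {n k : ℕ} {p : TLHom k n} (hp : TopKilled d p) :
    BotKilled d (TL.swap p) := by
  rintro n' i h rfl
  have := congrArg TL.swap (hp n' i h rfl)
  rwa [swap_comp, swap_capAt, map_zero] at this

theorem BotKilled.dia_comp {m n k : ℕ} {p : TLHom n k} (hp : BotKilled d p)
    {f : TLDiagram m n} (hf : ¬ f.CapOnly) : comp d (dia f) p = 0 := by
  cases f.isNormal with
  | base h => exact absurd h hf
  | @cup n i f h _ => rw [← dia_comp_cupAt d f h, assoc, hp n i h rfl, comp_zero]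

/-- The diagrams that raise the number of points have a cup at the top of their normal form. -/
theorem BotKilled.comp_of_lt {m n k : ℕ} {p : TLHom n k} (hp : BotKilled d p) (h : m < n)
    (x : TLHom m n) : comp d x p = 0 := by
  induction x using dia_induction with
  | h0 => simp [zero_comp]
  | hadd x z hx hz => rw [add_comp, hx, hz, add_zero]
  | hsmul c x hx => rw [smul_comp, hx, smul_zero]
  | hd f =>
    apply hp.dia_comp
    intro hf
    rcases hf.eq_one_or_lt with ⟨e, -⟩ | h <;> omega

/-- Only the vertical strands survive, because all other diagrams have a cup at the top. -/
theorem BotKilled.comp_end {n k : ℕ} {p : TLHom n k} (hp : BotKilled d p) (x : TLHom n n) :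
    comp d x p = coeff x • p := by
  induction x using dia_induction with
  | h0 => simp [zero_comp]
  | hadd x z hx hz => rw [add_comp, hx, hz, map_add, add_smul]
  | hsmul c x hx => rw [smul_comp, hx, smul_smul, map_smul, smul_eq_mul]
  | hd f =>
    by_cases h : f = .one n
    · rw [h, ← one_eq, one_comp, coeff_one, one_smul]
    · rw [coeff_dia h, zero_smul, hp.dia_comp]
      exact fun h2 => h h2.eq_one

theorem TopKilled.comp_of_lt {m n k : ℕ} {p : TLHom k n} (hp : TopKilled d p) (h : m < n)
    (x : TLHom n m) : comp d p x = 0 := by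
  have := congrArg TL.swap (hp.swap.comp_of_lt h (TL.swap x))
  rwa [swap_comp, swap_swap, swap_swap, map_zero] at this

theorem TopKilled.comp_end {n k : ℕ} {p : TLHom k n} (hp : TopKilled d p) (x : TLHom n n) :
    comp d p x = coeff x • p := by
  have := congrArg TL.swap (hp.swap.comp_end (TL.swap x))
  rwa [swap_comp, swap_swap, swap_swap, map_smul, swap_swap, coeff_swap] at this

/-! ### The generators -/

theorem U_succ (a b : ℕ) {n : ℕ} (h : a + 2 + b = n) :
    U d a (b + 1) (by omega : a + 2 + (b + 1) = n + 1) = addStrand (U d a b h) := by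
  subst h
  exact tensor_one_succ _ b

theorem U_zero (a : ℕ) :
    U d a 0 rfl = comp d (capAt a a le_rfl) (cupAt a a le_rfl) := by
  have h1 : U d a 0 rfl = tensor (tensor (one a) (capCup d)) (one 0) := rfl
  rw [h1, tensor_one_zero, ← tensor_cap, ← tensor_cup]
  refine Eq.trans ?_ (comp_tensor d (one a) cap (one a) cup).symm
  rw [comp_one]
  rfl

theorem U_eq (a b : ℕ) {n : ℕ} (h : a + 2 + b = n + 2) :
    U d a b h = comp d (capAt n a (by omega)) (cupAt n a (by omega)) := by
  induction b generalizing n with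
  | zero =>
    obtain rfl : a = n := by omega
    exact U_zero a
  | succ b ih =>
    obtain ⟨n, rfl⟩ : ∃ n', n = n' + 1 := ⟨a + b, by omega⟩
    have h' : a + 2 + b = n + 2 := by omega
    refine (U_succ a b h').trans ?_
    rw [ih h', addStrand_comp, addStrand_capAt, addStrand_cupAt]

theorem TopKilled.of_U (hd : d ≠ 0) {n k : ℕ} {p : TLHom k n}
    (hp : ∀ (a b : ℕ) (h : a + 2 + b = n), comp d p (U d a b h) = 0) : TopKilled d p := by
  rintro n i h rfl
  have h1 := hp i (n - i) (by omega)
  rw [U_eq] at h1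
  have h2 := congrArg (fun y => comp d y (capAt n i h)) h1
  simp only [zero_comp] at h2
  rw [assoc, assoc, cupAt_comp_capAt_self, comp_smul, comp_one, comp_smul] at h2
  exact (smul_eq_zero.1 h2).resolve_left hd

theorem BotKilled.U_comp {n k : ℕ} {p : TLHom n k} (hp : BotKilled d p) (a b : ℕ)
    (h : a + 2 + b = n) : comp d (U d a b h) p = 0 := by
  obtain ⟨n, rfl⟩ : ∃ n', n = n' + 2 := ⟨a + b, by omega⟩
  rw [U_eq, assoc, hp n a (by omega) rfl, comp_zero]

theorem TopKilled.comp_U {n k : ℕ} {p : TLHom k n} (hp : TopKilled d p) (a b : ℕ)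
    (h : a + 2 + b = n) : comp d p (U d a b h) = 0 := by
  obtain ⟨n, rfl⟩ : ∃ n', n = n' + 2 := ⟨a + b, by omega⟩
  rw [U_eq, ← assoc, hp n a (by omega) rfl, zero_comp]

end TL

/-! ### Jones-Wenzl projectors below the critical index -/

namespace TL

variable {d : ℂ}

theorem jw_succ_succ (k : ℕ) :
    jw d (k + 2) = addStrand (jw d (k + 1)) - (cheb d k / cheb d (k + 1)) •
      comp d (comp d (addStrand (jw d (k + 1))) (comp d (capAt k k le_rfl) (cupAt k k le_rfl)))
        (addStrand (jw d (k + 1))) := by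
  rw [← U_zero]
  rfl

theorem coeff_jw (k : ℕ) : coeff (jw d k) = 1 := by
  induction k using Nat.twoStepInduction with
  | zero => exact coeff_one 0
  | one => exact coeff_one 1
  | more k _ ih =>
    rw [jw_succ_succ, map_sub, map_smul, assoc, assoc, ← assoc, coeff_addStrand, ih,
      coeff_comp_of_lt d (by omega), smul_zero, sub_zero]

theorem jw_ne_zero (k : ℕ) : jw d k ≠ 0 := by
  intro h
  have := coeff_jw (d := d) k
  rw [h, map_zero] at this
  exact zero_ne_one this

theorem swap_jw (k : ℕ) : swap (jw d k) = jw d k := by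
  induction k using Nat.twoStepInduction with
  | zero => exact swap_one 0
  | one => exact swap_one 1
  | more k _ ih =>
    rw [jw_succ_succ, map_sub, map_smul, swap_comp, swap_comp, swap_comp, swap_addStrand, ih,
      swap_cupAt, swap_capAt]
    simp only [assoc]

/-- The partial trace: the last strand is closed up on the right. -/
def ptr (d : ℂ) {m n : ℕ} (x : TLHom (m + 1) (n + 1)) : TLHom m n :=
  comp d (comp d (cupAt m m le_rfl) (addStrand x)) (capAt n n le_rfl)

theorem ptr_addStrand_comp {m n k : ℕ} (x : TLHom m n) (y : TLHom (n + 1) (k + 1)) :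
    ptr d (comp d (addStrand x) y) = comp d x (ptr d y) := by
  rw [ptr, addStrand_comp, ← assoc, cupAt_comp_addStrand_addStrand, assoc, assoc, ptr, assoc]

theorem ptr_comp_addStrand {m n k : ℕ} (x : TLHom (m + 1) (n + 1)) (y : TLHom n k) :
    ptr d (comp d x (addStrand y)) = comp d (ptr d x) y := by
  rw [ptr, addStrand_comp, assoc, assoc, addStrand_addStrand_comp_capAt, ← assoc, ← assoc, ptr]

theorem ptr_one (n : ℕ) : ptr d (one (n + 1)) = d • one n := by
  rw [ptr, addStrand_one, comp_one, cupAt_comp_capAt_self]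

theorem ptr_capAt_comp_cupAt (k : ℕ) :
    ptr d (comp d (capAt k k le_rfl) (cupAt k k le_rfl)) = one (k + 1) := by
  rw [ptr, addStrand_comp, addStrand_capAt, addStrand_cupAt, ← assoc, assoc,
    cupAt_comp_capAt_succ d le_rfl, cupAt_succ_comp_capAt d le_rfl, comp_one]

theorem ptr_sub {m n : ℕ} (x y : TLHom (m + 1) (n + 1)) :
    ptr d (x - y) = ptr d x - ptr d y := by
  rw [ptr, map_sub, comp_sub, sub_comp, ptr, ptr]

theorem ptr_smul {m n : ℕ} (c : ℂ) (x : TLHom (m + 1) (n + 1)) :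
    ptr d (c • x) = c • ptr d x := by
  rw [ptr, map_smul, comp_smul, smul_comp, ptr]

theorem comp_self_of_topKilled {k : ℕ} (h : TopKilled d (jw d k)) :
    comp d (jw d k) (jw d k) = jw d k := by
  rw [h.comp_end, coeff_jw, one_smul]

/-- The projector on `k + 1` strands absorbs the projector on `k` strands. -/
theorem jw_comp_capAt {k : ℕ} (h : TopKilled d (jw d (k + 1))) :
    comp d (comp d (addStrand (jw d (k + 1))) (capAt k k le_rfl)) (jw d k) =
      comp d (addStrand (jw d (k + 1))) (capAt k k le_rfl) := by
  rw [assoc, ← addStrand_addStrand_comp_capAt, ← assoc, ← addStrand_comp, h.comp_end,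
    coeff_addStrand, coeff_jw, one_smul]

/-- Up to the first index at which the Chebyshev polynomials vanish, the recursively defined
projectors are annihilated by caps, and their partial traces are known. -/
theorem topKilled_jw_aux {s : ℕ} (hs : ∀ k < s, cheb d k ≠ 0) (k : ℕ) (hk : k + 1 ≤ s) :
    TopKilled d (jw d (k + 1)) ∧
      ptr d (jw d (k + 1)) = (cheb d (k + 1) / cheb d k) • jw d k := by
  induction k with
  | zero =>
    refine ⟨fun n' i h e => by omega, ?_⟩
    have h1 : jw d (0 + 1) = one (0 + 1) := rfl
    rw [h1, ptr_one]
    simp [cheb, jw]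
  | succ k ih =>
    obtain ⟨h1, h2⟩ := ih (by omega)
    have hc0 := hs k (by omega)
    have hc1 := hs (k + 1) (by omega)
    rw [jw_succ_succ]
    set p := jw d (k + 1) with hp
    constructor
    · intro n' i hi e
      obtain rfl : n' = k := by omega
      change comp d (addStrand p - _) (capAt n' i hi) = 0
      obtain rfl | hlt := Nat.eq_or_lt_of_le hi
      · rw [sub_comp, smul_comp, assoc, assoc, assoc, ← assoc _ (cupAt i i hi)]
        rw [ptr] at h2
        rw [h2, comp_smul, comp_smul, ← assoc, jw_comp_capAt h1, smul_smul, ← hp,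
          div_mul_div_cancel₀ hc1, div_self hc0, one_smul, sub_self]
      · obtain ⟨n, rfl⟩ := Nat.exists_eq_add_of_lt hlt
        have h3 : comp d (addStrand p) (capAt (i + n + 1) i hi) = 0 := by
          have := congrArg addStrand (h1 (i + n) i (by omega) rfl)
          rwa [addStrand_comp, addStrand_capAt, map_zero] at this
        rw [sub_comp, smul_comp, assoc, h3, comp_zero, smul_zero, sub_zero]
    · rw [ptr_sub, ptr_smul, ptr_comp_addStrand, ptr_addStrand_comp, ptr_capAt_comp_cupAt,
        comp_one, comp_self_of_topKilled h1]
      have h4 : ptr d (addStrand p) = d • p := by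
        have := ptr_addStrand_comp (d := d) p (one _)
        rwa [comp_one, ptr_one, comp_smul, comp_one] at this
      rw [h4, ← sub_smul]
      congr 1
      rw [cheb]
      field_simp

variable {s : ℕ}

theorem topKilled_jw (hs : ∀ k < s, cheb d k ≠ 0) {k : ℕ} (hk : k ≤ s) :
    TopKilled d (jw d k) := by
  cases k with
  | zero => intro n' i h e; omega
  | succ k => exact (topKilled_jw_aux hs k hk).1

theorem botKilled_jw (hs : ∀ k < s, cheb d k ≠ 0) {k : ℕ} (hk : k ≤ s) :
    BotKilled d (jw d k) := by
  rw [← swap_jw]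
  exact (topKilled_jw hs hk).swap

theorem ptr_jw (hs : ∀ k < s, cheb d k ≠ 0) {k : ℕ} (hk : k + 1 ≤ s) :
    ptr d (jw d (k + 1)) = (cheb d (k + 1) / cheb d k) • jw d k :=
  (topKilled_jw_aux hs k hk).2

theorem isJonesWenzl_jw (hs : ∀ k < s, cheb d k ≠ 0) : IsJonesWenzl d (jw d s) :=
  ⟨jw_ne_zero s, comp_self_of_topKilled (topKilled_jw hs le_rfl), fun a b h =>
    ⟨(botKilled_jw hs le_rfl).U_comp a b h, (topKilled_jw hs le_rfl).comp_U a b h⟩⟩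

end TL

/-! ### Oriented colourings -/

namespace Conn

variable {α β : Type}

/-- An equivalence relation is determined by the two-colourings that are constant on its classes. -/
theorem rel_iff (f : Setoid α) (x y : α) : f x y ↔ ∀ u : α → Bool, f ≤ Setoid.ker u → u x = u y := by
  classical
  refine ⟨fun h u hu => hu h, fun h => ?_⟩
  have h1 := h (fun z => decide (f x z)) (fun z w hzw => by
    change decide _ = decide _
    exact decide_eq_decide.2 ⟨fun h => f.trans h hzw, fun h => f.trans h (f.symm hzw)⟩)
  have h2 : decide (f x x) = decide (f x y) := h1
  exact (decide_eq_decide.1 h2).1 (f.refl x)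

theorem comp_cupAt_le_ker {n i : ℕ} (h : i ≤ n) (f : Setoid (Fin 0 ⊕ Fin n)) (a : Fin 0 → Bool)
    (b : Fin (n + 2) → Bool) : comp f (cupAt n i) ≤ Setoid.ker (Sum.elim a b) ↔
      b ⟨i, by omega⟩ = b ⟨i + 1, by omega⟩ ∧ f ≤ Setoid.ker (Sum.elim a (b ∘ Word.skip i)) := by
  classical
  have e := congrFun (congrFun (mat_mul f (cupAt n i)) a) b
  rw [mul_mat_cupAt h, loops_cupAt f h, pow_zero, one_smul, Word.cupOp, same, mat_apply,
    mat_apply] at e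
  by_cases h1 : comp f (cupAt n i) ≤ Setoid.ker (Sum.elim a b) <;>
  by_cases h2 : b ⟨i, by omega⟩ = b ⟨i + 1, by omega⟩ <;>
  by_cases h3 : f ≤ Setoid.ker (Sum.elim a (b ∘ Word.skip i)) <;>
  simp_all

end Conn

namespace TLDiagram

open Word

/-- Two upper end points are joined. -/
def Link {m : ℕ} (f : TLDiagram 0 m) (p q : Fin m) : Prop := f.1 (Sum.inr p) (Sum.inr q)

theorem link_iff {m : ℕ} (f : TLDiagram 0 m) (p q : Fin m) :
    f.Link p q ↔ ∀ b : Fin m → Bool, f.1 ≤ Setoid.ker (Sum.elim Fin.elim0 b) → b p = b q := by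
  rw [Link, Conn.rel_iff]
  constructor
  · intro h b hb
    exact h _ hb
  · intro h u hu
    have e : u = Sum.elim Fin.elim0 (u ∘ Sum.inr) := by
      funext x
      rcases x with x | x
      · exact x.elim0
      · rfl
    rw [e] at hu
    exact h _ hu

theorem Link.symm {m : ℕ} {f : TLDiagram 0 m} {p q : Fin m} (h : f.Link p q) : f.Link q p :=
  f.1.symm h

section cup

variable {n i : ℕ} (h : i ≤ n) (f : TLDiagram 0 n)

theorem link_comp_cupAt_iff (p q : Fin (n + 2)) :
    (f.comp (cupAt n i h)).Link p q ↔ ∀ b : Fin (n + 2) → Bool,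
      b ⟨i, by omega⟩ = b ⟨i + 1, by omega⟩ →
      f.1 ≤ Setoid.ker (Sum.elim Fin.elim0 (b ∘ skip i)) → b p = b q := by
  rw [link_iff]
  refine forall_congr' fun b => ?_
  rw [← and_imp]
  exact imp_congr_left (Conn.comp_cupAt_le_ker h f.1 _ b)

theorem link_skip (p q : Fin n) :
    (f.comp (cupAt n i h)).Link (skip i p) (skip i q) ↔ f.Link p q := by
  rw [link_comp_cupAt_iff, link_iff]
  constructor
  · intro H b hb
    have := H (ins h true true b) (by rw [ins_left, ins_right]) (by rwa [ins_comp_skip])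
    rwa [ins_skip, ins_skip] at this
  · intro H b _ hb
    exact H _ hb

theorem link_left_right :
    (f.comp (cupAt n i h)).Link ⟨i, by omega⟩ ⟨i + 1, by omega⟩ := by
  rw [link_comp_cupAt_iff]
  exact fun b hb _ => hb

theorem not_link_left_skip (p : Fin n) :
    ¬ (f.comp (cupAt n i h)).Link ⟨i, by omega⟩ (skip i p) := by
  rw [link_comp_cupAt_iff]
  intro H
  have := H (ins h true true (fun _ => false)) (by rw [ins_left, ins_right]) (by
    rw [ins_comp_skip]
    rintro (x | x) (y | y) _
    exacts [x.elim0, x.elim0, y.elim0, rfl])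
  rw [ins_left, ins_skip] at this
  exact Bool.noConfusion this

theorem not_link_right_skip (p : Fin n) :
    ¬ (f.comp (cupAt n i h)).Link ⟨i + 1, by omega⟩ (skip i p) := fun H =>
  not_link_left_skip h f p ((f.comp (cupAt n i h)).1.trans (link_left_right h f) H)

theorem skip_cases (k : Fin (n + 2)) :
    k = ⟨i, by omega⟩ ∨ k = ⟨i + 1, by omega⟩ ∨ ∃ k', k = skip i k' := by
  by_cases h1 : k.1 = i
  · exact .inl (Fin.ext h1)
  by_cases h2 : k.1 = i + 1
  · exact .inr (.inl (Fin.ext h2))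
  by_cases h3 : k.1 < i
  · exact .inr (.inr ⟨⟨k.1, by omega⟩, Fin.ext (by simp [skip, h3])⟩)
  · have h4 : ¬ k.1 - 2 < i := by omega
    exact .inr (.inr ⟨⟨k.1 - 2, by omega⟩, Fin.ext (by simp only [skip, h4, if_false]; omega)⟩)

theorem skip_lt_skip {p q : Fin n} : skip i p < skip i q ↔ p < q := by
  simp only [Fin.lt_def, skip]
  split_ifs <;> omega

theorem skip_injective : Function.Injective (skip i : Fin n → Fin (n + 2)) := by
  intro p q hpq
  have := congrArg Fin.val hpq
  simp only [skip] at this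
  apply Fin.ext
  split_ifs at this <;> omega

end cup

/-- The point `p` is the left end of an arc. -/
def Opener {m : ℕ} (f : TLDiagram 0 m) (p : Fin m) : Prop := ∃ q, p < q ∧ f.Link p q

section cup

variable {n i : ℕ} (h : i ≤ n) (f : TLDiagram 0 n)

theorem opener_left : (f.comp (cupAt n i h)).Opener ⟨i, by omega⟩ :=
  ⟨_, Fin.mk_lt_mk.2 (Nat.lt_succ_self i), link_left_right h f⟩

theorem not_opener_right : ¬ (f.comp (cupAt n i h)).Opener ⟨i + 1, by omega⟩ := by
  rintro ⟨q, hq, hl⟩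
  rcases skip_cases h q with rfl | rfl | ⟨q, rfl⟩
  · simp [Fin.lt_def] at hq
  · exact lt_irrefl _ hq
  · exact not_link_right_skip h f q hl

theorem opener_skip (p : Fin n) : (f.comp (cupAt n i h)).Opener (skip i p) ↔ f.Opener p := by
  constructor
  · rintro ⟨q, hq, hl⟩
    rcases skip_cases h q with rfl | rfl | ⟨q, rfl⟩
    · exact absurd hl.symm (not_link_left_skip h f p)
    · exact absurd hl.symm (not_link_right_skip h f p)
    · exact ⟨q, skip_lt_skip.1 hq, (link_skip h f p q).1 hl⟩
  · rintro ⟨q, hq, hl⟩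
    exact ⟨skip i q, skip_lt_skip.2 hq, (link_skip h f p q).2 hl⟩

end cup

/-- The two ends of each arc have different colours. -/
def Compat {m : ℕ} (f : TLDiagram 0 m) (w : Fin m → Bool) : Prop :=
  ∀ p q, p ≠ q → f.Link p q → w p ≠ w q

theorem compat_comp_cupAt {n i : ℕ} (h : i ≤ n) (f : TLDiagram 0 n) (w : Fin (n + 2) → Bool) :
    (f.comp (cupAt n i h)).Compat w ↔
      w ⟨i, by omega⟩ ≠ w ⟨i + 1, by omega⟩ ∧ f.Compat (w ∘ skip i) := by
  constructor
  · intro H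
    refine ⟨H _ _ (by simp) (link_left_right h f), fun p q hpq hl => ?_⟩
    exact H _ _ (skip_injective.ne hpq) ((link_skip h f p q).2 hl)
  · rintro ⟨h1, h2⟩ p q hpq hl
    rcases skip_cases h p with rfl | rfl | ⟨p, rfl⟩ <;>
    rcases skip_cases h q with rfl | rfl | ⟨q, rfl⟩
    · exact absurd rfl hpq
    · exact h1
    · exact absurd hl (not_link_left_skip h f q)
    · exact h1.symm
    · exact absurd rfl hpq
    · exact absurd hl (not_link_right_skip h f q)
    · exact absurd hl.symm (not_link_left_skip h f p)
    · exact absurd hl.symm (not_link_right_skip h f p)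
    · exact h2 p q (fun e => hpq (by rw [e])) ((link_skip h f p q).1 hl)

/-- The weight of an oriented arc, by the colours of its left and its right end. -/
def wt (t : ℂ) (p q : Bool) : ℂ := if p = q then 0 else if p then t else 1

/-- The weight of an arc at the bottom, by the colours of its left and its right end. -/
def wt' (t : ℂ) (p q : Bool) : ℂ := if p = q then 0 else if p then 1 else t⁻¹

open Classical in
/-- The coordinates of a diagram without lower end points in the tensor power of the plane that
is indexed by its upper end points. The colours stand for the two basis vectors; the coordinate is
a power of `t` if the ends of each arc have different colours, and zero otherwise. -/
def coord (t : ℂ) {m : ℕ} (f : TLDiagram 0 m) (w : Fin m → Bool) : ℂ :=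
  if f.Compat w then ∏ p, (if w p = true ∧ f.Opener p then t else 1) else 0

/-- A new arc between neighbours multiplies the coordinates by the weight of the arc. -/
theorem coord_comp_cupAt (t : ℂ) {n i : ℕ} (h : i ≤ n) (f : TLDiagram 0 n) :
    (f.comp (cupAt n i h)).coord t = cupOp h (wt t) (f.coord t) := by
  classical
  funext w
  unfold coord cupOp
  have e1 := opener_left h f
  have e2 := not_opener_right h f
  rw [compat_comp_cupAt]
  simp only [prod_skip h, opener_skip, e1, e2, and_true, and_false, if_false, mul_one,
    Function.comp_apply]
  unfold wt
  by_cases h1 : w ⟨i, by omega⟩ = w ⟨i + 1, by omega⟩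
  · simp [h1]
  · by_cases h2 : f.Compat (w ∘ skip i) <;> simp [h1, h2]

theorem isNormal_zero {m : ℕ} (f : TLDiagram 0 m) :
    (∃ e : 0 = m, f = e ▸ one 0) ∨ ∃ (n i : ℕ) (h : i ≤ n) (g : TLDiagram 0 n) (e : n + 2 = m),
      f = e ▸ g.comp (cupAt n i h) := by
  cases f.isNormal with
  | base h =>
    rcases h.eq_one_or_lt with h | h
    · exact .inl h
    · omega
  | cup h _ => exact .inr ⟨_, _, h, _, rfl, rfl⟩

/-- Diagrams without lower end points are built from cups. -/
theorem cup_induction {P : ∀ {m : ℕ}, TLDiagram 0 m → Prop} (h0 : P (one 0))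
    (hc : ∀ {n i : ℕ} (h : i ≤ n) (f : TLDiagram 0 n), P f → P (f.comp (cupAt n i h)))
    {m : ℕ} (f : TLDiagram 0 m) : P f := by
  induction f.isNormal with
  | base h =>
    rcases h.eq_one_or_lt with ⟨rfl, rfl⟩ | h
    · exact h0
    · omega
  | cup h _ ih => exact hc h _ ih

open Classical in
/-- The colouring that marks the right ends of the arcs. -/
def word {m : ℕ} (f : TLDiagram 0 m) (p : Fin m) : Bool := decide (¬ f.Opener p)

theorem word_comp_cupAt {n i : ℕ} (h : i ≤ n) (f : TLDiagram 0 n) :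
    (f.comp (cupAt n i h)).word = ins h false true f.word := by
  apply eq_ins
  · simp [word, opener_left h f]
  · simp [word, not_opener_right h f]
  · funext p
    simp [word, opener_skip]

theorem coord_word (t : ℂ) {m : ℕ} (f : TLDiagram 0 m) : f.coord t f.word = 1 := by
  induction f using cup_induction with
  | h0 =>
    have hc : (one 0).Compat (one 0).word := fun p => p.elim0
    rw [coord, if_pos hc]
    simp
  | hc h f ih =>
    rw [coord_comp_cupAt, word_comp_cupAt, cupOp, ins_left, ins_right, ins_comp_skip, ih]
    simp [wt]

theorem exists_link {m : ℕ} (f : TLDiagram 0 m) (p : Fin m) : ∃ q, p ≠ q ∧ f.Link p q := by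
  induction f using cup_induction with
  | h0 => exact p.elim0
  | hc h f ih =>
    rcases skip_cases h p with rfl | rfl | ⟨p, rfl⟩
    · exact ⟨_, by simp, link_left_right h f⟩
    · exact ⟨_, by simp, (link_left_right h f).symm⟩
    · obtain ⟨q, hq, hl⟩ := ih p
      exact ⟨skip _ q, skip_injective.ne hq, (link_skip h f p q).2 hl⟩

/-- The word of a diagram is the lexicographically smallest compatible colouring. -/
theorem word_le_of_coord_ne_zero {t : ℂ} {m : ℕ} {f : TLDiagram 0 m} {w : Fin m → Bool}
    (hw : f.coord t w ≠ 0) : toLex f.word ≤ toLex w := by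
  have hc : f.Compat w := by
    by_contra h
    exact hw (if_neg h)
  by_contra hlt
  obtain ⟨p, h1, h2⟩ := not_le.1 hlt
  have h2 : w p < f.word p := h2
  have h3 : w p = false ∧ f.word p = true := by
    revert h2
    cases w p <;> cases f.word p <;> simp
  have h4 : ¬ f.Opener p := by simpa [word] using h3.2
  obtain ⟨q, hq, hl⟩ := exists_link f p
  have hqp : q < p := lt_of_le_of_ne (le_of_not_gt fun h => h4 ⟨q, h, hl⟩) hq.symm
  have h5 : w q = f.word q := h1 q hqp
  have h6 : f.word q = false := by
    simp only [word, decide_eq_false_iff_not, not_not]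
    exact ⟨p, hqp, hl.symm⟩
  exact hc p q hq hl (by rw [h3.1, h5, h6])

/-- A left end next to a right end is joined to it. -/
theorem exists_eq_comp_cupAt {n i : ℕ} (h : i ≤ n) (f : TLDiagram 0 (n + 2))
    (h1 : f.Opener ⟨i, by omega⟩) (h2 : ¬ f.Opener ⟨i + 1, by omega⟩) :
    ∃ g : TLDiagram 0 n, f = g.comp (cupAt n i h) := by
  induction n using Nat.strong_induction_on generalizing i with
  | _ n ih =>
  rcases f.isNormal_zero with ⟨e, -⟩ | ⟨n', j, hj, g, e, hf⟩
  · omega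
  obtain rfl : n' = n := by omega
  replace hf : f = g.comp (cupAt n' j hj) := hf
  subst hf
  rcases lt_trichotomy i j with hij | rfl | hij
  · obtain rfl | hij := Nat.eq_or_lt_of_le (Nat.succ_le_of_lt hij)
    · exact absurd (opener_left hj g) h2
    · obtain ⟨j, rfl⟩ := Nat.exists_eq_add_of_le' (show 2 ≤ j by omega)
      obtain ⟨n, rfl⟩ := Nat.exists_eq_add_of_le' (show 2 ≤ n' by omega)
      have hi1 : i < j + 2 := by omega
      have hi2 : i + 1 < j + 2 := by omega
      have e1 : (⟨i, by omega⟩ : Fin (n + 2 + 2)) = skip (j + 2) ⟨i, by omega⟩ :=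
        Fin.ext (by simp [skip, hi1])
      have e2 : (⟨i + 1, by omega⟩ : Fin (n + 2 + 2)) = skip (j + 2) ⟨i + 1, by omega⟩ :=
        Fin.ext (by simp [skip, hi2])
      rw [e1, opener_skip] at h1
      rw [e2, opener_skip] at h2
      obtain ⟨g', rfl⟩ := ih n (by omega) (by omega) g h1 h2
      refine ⟨g'.comp (cupAt n j (by omega)), ?_⟩
      rw [comp_assoc, comp_assoc, cupAt_comp_cupAt (by omega) (by omega)]
  · exact ⟨g, rfl⟩
  · obtain rfl | hij := Nat.eq_or_lt_of_le (Nat.succ_le_of_lt hij)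
    · exact absurd h1 (not_opener_right hj g)
    · obtain ⟨i, rfl⟩ := Nat.exists_eq_add_of_le' (show 2 ≤ i by omega)
      obtain ⟨n, rfl⟩ := Nat.exists_eq_add_of_le' (show 2 ≤ n' by omega)
      have hi1 : ¬ i < j := by omega
      have hi2 : ¬ i + 1 < j := by omega
      have e1 : (⟨i + 2, by omega⟩ : Fin (n + 2 + 2)) = skip j ⟨i, by omega⟩ :=
        Fin.ext (by simp [skip, hi1])
      have e2 : (⟨i + 2 + 1, by omega⟩ : Fin (n + 2 + 2)) = skip j ⟨i + 1, by omega⟩ :=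
        Fin.ext (by simp only [skip, hi2, if_false])
      rw [e1, opener_skip] at h1
      rw [e2, opener_skip] at h2
      obtain ⟨g', rfl⟩ := ih n (by omega) (by omega) g h1 h2
      refine ⟨g'.comp (cupAt n j (by omega)), ?_⟩
      rw [comp_assoc, comp_assoc, cupAt_comp_cupAt (by omega) (by omega)]

/-- Planar diagrams are determined by the left ends of their arcs. -/
theorem word_injective {m : ℕ} {f g : TLDiagram 0 m} (h : f.word = g.word) : f = g := by
  induction f using cup_induction with
  | h0 =>
    apply Subtype.ext
    ext x
    rcases x with x | x <;> exact x.elim0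
  | @hc n i hi f ih =>
    rw [word_comp_cupAt] at h
    have h1 := congrFun h ⟨i, by omega⟩
    have h2 := congrFun h ⟨i + 1, by omega⟩
    rw [ins_left] at h1
    rw [ins_right] at h2
    obtain ⟨g, rfl⟩ := exists_eq_comp_cupAt hi g (by simpa [word] using h1.symm)
      (by simpa [word] using h2.symm)
    rw [word_comp_cupAt] at h
    have := congrArg (· ∘ skip i) h
    simp only [ins_comp_skip] at this
    rw [ih this]

/-- In the left half of the end points, together with the point after it, some arc joins
neighbours. -/
theorem exists_cup_le {m : ℕ} (f : TLDiagram 0 m) (n : ℕ) (e : m = 2 * n + 2) :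
    ∃ (i : ℕ) (h : i ≤ 2 * n) (g : TLDiagram 0 (2 * n)), i ≤ n ∧ e ▸ f = g.comp (cupAt _ i h) := by
  induction f using cup_induction generalizing n with
  | h0 => omega
  | @hc n' j hj f ih =>
    obtain rfl : n' = 2 * n := by omega
    by_cases hjn : j ≤ n
    · exact ⟨j, hj, f, hjn, rfl⟩
    · obtain ⟨n, rfl⟩ := Nat.exists_eq_add_of_le' (show 1 ≤ n by omega)
      obtain ⟨i, hi, g, hin, rfl⟩ := ih n rfl
      obtain ⟨j, rfl⟩ := Nat.exists_eq_add_of_le' (show 2 ≤ j by omega)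
      refine ⟨i, by omega, g.comp (cupAt _ j (by omega)), by omega, ?_⟩
      change (g.comp (cupAt (2 * n) i hi)).comp (cupAt (2 * n + 2) (j + 2) hj) =
        (g.comp (cupAt (2 * n) j _)).comp (cupAt (2 * n + 2) i _)
      rw [comp_assoc, comp_assoc, cupAt_comp_cupAt (by omega) (by omega)]

end TLDiagram

/-! ### The coordinates of a morphism -/

namespace Word

variable {R : Type*} [CommSemiring R] {n i : ℕ} (h : i ≤ n) (M : Bool → Bool → R)

theorem capOp_zero : capOp h M 0 = 0 := by
  funext c
  simp [capOp]

theorem capOp_add (v w : (Fin (n + 2) → Bool) → R) :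
    capOp h M (v + w) = capOp h M v + capOp h M w := by
  funext c
  simp only [capOp, Pi.add_apply, mul_add, Finset.sum_add_distrib]

theorem capOp_smul (c : R) (v : (Fin (n + 2) → Bool) → R) :
    capOp h M (c • v) = c • capOp h M v := by
  funext b
  simp only [capOp, Pi.smul_apply, smul_eq_mul, Finset.mul_sum]
  exact Finset.sum_congr rfl fun p _ => Finset.sum_congr rfl fun q _ => by ring

theorem cupOp_zero : cupOp h M 0 = 0 := by
  funext c
  simp [cupOp]

theorem cupOp_add (v w : (Fin n → Bool) → R) :
    cupOp h M (v + w) = cupOp h M v + cupOp h M w := by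
  funext c
  simp only [cupOp, Pi.add_apply, mul_add]

theorem cupOp_smul (c : R) (v : (Fin n → Bool) → R) :
    cupOp h M (c • v) = c • cupOp h M v := by
  funext b
  simp only [cupOp, Pi.smul_apply, smul_eq_mul]
  ring

end Word

namespace TL

open Word TLDiagram

variable {t : ℂ}

theorem sum_wt_wt' (ht : t ≠ 0) (p q : Bool) :
    ∑ s, wt t p s * wt' t s q = if p = q then 1 else 0 := by
  cases p <;> cases q <;> simp [wt, wt', ht]

theorem sum_wt'_wt (ht : t ≠ 0) (p q : Bool) :
    ∑ s, wt' t p s * wt t s q = if p = q then 1 else 0 := by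
  cases p <;> cases q <;> simp [wt, wt', ht]

theorem sum_wt'_mul_wt : ∑ p, ∑ q, wt' t p q * wt t p q = t + t⁻¹ := by
  simp [wt, wt']

/-- The coordinates of a morphism without lower end points in a tensor power of the plane. -/
def coordMap (t : ℂ) (m : ℕ) : TLHom 0 m →ₗ[ℂ] (Fin m → Bool) → ℂ :=
  Finsupp.linearCombination ℂ (coord t)

theorem coordMap_dia {m : ℕ} (f : TLDiagram 0 m) : coordMap t m (dia f) = f.coord t := by
  simp [coordMap, dia]

theorem coordMap_comp_cupAt (d : ℂ) {n i : ℕ} (h : i ≤ n) (x : TLHom 0 n) :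
    coordMap t (n + 2) (comp d x (cupAt n i h)) = cupOp h (wt t) (coordMap t n x) := by
  induction x using dia_induction with
  | h0 => rw [zero_comp, map_zero, map_zero, cupOp_zero]
  | hadd x y hx hy => rw [add_comp, map_add, map_add, cupOp_add, hx, hy]
  | hsmul c x hx => rw [smul_comp, map_smul, map_smul, cupOp_smul, hx]
  | hd f => rw [dia_comp_cupAt, coordMap_dia, coordMap_dia, coord_comp_cupAt]

variable {d : ℂ}

/-- The cap is pulled down through the cups of the diagram by the relations that it shares with the
contraction of coordinates. -/
theorem coordMap_dia_comp_capAt (ht : t ≠ 0) (hd : d = t + t⁻¹) {m : ℕ} (f : TLDiagram 0 m) :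
    ∀ {n j : ℕ} (hj : j ≤ n) (e : m = n + 2),
      coordMap t n (comp d (e ▸ dia f) (capAt n j hj)) =
        capOp hj (wt' t) (coordMap t (n + 2) (e ▸ dia f)) := by
  induction f using cup_induction with
  | h0 => intro n j hj e; omega
  | @hc n i hi f ih =>
    intro n' j hj e
    obtain rfl : n = n' := by omega
    change coordMap t n (comp d (dia (f.comp (.cupAt n i hi))) (capAt n j hj)) =
      capOp hj (wt' t) (coordMap t (n + 2) (dia (f.comp (.cupAt n i hi))))
    rw [← dia_comp_cupAt d, assoc, coordMap_comp_cupAt]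
    rcases lt_trichotomy i j with h | rfl | h
    · obtain rfl | h := Nat.eq_or_lt_of_le (Nat.succ_le_of_lt h)
      · rw [cupAt_comp_capAt_succ d hj, comp_one, capOp_succ_cupOp _ _ (sum_wt_wt' ht)]
      · obtain ⟨j, rfl⟩ := Nat.exists_eq_add_of_le' (show 2 ≤ j by omega)
        obtain ⟨n, rfl⟩ := Nat.exists_eq_add_of_le' (show 2 ≤ n by omega)
        rw [cupAt_comp_capAt_far_right d (by omega) (by omega), ← assoc, coordMap_comp_cupAt,
          capOp_far_right_cupOp (wt t) (wt' t) (by omega) (by omega)]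
        exact congrArg _ (ih _ rfl)
    · rw [cupAt_comp_capAt_self, comp_smul, comp_one, map_smul, capOp_cupOp_self, sum_wt'_mul_wt,
        hd]
    · obtain rfl | h := Nat.eq_or_lt_of_le (Nat.succ_le_of_lt h)
      · rw [cupAt_succ_comp_capAt d hi, comp_one, capOp_cupOp_succ _ _ (sum_wt'_wt ht)]
      · obtain ⟨i, rfl⟩ := Nat.exists_eq_add_of_le' (show 2 ≤ i by omega)
        obtain ⟨n, rfl⟩ := Nat.exists_eq_add_of_le' (show 2 ≤ n by omega)
        rw [cupAt_far_right_comp_capAt d (by omega) (by omega), ← assoc, coordMap_comp_cupAt,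
          capOp_cupOp_far_right (wt t) (wt' t) (by omega) (by omega)]
        exact congrArg _ (ih _ rfl)

theorem coordMap_comp_capAt (ht : t ≠ 0) (hd : d = t + t⁻¹) {n i : ℕ} (h : i ≤ n)
    (x : TLHom 0 (n + 2)) :
    coordMap t n (comp d x (capAt n i h)) = capOp h (wt' t) (coordMap t (n + 2) x) := by
  induction x using dia_induction with
  | h0 => rw [zero_comp, map_zero, map_zero, capOp_zero]
  | hadd x y hx hy => rw [add_comp, map_add, map_add, capOp_add, hx, hy]
  | hsmul c x hx => rw [smul_comp, map_smul, map_smul, capOp_smul, hx]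
  | hd f => exact coordMap_dia_comp_capAt ht hd f h rfl

/-- A morphism without lower end points is determined by its coordinates. -/
theorem eq_zero_of_coordMap {m : ℕ} {x : TLHom 0 m} (h : coordMap t m x = 0) : x = 0 := by
  classical
  by_contra hx
  obtain ⟨f, hf, hmin⟩ := x.support.exists_min_image (fun f => toLex f.word)
    (Finsupp.support_nonempty_iff.2 hx)
  have h1 := congrFun h f.word
  rw [coordMap, Finsupp.linearCombination_apply, Finsupp.sum, Finset.sum_apply,
    Finset.sum_eq_single_of_mem f hf] at h1
  · simp only [Pi.smul_apply, coord_word, smul_eq_mul, mul_one, Pi.zero_apply] at h1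
    exact Finsupp.mem_support_iff.1 hf h1
  · intro g hg hgf
    rw [Pi.smul_apply, smul_eq_mul]
    have : g.coord t f.word = 0 := by
      by_contra hne
      exact hgf (word_injective (toLex.injective
        (le_antisymm (word_le_of_coord_ne_zero hne) (hmin g hg))))
    rw [this, mul_zero]

/-- A coordinate vanishes unless both colours occur equally often. -/
theorem coordMap_eq_zero_of_unbalanced {m : ℕ} (x : TLHom 0 m) {w : Fin m → Bool}
    (hw : ∑ p, (if w p then (1 : ℤ) else -1) ≠ 0) : coordMap t m x w = 0 := by
  induction x using dia_induction with
  | h0 => simp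
  | hadd x y hx hy => rw [map_add, Pi.add_apply, hx, hy, add_zero]
  | hsmul c x hx => rw [map_smul, Pi.smul_apply, hx, smul_zero]
  | hd f =>
  rw [coordMap_dia]
  induction f using cup_induction with
  | h0 => simp at hw
  | @hc n i h f ih =>
    rw [coord_comp_cupAt, cupOp]
    rw [sum_skip h] at hw
    have h0 : i < n + 2 := by omega
    have h0' : i + 1 < n + 2 := by omega
    by_cases h1 : w ⟨i, h0⟩ = w ⟨i + 1, h0'⟩
    · rw [wt, if_pos h1, zero_mul]
    · rw [ih, mul_zero]
      revert hw h1
      generalize w ⟨i, h0⟩ = a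
      generalize w ⟨i + 1, h0'⟩ = b
      cases a <;> cases b <;> simp

/-! ### Coordinates along lists -/

/-- The colouring with the given list of colours. -/
def ofList (m : ℕ) (l : List Bool) (p : Fin m) : Bool := l.getD p.1 false

theorem ofList_eq_ins {n : ℕ} (l₁ l₂ : List Bool) (p q : Bool) (h : l₁.length ≤ n) :
    ofList (n + 2) (l₁ ++ p :: q :: l₂) = ins h p q (ofList n (l₁ ++ l₂)) := by
  apply eq_ins
  · simp [ofList]
  · simp [ofList, List.getD_eq_getElem?_getD]
  · funext k
    simp only [Function.comp_apply, ofList, skip]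
    by_cases hk : k.1 < l₁.length
    · simp [hk, List.getD_eq_getElem?_getD, List.getElem?_append_left]
    · have h1 : ¬ k.1 + 2 < l₁.length := by omega
      have h2 : k.1 + 2 - l₁.length = (k.1 - l₁.length) + 2 := by omega
      rw [if_neg hk]
      simp only [List.getD_eq_getElem?_getD]
      rw [List.getElem?_append_right (by omega), List.getElem?_append_right (by omega), h2]
      rfl

/-- The number of pairs of entries in the wrong order. -/
def inversions : List Bool → ℕ
  | [] => 0
  | false :: l => inversions l
  | true :: l => l.count false + inversions l

/-- The list with the same entries in increasing order. -/
def sorted (l : List Bool) : List Bool :=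
  List.replicate (l.count false) false ++ List.replicate (l.count true) true

/-! Functions on words for which the exchange of neighbours `true`, `false` is multiplication by
`κ` are determined by one value for each number of entries `true`. -/

section swapRule

variable {m : ℕ} {V : List Bool → ℂ} {κ : ℂ}
  (hV : ∀ l₁ l₂ : List Bool, l₁.length + l₂.length + 2 = m →
    V (l₁ ++ true :: false :: l₂) = κ * V (l₁ ++ false :: true :: l₂))

include hV

theorem move_true (a : ℕ) (l₁ l₂ : List Bool) (h : l₁.length + (a + 1) + l₂.length = m) :
    V (l₁ ++ true :: (List.replicate a false ++ l₂)) =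
      κ ^ a * V (l₁ ++ (List.replicate a false ++ true :: l₂)) := by
  induction a generalizing l₁ with
  | zero => simp
  | succ a ih =>
    rw [List.replicate_succ, List.cons_append, hV _ _ (by simp; omega)]
    have := ih (l₁ ++ [false]) (by simp; omega)
    simp only [List.append_assoc, List.cons_append, List.nil_append] at this
    rw [this, pow_succ]
    simp only [List.cons_append]
    ring

theorem eq_pow_inversions_mul (l₁ l : List Bool) (h : l₁.length + l.length = m) :
    V (l₁ ++ l) = κ ^ inversions l * V (l₁ ++ sorted l) := by
  induction l generalizing l₁ with
  | nil => simp [inversions, sorted]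
  | cons p l ih =>
    have := ih (l₁ ++ [p]) (by simp at h ⊢; omega)
    simp only [List.append_assoc, List.cons_append, List.nil_append] at this
    rw [this]
    cases p with
    | false =>
      simp only [inversions, sorted, List.count_cons_self, List.replicate_succ, List.cons_append]
      simp
    | true =>
      have hl : l.count false + l.count true = l.length := by
        have := List.count_false_add_count_true l
        omega
      have h2 := move_true hV (l.count false) l₁ (List.replicate (l.count true) true)
        (by simp at h ⊢; omega)
      simp only [inversions, sorted, List.count_cons_self, List.replicate_succ]
      rw [h2, pow_add]
      simp
      ring

end swapRule

/-! ### Gaussian sums over words -/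

/-- The sum of the values of `F` at the words of length `N` with `k` entries `true`, weighted by
powers of `κ` that count inversions: a leading `true` stands before `N - k` entries `false`. For
`k > N` the difference is truncated, but then the sum is zero. -/
def wordSum (κ : ℂ) : ℕ → ℕ → (List Bool → ℂ) → ℂ
  | 0, 0, F => F []
  | 0, _ + 1, _ => 0
  | N + 1, 0, F => wordSum κ N 0 fun l => F (false :: l)
  | N + 1, k + 1, F => wordSum κ N (k + 1) (fun l => F (false :: l)) +
      κ ^ (N - k) * wordSum κ N k (fun l => F (true :: l))

/-- Gaussian binomial coefficients. -/
def gauss (ω : ℂ) : ℕ → ℕ → ℂ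
  | _, 0 => 1
  | 0, _ + 1 => 0
  | N + 1, k + 1 => gauss ω N (k + 1) + ω ^ (N - k) * gauss ω N k

theorem wordSum_of_eq {κ : ℂ} (N k : ℕ) (F : List Bool → ℂ) (c : ℂ)
    (hF : ∀ l : List Bool, l.length = N → l.count true = k → F l = κ ^ inversions l * c) :
    wordSum κ N k F = gauss (κ ^ 2) N k * c := by
  induction N generalizing k F c with
  | zero =>
    cases k with
    | zero => simpa [wordSum, gauss, inversions] using hF [] rfl rfl
    | succ k => simp [wordSum, gauss]
  | succ N ih =>
    cases k with
    | zero =>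
      rw [wordSum, ih 0 _ c]
      · cases N <;> rfl
      · intro l h1 h2
        rw [hF _ (by simp [h1]) (by simp [h2]), inversions]
    | succ k =>
      rw [wordSum, gauss, ih (k + 1) _ c, ih k _ (κ ^ (N - k) * c)]
      · ring
      · intro l h1 h2
        have h3 := List.count_false_add_count_true l
        have h4 : l.count false = N - k := by omega
        rw [hF _ (by simp [h1]) (by simp [h2]), inversions, h4, pow_add]
        ring
      · intro l h1 h2
        rw [hF _ (by simp [h1]) (by simp [h2]), inversions]

theorem wordSum_zero (κ : ℂ) (N k : ℕ) : wordSum κ N k (fun _ => 0) = 0 := by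
  have := wordSum_of_eq (κ := κ) N k (fun _ => 0) 0 (by simp)
  rwa [mul_zero] at this

theorem wordSum_add (κ : ℂ) (N k : ℕ) (F G : List Bool → ℂ) :
    wordSum κ N k (fun l => F l + G l) = wordSum κ N k F + wordSum κ N k G := by
  induction N generalizing k F G with
  | zero => cases k <;> simp [wordSum]
  | succ N ih =>
    cases k with
    | zero => simp only [wordSum, ih]
    | succ k => simp only [wordSum, ih]; ring

theorem wordSum_mul (κ : ℂ) (N k : ℕ) (c : ℂ) (F : List Bool → ℂ) :
    wordSum κ N k (fun l => c * F l) = c * wordSum κ N k F := by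
  induction N generalizing k F with
  | zero => cases k <;> simp [wordSum]
  | succ N ih =>
    cases k with
    | zero => simp only [wordSum, ih]
    | succ k => simp only [wordSum, ih]; ring

theorem wordSum_eq_zero_of_gt (κ : ℂ) {N k : ℕ} (h : N < k) (F : List Bool → ℂ) :
    wordSum κ N k F = 0 := by
  induction N generalizing k F with
  | zero =>
    obtain ⟨k, rfl⟩ := Nat.exists_eq_add_of_le' (show 1 ≤ k by omega)
    rfl
  | succ N ih =>
    obtain ⟨k, rfl⟩ := Nat.exists_eq_add_of_le' (show 1 ≤ k by omega)
    rw [wordSum, ih (by omega), ih (by omega), mul_zero, add_zero]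

/-- The two orientations of an arc that joins neighbours cancel in the weighted sum. -/
theorem wordSum_eq_zero {t κ : ℂ} (hκ : κ * t = -1) (N k i : ℕ) (hi : i + 2 ≤ N)
    (F : List Bool → ℂ)
    (h1 : ∀ (p : Bool) (l₁ l₂ : List Bool), l₁.length = i → F (l₁ ++ p :: p :: l₂) = 0)
    (h2 : ∀ l₁ l₂ : List Bool, l₁.length = i →
      F (l₁ ++ true :: false :: l₂) = t * F (l₁ ++ false :: true :: l₂)) :
    wordSum κ N k F = 0 := by
  induction i generalizing N k F with
  | zero =>
    obtain ⟨N, rfl⟩ := Nat.exists_eq_add_of_le' hi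
    have e1 : ∀ p l, F (p :: p :: l) = 0 := fun p l => h1 p [] l rfl
    have e2 : ∀ l, F (true :: false :: l) = t * F (false :: true :: l) := fun l => h2 [] l rfl
    cases k with
    | zero => simp only [wordSum, e1, wordSum_zero]
    | succ k =>
      cases k with
      | zero =>
        simp only [zero_add, wordSum, e1, e2, wordSum_zero, wordSum_mul, Nat.sub_zero]
        linear_combination (κ ^ N * wordSum κ N 0 fun l => F (false :: true :: l)) * hκ
      | succ k =>
        simp only [zero_add, wordSum, e1, e2, wordSum_zero, wordSum_mul]
        by_cases hk : k + 1 ≤ N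
        · have e3 : N + 1 - (k + 1) = N - (k + 1) + 1 := by omega
          rw [e3, pow_succ]
          linear_combination (κ ^ (N - (k + 1)) *
            wordSum κ N (k + 1) fun l => F (false :: true :: l)) * hκ
        · rw [wordSum_eq_zero_of_gt κ (by omega)]
          ring
  | succ i ih =>
    obtain ⟨N, rfl⟩ := Nat.exists_eq_add_of_le' (show 1 ≤ N by omega)
    have key : ∀ a k, wordSum κ N k (fun l => F (a :: l)) = 0 := fun a k =>
      ih N k (by omega) _ (fun p l₁ l₂ hl => h1 p (a :: l₁) l₂ (by simp [hl]))
        (fun l₁ l₂ hl => h2 (a :: l₁) l₂ (by simp [hl]))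
    cases k with
    | zero => rw [wordSum, key]
    | succ k => rw [wordSum, key, key, mul_zero, add_zero]

end TL

/-! ### Gaussian binomial coefficients at roots of unity -/

namespace TL

open Polynomial in
/-- The Gaussian binomial theorem. -/
theorem coeff_prod_one_add (ω : ℂ) (N k : ℕ) :
    (∏ i ∈ Finset.range N, (1 + C (ω ^ i) * X)).coeff k = ω ^ k.choose 2 * gauss ω N k := by
  induction N generalizing k with
  | zero => cases k <;> simp [gauss, Polynomial.coeff_one]
  | succ N ih =>
    rw [Finset.prod_range_succ, mul_add, mul_one, ← mul_assoc, mul_comm _ (C (ω ^ N)), mul_assoc]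
    cases k with
    | zero =>
      rw [Polynomial.coeff_add, ih, Polynomial.coeff_C_mul, Polynomial.coeff_mul_X_zero]
      cases N <;> simp [gauss]
    | succ k =>
      rw [Polynomial.coeff_add, ih, Polynomial.coeff_C_mul, Polynomial.coeff_mul_X, ih, gauss]
      have h1 : (k + 1).choose 2 = k + k.choose 2 := by
        rw [Nat.choose_succ_succ' k 1, Nat.choose_one_right]
      by_cases hk : k ≤ N
      · have h2 : ω ^ N = ω ^ k * ω ^ (N - k) := by
          rw [← pow_add, Nat.add_sub_cancel' hk]
        rw [h1, h2, pow_add]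
        ring
      · have h3 : ∀ N k, N < k → gauss ω N k = 0 := by
          intro N
          induction N with
          | zero => intro k hk; cases k with
            | zero => omega
            | succ k => rfl
          | succ N ihN => intro k hk; cases k with
            | zero => omega
            | succ k => rw [gauss, ihN _ (by omega), ihN _ (by omega)]; ring
        rw [h3 N k (by omega), h3 N (k + 1) (by omega)]
        ring

open Polynomial in
theorem prod_one_add_of_isPrimitiveRoot {ω : ℂ} {r : ℕ} (hr : 0 < r) (h : IsPrimitiveRoot ω r) :
    ∏ i ∈ Finset.range r, (1 + C (ω ^ i) * X) = 1 - (-1) ^ r * X ^ r := by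
  have hC : IsPrimitiveRoot (C ω) r := h.map_of_injective C_injective
  have h1 := hC.pow_sub_pow_eq_prod_sub_mul (1 : ℂ[X]) (-X) hr
  rw [one_pow, neg_pow] at h1
  rw [h1]
  have h2 : nthRootsFinset r (1 : ℂ[X]) = (Finset.range r).image (fun i => C ω ^ i) := by
    symm
    apply Finset.eq_of_subset_of_card_le
    · intro x hx
      obtain ⟨i, -, rfl⟩ := Finset.mem_image.1 hx
      rw [mem_nthRootsFinset hr, ← pow_mul, mul_comm, pow_mul, hC.pow_eq_one, one_pow]
    · rw [hC.card_nthRootsFinset, Finset.card_image_of_injOn, Finset.card_range]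
      intro i hi j hj hij
      exact hC.pow_inj (Finset.mem_range.1 hi) (Finset.mem_range.1 hj) hij
  rw [h2, Finset.prod_image]
  · exact Finset.prod_congr rfl fun i _ => by rw [C_pow]; ring
  · intro i hi j hj hij
    exact hC.pow_inj (Finset.mem_range.1 hi) (Finset.mem_range.1 hj) hij

open Polynomial in
/-- By the Gaussian binomial theorem this coefficient is, up to a power of `ω`, the Gaussian
binomial coefficient in row `N` and column `r`. Each block of `r` consecutive factors multiplies to
`1 - (-1) ^ r * X ^ r`. -/
theorem coeff_prod_of_isPrimitiveRoot {ω : ℂ} {r : ℕ} (hr : 0 < r) (h : IsPrimitiveRoot ω r)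
    (N : ℕ) : (∏ i ∈ Finset.range N, (1 + C (ω ^ i) * X)).coeff r =
      -(-1) ^ r * ((N / r : ℕ) : ℂ) := by
  induction N using Nat.strong_induction_on with
  | _ N ih =>
  by_cases hN : N < r
  · rw [Nat.div_eq_of_lt hN, Nat.cast_zero, mul_zero]
    apply Polynomial.coeff_eq_zero_of_natDegree_lt
    refine lt_of_le_of_lt (natDegree_prod_le _ _) ?_
    refine lt_of_le_of_lt (Finset.sum_le_card_nsmul _ _ 1 fun i _ => ?_) (by simpa using hN)
    compute_degree
  · obtain ⟨N, rfl⟩ := Nat.exists_eq_add_of_le (not_lt.1 hN)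
    have e : ∏ i ∈ Finset.range (r + N), (1 + C (ω ^ i) * X) =
        (∏ i ∈ Finset.range N, (1 + C (ω ^ i) * X)) * (1 - C ((-1) ^ r) * X ^ r) := by
      rw [Finset.prod_range_add, prod_one_add_of_isPrimitiveRoot hr h, mul_comm]
      congr 1
      · exact Finset.prod_congr rfl fun i _ => by rw [pow_add, h.pow_eq_one, one_mul]
      · simp
    have h0 : (∏ i ∈ Finset.range N, (1 + C (ω ^ i) * X)).coeff 0 = 1 := by
      rw [coeff_zero_eq_eval_zero, eval_prod]
      simp
    rw [e, mul_sub, mul_one, ← mul_assoc, mul_comm _ (C _), mul_assoc, coeff_sub, coeff_C_mul,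
      coeff_mul_X_pow', if_pos le_rfl, Nat.sub_self, h0, ih N (by omega),
      Nat.add_div_left _ hr]
    push_cast
    ring

theorem gauss_ne_zero {ω : ℂ} {r : ℕ} (hr : 0 < r) (h : IsPrimitiveRoot ω r) {N : ℕ}
    (hN : r ≤ N) : gauss ω N r ≠ 0 := by
  intro h0
  have h1 := coeff_prod_one_add ω N r
  rw [coeff_prod_of_isPrimitiveRoot hr h, h0, mul_zero] at h1
  have h2 : ((N / r : ℕ) : ℂ) ≠ 0 := Nat.cast_ne_zero.2 (Nat.div_pos hN hr).ne'
  exact mul_ne_zero (neg_ne_zero.2 (pow_ne_zero _ (neg_ne_zero.2 one_ne_zero))) h2 h1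

/-! ### Morphisms without lower end points that are annihilated by caps -/

open Word TLDiagram

variable {t d : ℂ}

/-- The vanishing under a cap relates the two orientations of neighbouring points. -/
theorem swap_rule (ht : t ≠ 0) (hd : d = t + t⁻¹) {m : ℕ} {x : TLHom 0 m} (hx : TopKilled d x)
    (l₁ l₂ : List Bool) (h : l₁.length + l₂.length + 2 = m) :
    coordMap t m x (ofList m (l₁ ++ true :: false :: l₂)) =
      -t⁻¹ * coordMap t m x (ofList m (l₁ ++ false :: true :: l₂)) := by
  subst h
  have h1 := congrArg (coordMap t _) (hx _ l₁.length (Nat.le_add_right _ l₂.length) rfl)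
  rw [map_zero] at h1
  have h2 := congrFun ((coordMap_comp_capAt ht hd _ x).symm.trans h1) (ofList _ (l₁ ++ l₂))
  rw [ofList_eq_ins _ _ _ _ (Nat.le_add_right _ _), ofList_eq_ins _ _ _ _ (Nat.le_add_right _ _)]
  simp only [capOp, Fintype.sum_bool, wt', Pi.zero_apply] at h2
  simp at h2
  linear_combination h2

theorem ofList_ofFn {m : ℕ} (w : Fin m → Bool) : ofList m (List.ofFn w) = w := by
  funext p
  simp [ofList, List.getD_eq_getElem?_getD]

theorem inversions_append_replicate (l : List Bool) (b : ℕ) :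
    inversions (l ++ List.replicate b true) = inversions l := by
  induction l with
  | nil =>
    induction b with
    | zero => rfl
    | succ b ih =>
      simp only [List.nil_append] at ih
      simp [List.replicate_succ, inversions, ih, List.count_replicate]
  | cons p l ih => cases p <;> simp [inversions, ih, List.count_replicate]

/-- The weighted sum of the coordinates along the words with a fixed suffix is zero for each
diagram: there are more than `n` points in front of the suffix, and among these some arc joins
neighbours. -/
theorem wordSum_coordMap (ht : t ≠ 0) (n r : ℕ) (hr : 1 ≤ r) (hn : 1 ≤ n) (suffix : List Bool)
    (x : TLHom 0 (2 * n)) :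
    wordSum (-t⁻¹) (n + r) r (fun l => coordMap t (2 * n) x (ofList _ (l ++ suffix))) = 0 := by
  induction x using dia_induction with
  | h0 => simp only [map_zero, Pi.zero_apply, wordSum_zero]
  | hadd x y hx hy => simp only [map_add, Pi.add_apply, wordSum_add, hx, hy, add_zero]
  | hsmul c x hx => simp only [map_smul, Pi.smul_apply, smul_eq_mul, wordSum_mul, hx, mul_zero]
  | hd f =>
    obtain ⟨n, rfl⟩ := Nat.exists_eq_add_of_le' hn
    obtain ⟨i, hi, g, hin, hf⟩ := f.exists_cup_le n rfl
    replace hf : f = g.comp (.cupAt (2 * n) i hi) := hf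
    have key : ∀ (p q : Bool) (l₁ l₂ : List Bool), l₁.length = i →
        coordMap t (2 * (n + 1)) (dia f) (ofList _ ((l₁ ++ p :: q :: l₂) ++ suffix)) =
          wt t p q * g.coord t (ofList _ (l₁ ++ (l₂ ++ suffix))) := by
      rintro p q l₁ l₂ rfl
      rw [coordMap_dia, hf]
      have h1 := ofList_eq_ins (n := 2 * n) l₁ (l₂ ++ suffix) p q hi
      have h2 : l₁ ++ p :: q :: l₂ ++ suffix = l₁ ++ p :: q :: (l₂ ++ suffix) := by simp
      rw [h2]
      refine (congrFun (coord_comp_cupAt t hi g) _).trans ?_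
      refine (congrArg (cupOp hi (wt t) (g.coord t)) h1).trans ?_
      rw [cupOp, ins_left, ins_right, ins_comp_skip]
    refine wordSum_eq_zero (t := t) (i := i) (by field_simp) _ _ (by omega) _ ?_ ?_
    · intro p l₁ l₂ hl
      rw [key p p l₁ l₂ hl, wt, if_pos rfl, zero_mul]
    · intro l₁ l₂ hl
      rw [key _ _ l₁ l₂ hl, key _ _ l₁ l₂ hl]
      simp [wt]

/-- All balanced coordinates of `x` are multiples of a single one, the value `c` at the sorted
word. The weighted sum of the coordinates over the words that end in `n - r` entries `true` is a
nonzero Gaussian binomial coefficient times `c`, and it is zero because it is zero for each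
diagram. -/
theorem eq_zero_of_topKilled (ht : t ≠ 0) (hd : d = t + t⁻¹) {r : ℕ} (hr : 1 ≤ r)
    (h : IsPrimitiveRoot (t ^ 2) r) {n : ℕ} (hn : r ≤ n) {x : TLHom 0 (2 * n)}
    (hx : TopKilled d x) : x = 0 := by
  have hω : IsPrimitiveRoot ((-t⁻¹) ^ 2) r := by
    have := h.inv
    rwa [← inv_pow, ← neg_sq] at this
  set c := coordMap t (2 * n) x (ofList _ (List.replicate n false ++ List.replicate n true))
    with hc
  have hV := eq_pow_inversions_mul (V := fun l => coordMap t (2 * n) x (ofList _ l))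
    (swap_rule ht hd hx) []
  simp only [List.nil_append, List.length_nil, zero_add] at hV
  have h1 := wordSum_coordMap (t := t) ht n r hr (by omega) (List.replicate (n - r) true) x
  rw [wordSum_of_eq _ _ _ c] at h1
  · have hc0 : c = 0 := (mul_eq_zero.1 h1).resolve_left (gauss_ne_zero (by omega) hω (by omega))
    apply eq_zero_of_coordMap (t := t)
    funext w
    by_cases hw : ∑ p, (if w p then (1 : ℤ) else -1) = 0
    · have h2 := hV (List.ofFn w) (by simp)
      rw [ofList_ofFn] at h2
      have h3 := List.count_false_add_count_true (List.ofFn w)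
      have h4 : ((List.ofFn w).count true : ℤ) - (List.ofFn w).count false =
          ∑ p, (if w p then (1 : ℤ) else -1) := by
        rw [← List.sum_ofFn]
        have : ∀ l : List Bool, (l.count true : ℤ) - l.count false =
            (l.map fun p => if p then (1 : ℤ) else -1).sum := by
          intro l
          induction l with
          | nil => rfl
          | cons p l ih => cases p <;> simp [← ih] <;> ring
        rw [this, List.map_ofFn]
        rfl
      rw [List.length_ofFn] at h3
      have h5 : (List.ofFn w).count false = n := by omega
      have h6 : (List.ofFn w).count true = n := by omega
      rw [h2, sorted, h5, h6, ← hc, hc0, mul_zero, Pi.zero_apply]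
    · exact coordMap_eq_zero_of_unbalanced x hw
  · intro l h2 h3
    have h4 := List.count_false_add_count_true l
    rw [hV _ (by simp; omega), inversions_append_replicate]
    congr 1
    rw [hc, sorted]
    have e1 : (l ++ List.replicate (n - r) true).count false = n := by
      simp [List.count_replicate]; omega
    have e2 : (l ++ List.replicate (n - r) true).count true = n := by
      simp; omega
    rw [e1, e2]

end TL

/-! ### Nonzero tensor ideals -/

namespace TL

variable {d : ℂ}

/-- The last lower end point is bent up to the right. -/
def bend (d : ℂ) {m n : ℕ} (x : TLHom (m + 1) n) : TLHom m (n + 1) :=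
  comp d (cupAt m m le_rfl) (addStrand x)

/-- The last upper end point is bent down to the right. -/
def unbend (d : ℂ) {m n : ℕ} (y : TLHom m (n + 1)) : TLHom (m + 1) n :=
  comp d (addStrand y) (capAt n n le_rfl)

theorem unbend_bend {m n : ℕ} (x : TLHom (m + 1) n) : unbend d (bend d x) = x := by
  rw [unbend, bend, addStrand_comp, addStrand_cupAt, assoc, addStrand_addStrand_comp_capAt,
    ← assoc, cupAt_comp_capAt_succ d le_rfl, one_comp]

theorem bend_unbend {m n : ℕ} (y : TLHom m (n + 1)) : bend d (unbend d y) = y := by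
  rw [unbend, bend, addStrand_comp, addStrand_capAt, ← assoc, cupAt_comp_addStrand_addStrand,
    assoc, cupAt_succ_comp_capAt d le_rfl, comp_one]

end TL

namespace TLIdeal

open TL

variable {d : ℂ} (I : TLIdeal d)

theorem addStrand_mem {m n : ℕ} {x : TLHom m n} (hx : x ∈ I.hom m n) :
    addStrand x ∈ I.hom (m + 1) (n + 1) :=
  I.tensor_mem_right (one 1) hx

/-- The ideal contains a nonzero morphism with the given numbers of end points. -/
def NonzeroAt (m n : ℕ) : Prop := ∃ x ∈ I.hom m n, x ≠ 0

theorem nonzeroAt_succ_iff (m n : ℕ) : I.NonzeroAt (m + 1) n ↔ I.NonzeroAt m (n + 1) := by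
  constructor
  · rintro ⟨x, hx, h0⟩
    refine ⟨bend d x, I.comp_mem_left _ (I.addStrand_mem hx), fun h => h0 ?_⟩
    rw [← unbend_bend (d := d) x, h, unbend, map_zero, zero_comp]
  · rintro ⟨x, hx, h0⟩
    refine ⟨unbend d x, I.comp_mem_right _ (I.addStrand_mem hx), fun h => h0 ?_⟩
    rw [← bend_unbend (d := d) x, h, bend, map_zero, comp_zero]

/-- Bending is invertible, so only the total number of end points matters. -/
theorem nonzeroAt_iff (m n : ℕ) : I.NonzeroAt m n ↔ I.NonzeroAt 0 (m + n) := by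
  induction m generalizing n with
  | zero => rw [Nat.zero_add]
  | succ m ih => rw [nonzeroAt_succ_iff, ih, Nat.add_assoc, Nat.add_comm n 1]

theorem NonzeroAt.even {m : ℕ} (h : I.NonzeroAt 0 m) : Even m := by
  obtain ⟨x, -, h0⟩ := h
  obtain ⟨f, -⟩ := Finsupp.support_nonempty_iff.2 h0
  induction f using TLDiagram.cup_induction with
  | h0 => exact Even.zero
  | hc h f ih =>
    rename_i n i
    by_cases hx : ∃ x : TLHom 0 n, x ≠ 0
    · obtain ⟨x, hx⟩ := hx
      exact (ih x hx).add even_two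
    · exact absurd ⟨dia f, by simp [dia]⟩ hx

theorem mem_of_one_mem (h : one 0 ∈ I.hom 0 0) {m n : ℕ} (x : TLHom m n) : x ∈ I.hom m n := by
  have := I.tensor_mem_left x h
  rwa [tensor_one_zero] at this

variable {s : ℕ}

/-- Partial traces lead down from the projectors below the critical index to the unit. -/
theorem one_mem_of_jw_mem (hs : ∀ k < s, cheb d k ≠ 0) {k : ℕ} (hk : k < s)
    (h : jw d k ∈ I.hom k k) : one 0 ∈ I.hom 0 0 := by
  induction k with
  | zero => exact h
  | succ k ih =>
    refine ih (by omega) ?_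
    have h1 : ptr d (jw d (k + 1)) ∈ I.hom k k :=
      I.comp_mem_right _ (I.comp_mem_left _ (I.addStrand_mem h))
    rw [ptr_jw hs hk.le] at h1
    exact ((I.hom k k).smul_mem_iff (div_ne_zero (hs _ hk) (hs _ (by omega)))).1 h1

/-- A nonzero morphism of the ideal with as few end points as possible, say `2 * n`, is annihilated
by caps, even after bending end points from the bottom to the top. For `n ≤ s` it is a multiple of a
projector, and for larger `n` it cannot exist. -/
theorem jw_mem {t : ℂ} (ht : t ≠ 0) (hd : d = t + t⁻¹) (h : IsPrimitiveRoot (t ^ 2) (s + 1))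
    (hs : ∀ k < s, cheb d k ≠ 0) (hI : I.IsNonzero) : jw d s ∈ I.hom s s := by
  classical
  have hex : ∃ m, I.NonzeroAt 0 m := by
    obtain ⟨m, n, x, hx, h0⟩ := hI
    exact ⟨m + n, (I.nonzeroAt_iff m n).1 ⟨x, hx, h0⟩⟩
  have hmin : ∀ {a b : ℕ}, a + b < Nat.find hex → ∀ x ∈ I.hom a b, x = 0 := by
    intro a b hab x hx
    by_contra h0
    exact Nat.find_min hex hab ((I.nonzeroAt_iff a b).1 ⟨x, hx, h0⟩)
  have hfind := Nat.find_spec hex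
  obtain ⟨n, hn⟩ := hfind.even
  have hkill : ∀ {a b : ℕ}, a + b = Nat.find hex → ∀ x ∈ I.hom a b, TopKilled d x := by
    rintro a b hab x hx n' i hi rfl
    exact hmin (by omega) _ (I.comp_mem_right _ hx)
  by_cases hns : n ≤ s
  · rw [hn, ← nonzeroAt_iff] at hfind
    obtain ⟨x, hx, h0⟩ := hfind
    have h1 := (hkill hn.symm x hx).comp_end (jw d n)
    rw [(botKilled_jw hs hns).comp_end x, coeff_jw, one_smul] at h1
    have hc : coeff x ≠ 0 := by
      intro hc
      rw [hc, zero_smul] at h1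
      exact h0 h1.symm
    have h2 : jw d n ∈ I.hom n n := by
      rw [← h1] at hx
      exact ((I.hom n n).smul_mem_iff hc).1 hx
    obtain rfl | hlt := Nat.eq_or_lt_of_le hns
    · exact h2
    · exact I.mem_of_one_mem (I.one_mem_of_jw_mem hs hlt h2) _
  · rw [← two_mul] at hn
    rw [hn] at hfind
    obtain ⟨x, hx, h0⟩ := hfind
    exact absurd (eq_zero_of_topKilled ht hd (by omega) h (by omega)
      (hkill (by omega) x hx)) h0

end TLIdeal

/-! ### Traces -/

namespace Conn

open Word

/-- The equivalence relation on `α` of lying on the same component of the closure of `f`, where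
each lower end point is joined to the upper end point above it. -/
def closure {α : Type} (f : Setoid (α ⊕ α)) : Setoid α :=
  sInf {s | f ≤ s.comap (Sum.elim id id)}

/-- The number of components of the closure. -/
def closureLoops {α : Type} (f : Setoid (α ⊕ α)) : ℕ := Nat.card (Quotient (closure f))

theorem closure_le_ker {α : Type} (f : Setoid (α ⊕ α)) (u : α → Bool) :
    closure f ≤ Setoid.ker u ↔ f ≤ Setoid.ker (Sum.elim u u) := by
  have h1 : (Setoid.ker u).comap (Sum.elim id id) = Setoid.ker (Sum.elim u u) := by
    ext x y
    rcases x with x | x <;> rcases y with y | y <;> rfl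
  constructor
  · intro h x y hxy
    rw [← h1]
    exact h (fun s hs => hs hxy)
  · intro h
    exact sInf_le (by rw [Set.mem_ofPred_eq, h1]; exact h)

theorem trace_mat {α : Type} [Fintype α] [DecidableEq α] (f : Setoid (α ⊕ α)) :
    (mat f).trace = 2 ^ closureLoops f := by
  classical
  have h1 : (mat f).trace = Nat.card {u : α → Bool // closure f ≤ Setoid.ker u} := by
    rw [Nat.card_eq_fintype_card, Fintype.card_subtype, Finset.card_filter, Matrix.trace]
    exact Finset.sum_congr rfl fun u _ => by
      rw [Matrix.diag_apply, mat_apply, closure_le_ker]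
  rw [h1, Nat.card_congr (Setoid.liftEquiv _), Nat.card_fun]
  simp [closureLoops]

/-- The entries of a matrix that is closed up by a cup and a cap. -/
theorem mat_cupAt_mul_mul_mat_capAt {m n i j : ℕ} (hi : i ≤ m) (hj : j ≤ n)
    (M : Matrix (Fin (m + 2) → Bool) (Fin (n + 2) → Bool) ℕ) (a : Fin m → Bool)
    (b : Fin n → Bool) :
    (mat (cupAt m i) * M * mat (capAt n j)) a b = ∑ p, ∑ q, M (ins hi p p a) (ins hj q q b) := by
  have h1 : ∀ c, (mat (cupAt m i) * M) a c = ∑ p, M (ins hi p p a) c := by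
    intro c
    rw [Matrix.mul_apply, sum_ins hi]
    refine Finset.sum_congr rfl fun p _ => ?_
    simp only [mat_cupAt hi, ins_left, ins_right, ins_comp_skip, mul_ite, mul_one, mul_zero,
      ite_mul, zero_mul, Finset.sum_ite_eq, Finset.mem_univ, if_true]
    cases p <;> simp [same]
  rw [mul_mat_capAt hj, capOp, Finset.sum_comm]
  refine Eq.trans ?_ Finset.sum_comm
  refine Finset.sum_congr rfl fun q _ => ?_
  simp only [h1]
  cases q <;> simp [same]

end Conn

/-- The diagram `f`, with its numbers of end points rewritten. -/
def TLDiagram.cast {m n m' n' : ℕ} (hm : m = m') (hn : n = n') (f : TLDiagram m n) :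
    TLDiagram m' n' :=
  hm ▸ hn ▸ f

theorem TLDiagram.mat_cast {m n m' n' : ℕ} (hm : m = m') (hn : n = n') (f : TLDiagram m n)
    (a : Fin m' → Bool) (b : Fin n' → Bool) :
    Conn.mat (f.cast hm hn).1 a b = Conn.mat f.1 (a ∘ Fin.cast hm) (b ∘ Fin.cast hn) := by
  subst hm hn
  rfl

/-- A vertical strand on the left. -/
def TLDiagram.addLeft {m n : ℕ} (f : TLDiagram m n) : TLDiagram (m + 1) (n + 1) :=
  ((one 1).tensor f).cast (Nat.add_comm 1 m) (Nat.add_comm 1 n)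

theorem TLDiagram.mat_addLeft {m n : ℕ} (f : TLDiagram m n) (a : Fin (m + 1) → Bool)
    (b : Fin (n + 1) → Bool) :
    Conn.mat f.addLeft.1 a b =
      (if a 0 = b 0 then 1 else 0) * Conn.mat f.1 (a ∘ Fin.succ) (b ∘ Fin.succ) := by
  rw [addLeft, mat_cast]
  refine (Conn.mat_tensor (Conn.one (Fin 1)) f.1 _ _).trans ?_
  rw [Conn.mat_one, Matrix.one_apply]
  have h : ∀ n : ℕ, Fin.cast (Nat.add_comm 1 n) ∘ Fin.natAdd 1 = Fin.succ := by
    intro n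
    funext x
    exact Fin.ext (Nat.add_comm 1 x.1)
  rw [Function.comp_assoc, Function.comp_assoc, Function.comp_assoc, Function.comp_assoc, h, h]
  congr 1
  simp only [funext_iff, Fin.forall_fin_one]
  rfl

theorem TLDiagram.one_succ_tensor (k : ℕ) {m n : ℕ} (f : TLDiagram m n) :
    (one (k + 1)).tensor f =
      ((one k).tensor f).addLeft.cast (Nat.add_right_comm k m 1) (Nat.add_right_comm k n 1) := by
  refine Subtype.ext (Conn.eq_of_mat ?_)
  ext a b
  rw [mat_cast, mat_addLeft]
  refine (Conn.mat_tensor (Conn.one (Fin (k + 1))) f.1 _ _).trans ?_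
  refine Eq.trans ?_ (congrArg _ (Conn.mat_tensor (Conn.one (Fin k)) f.1 _ _).symm)
  have h : ∀ n : ℕ, Fin.cast (Nat.add_right_comm k n 1) ∘ Fin.succ ∘ Fin.natAdd k =
      Fin.natAdd (k + 1) := by
    intro n
    funext x
    exact Fin.ext (Nat.add_right_comm k x.1 1)
  rw [Conn.mat_one, Conn.mat_one, Matrix.one_apply, Matrix.one_apply, ← mul_assoc]
  simp only [Function.comp_assoc, h]
  congr 1
  have h0 : ∀ n : ℕ, (Fin.cast (Nat.add_right_comm k n 1)) 0 = Fin.castAdd n 0 := fun n => rfl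
  have h1 : ∀ (n : ℕ) (x : Fin k), Fin.cast (Nat.add_right_comm k n 1) (Fin.castAdd n x).succ =
      Fin.castAdd n x.succ := fun n x => rfl
  simp only [funext_iff, Fin.forall_fin_succ, Function.comp_apply, h0, h1, ite_and]
  split_ifs <;> simp

theorem TLDiagram.one_zero_tensor {m n : ℕ} (f : TLDiagram m n) :
    (one 0).tensor f = f.cast (Nat.zero_add m).symm (Nat.zero_add n).symm := by
  refine Subtype.ext (Conn.eq_of_mat ?_)
  ext a b
  rw [mat_cast]
  refine (Conn.mat_tensor (Conn.one (Fin 0)) f.1 _ _).trans ?_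
  have h : ∀ n : ℕ, Fin.cast (Nat.zero_add n).symm = Fin.natAdd 0 := fun n => by
    funext x
    exact Fin.ext (Nat.zero_add x.1).symm
  rw [Conn.mat_one, Subsingleton.elim (a ∘ Fin.castAdd m) (b ∘ Fin.castAdd n), Matrix.one_apply_eq,
    one_mul, h, h]

namespace TL

open Word

variable {d : ℂ}

/-- The multiple of a diagram by the power of the loop value that belongs to a power of two in
the matrix: products of such multiples can be computed with matrices. -/
def Represents (d : ℂ) {m n : ℕ} (x : TLHom m n)
    (M : Matrix (Fin m → Bool) (Fin n → Bool) ℕ) : Prop :=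
  ∃ (l : ℕ) (f : TLDiagram m n), x = d ^ l • dia f ∧ M = 2 ^ l • Conn.mat f.1

theorem represents_dia {m n : ℕ} (f : TLDiagram m n) : Represents d (dia f) (Conn.mat f.1) :=
  ⟨0, f, by simp, by simp⟩

theorem Represents.comp {m n k : ℕ} {x : TLHom m n} {y : TLHom n k}
    {M : Matrix (Fin m → Bool) (Fin n → Bool) ℕ} {N : Matrix (Fin n → Bool) (Fin k → Bool) ℕ}
    (hx : Represents d x M) (hy : Represents d y N) : Represents d (comp d x y) (M * N) := by
  obtain ⟨l, f, rfl, rfl⟩ := hx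
  obtain ⟨l', f', rfl, rfl⟩ := hy
  refine ⟨l + l' + f.loops f', f.comp f', ?_, ?_⟩
  · rw [smul_comp, comp_smul, dia_comp, smul_smul, smul_smul, pow_add, pow_add]
  · rw [Matrix.smul_mul, Matrix.mul_smul, Conn.mat_mul, smul_smul, smul_smul, pow_add, pow_add]
    rfl

/-- The Markov trace: the end points of a diagram are joined, and each loop of the closure is
replaced by the factor `d`. -/
def tr (d : ℂ) {n : ℕ} : TLHom n n →ₗ[ℂ] ℂ :=
  Finsupp.linearCombination ℂ fun f => d ^ Conn.closureLoops f.1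

theorem tr_dia {n : ℕ} (f : TLDiagram n n) : tr d (dia f) = d ^ Conn.closureLoops f.1 := by
  simp [tr, dia]

/-- Traces in the category agree if the traces of the matrices do. -/
theorem Represents.tr_eq {m n : ℕ} {x : TLHom m m} {y : TLHom n n}
    {M : Matrix (Fin m → Bool) (Fin m → Bool) ℕ} {N : Matrix (Fin n → Bool) (Fin n → Bool) ℕ}
    (hx : Represents d x M) (hy : Represents d y N) (h : M.trace = N.trace) :
    tr d x = tr d y := by
  obtain ⟨l, f, rfl, rfl⟩ := hx
  obtain ⟨l', f', rfl, rfl⟩ := hy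
  rw [Matrix.trace_smul, Matrix.trace_smul, Conn.trace_mat, Conn.trace_mat, smul_eq_mul,
    smul_eq_mul, ← pow_add, ← pow_add] at h
  rw [map_smul, map_smul, tr_dia, tr_dia, smul_eq_mul, smul_eq_mul, ← pow_add, ← pow_add,
    Nat.pow_right_injective le_rfl h]

theorem tr_comp_comm {m n : ℕ} (x : TLHom m n) (y : TLHom n m) :
    tr d (comp d x y) = tr d (comp d y x) := by
  induction x using dia_induction with
  | h0 => simp only [zero_comp, comp_zero, map_zero]
  | hadd x z hx hz => simp only [add_comp, comp_add, map_add, hx, hz]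
  | hsmul c x hx => simp only [smul_comp, comp_smul, map_smul, hx]
  | hd f =>
  induction y using dia_induction with
  | h0 => simp only [zero_comp, comp_zero, map_zero]
  | hadd x z hx hz => simp only [add_comp, comp_add, map_add, hx, hz]
  | hsmul c x hx => simp only [smul_comp, comp_smul, map_smul, hx]
  | hd g =>
  exact ((represents_dia f).comp (represents_dia g)).tr_eq
    ((represents_dia g).comp (represents_dia f)) (Matrix.trace_mul_comm _ _)

/-- A vertical strand on the left. -/
def addLeft {m n : ℕ} : TLHom m n →ₗ[ℂ] TLHom (m + 1) (n + 1) :=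
  Finsupp.lmapDomain ℂ ℂ TLDiagram.addLeft

theorem addLeft_dia {m n : ℕ} (f : TLDiagram m n) : addLeft (dia f) = dia f.addLeft := by
  simp [addLeft, dia]

/-- The partial trace that closes up the first strand on the left. -/
def ptrLeft (d : ℂ) {m n : ℕ} (x : TLHom (m + 1) (n + 1)) : TLHom m n :=
  comp d (comp d (cupAt m 0 (Nat.zero_le _)) (addLeft x)) (capAt n 0 (Nat.zero_le _))

/-- A strand on the left can be closed up before the other strands, and on the left: the components
of the closed picture are the same. -/
theorem tr_addLeft_comp {m n : ℕ} (x : TLHom m n) (y : TLHom (n + 1) (m + 1)) :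
    tr d (comp d (addLeft x) y) = tr d (comp d x (ptrLeft d y)) := by
  induction x using dia_induction with
  | h0 => simp only [zero_comp, map_zero]
  | hadd x z hx hz => simp only [add_comp, map_add, hx, hz]
  | hsmul c x hx => simp only [smul_comp, map_smul, hx]
  | hd f =>
  induction y using dia_induction with
  | h0 => simp only [ptrLeft, zero_comp, comp_zero, map_zero]
  | hadd x z hx hz => simp only [ptrLeft, add_comp, comp_add, map_add] at hx hz ⊢; rw [hx, hz]
  | hsmul c x hx => simp only [ptrLeft, smul_comp, comp_smul, map_smul] at hx ⊢; rw [hx]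
  | hd g =>
  rw [ptrLeft, addLeft_dia, addLeft_dia]
  refine ((represents_dia f.addLeft).comp (represents_dia g)).tr_eq
    ((represents_dia f).comp (((represents_dia _).comp (represents_dia g.addLeft)).comp
      (represents_dia _))) ?_
  have e : ∀ {n : ℕ} (p : Bool) (c : Fin n → Bool),
      ins (Nat.zero_le n) p p c = Fin.cons p (Fin.cons p c : Fin (n + 1) → Bool) := by
    intro n p c
    funext k
    refine Fin.cases ?_ (fun k => Fin.cases ?_ (fun k => ?_) k) k <;> simp [ins]
  have hsum : ∀ {n : ℕ} (F : (Fin (n + 1) → Bool) → ℕ),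
      ∑ a, F a = ∑ p, ∑ c, F (Fin.cons p c) := by
    intro n F
    rw [← (Fin.consEquiv fun _ => Bool).sum_comp, Fintype.sum_prod_type]
    rfl
  have hc : ∀ {n : ℕ} (p : Bool) (c : Fin n → Bool),
      (Fin.cons p c : Fin (n + 1) → Bool) ∘ Fin.succ = c := fun p c => funext fun x => by simp
  simp only [Matrix.trace, Matrix.diag_apply]
  rw [hsum, Finset.sum_comm]
  refine Finset.sum_congr rfl fun a _ => ?_
  rw [Matrix.mul_apply]
  simp only [TLDiagram.cupAt, TLDiagram.capAt]
  simp only [Conn.mat_cupAt_mul_mul_mat_capAt (Nat.zero_le _) (Nat.zero_le _), Matrix.mul_apply,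
    TLDiagram.mat_addLeft, hsum, e, hc, Fin.cons_zero, ite_mul, one_mul, zero_mul]
  simp [Finset.sum_add_distrib, mul_add]

/-- A strand on the right can be closed up before the other strands. -/
theorem tr_addStrand_comp {m n : ℕ} (x : TLHom m n) (y : TLHom (n + 1) (m + 1)) :
    tr d (comp d (addStrand x) y) = tr d (comp d x (ptr d y)) := by
  induction x using dia_induction with
  | h0 => simp only [zero_comp, map_zero]
  | hadd x z hx hz => simp only [add_comp, map_add, hx, hz]
  | hsmul c x hx => simp only [smul_comp, map_smul, hx]
  | hd f =>
  induction y using dia_induction with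
  | h0 => simp only [ptr, zero_comp, comp_zero, map_zero]
  | hadd x z hx hz => simp only [ptr, add_comp, comp_add, map_add] at hx hz ⊢; rw [hx, hz]
  | hsmul c x hx => simp only [ptr, smul_comp, comp_smul, map_smul] at hx ⊢; rw [hx]
  | hd g =>
  rw [ptr, addStrand_dia, addStrand_dia]
  refine ((represents_dia _).comp (represents_dia g)).tr_eq
    ((represents_dia f).comp (((represents_dia _).comp (represents_dia (g.tensor (.one 1)))).comp
      (represents_dia _))) ?_
  have e : ∀ {n : ℕ} (p : Bool) (c : Fin n → Bool),
      ins (le_refl n) p p c = Fin.snoc (Fin.snoc c p : Fin (n + 1) → Bool) p := by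
    intro n p c
    funext k
    refine Fin.lastCases ?_ (fun k => Fin.lastCases ?_ (fun k => ?_) k) k <;> simp [ins]
  have hsum : ∀ {n : ℕ} (F : (Fin (n + 1) → Bool) → ℕ),
      ∑ a, F a = ∑ p, ∑ c, F (Fin.snoc c p) := by
    intro n F
    rw [← (Fin.snocEquiv fun _ => Bool).sum_comp, Fintype.sum_prod_type]
    rfl
  have hc : ∀ {n : ℕ} (p : Bool) (c : Fin n → Bool),
      (Fin.snoc c p : Fin (n + 1) → Bool) ∘ Fin.castSucc = c := fun p c => funext fun x => by simp
  simp only [Matrix.trace, Matrix.diag_apply]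
  rw [hsum, Finset.sum_comm]
  refine Finset.sum_congr rfl fun a _ => ?_
  rw [Matrix.mul_apply]
  simp only [TLDiagram.cupAt, TLDiagram.capAt, TLDiagram.tensor, TLDiagram.one]
  simp only [Conn.mat_cupAt_mul_mul_mat_capAt le_rfl le_rfl, Matrix.mul_apply,
    Conn.mat_tensor_one_one, hsum, e, hc, Fin.snoc_last, ite_mul, mul_ite, zero_mul,
    mul_one, mul_zero]
  simp [Finset.sum_add_distrib, mul_add]

/-! ### The ideal of negligible morphisms -/

/-- A morphism is negligible if it is orthogonal to all morphisms under the trace. -/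
def Negligible (d : ℂ) {m n : ℕ} (x : TLHom m n) : Prop := ∀ y, tr d (comp d x y) = 0

theorem Negligible.cast {m n m' n' : ℕ} (hm : m = m') (hn : n = n') {x : TLHom m n}
    (hx : Negligible d x) :
    Negligible d (Finsupp.mapDomain (TLDiagram.cast hm hn) x) := by
  subst hm hn
  have : TLDiagram.cast (rfl : m = m) (rfl : n = n) = id := rfl
  rwa [this, Finsupp.mapDomain_id]

theorem Negligible.comp_right {m n k : ℕ} {x : TLHom m n} (hx : Negligible d x)
    (y : TLHom n k) : Negligible d (comp d x y) := fun z => by rw [assoc]; exact hx _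

theorem Negligible.comp_left {m n k : ℕ} {x : TLHom n k} (hx : Negligible d x)
    (y : TLHom m n) : Negligible d (comp d y x) := fun z => by
  rw [assoc, tr_comp_comm, assoc]
  exact hx _

theorem Negligible.tensor_one {m n : ℕ} {x : TLHom m n} (hx : Negligible d x) (k : ℕ) :
    Negligible d (tensor x (one k)) := by
  induction k with
  | zero => rwa [tensor_one_zero]
  | succ k ih =>
    intro y
    rw [tensor_one_succ]
    exact (tr_addStrand_comp _ _).trans (ih _)

theorem one_zero_tensor {m n : ℕ} (x : TLHom m n) : tensor (one 0) x =
    Finsupp.mapDomain (TLDiagram.cast (Nat.zero_add m).symm (Nat.zero_add n).symm) x := by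
  induction x using dia_induction with
  | h0 => rw [tensor_zero, Finsupp.mapDomain_zero]
  | hadd x y hx hy => rw [tensor_add, Finsupp.mapDomain_add, hx, hy]
  | hsmul c x hx => rw [tensor_smul, Finsupp.mapDomain_smul, hx]
  | hd f =>
    rw [one_eq, dia_tensor, TLDiagram.one_zero_tensor, dia, dia, Finsupp.mapDomain_single]

theorem one_succ_tensor (k : ℕ) {m n : ℕ} (x : TLHom m n) : tensor (one (k + 1)) x =
    Finsupp.mapDomain (TLDiagram.cast (Nat.add_right_comm k m 1) (Nat.add_right_comm k n 1))
      (addLeft (tensor (one k) x)) := by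
  induction x using dia_induction with
  | h0 => rw [tensor_zero, tensor_zero, map_zero, Finsupp.mapDomain_zero]
  | hadd x y hx hy => rw [tensor_add, tensor_add, map_add, Finsupp.mapDomain_add, hx, hy]
  | hsmul c x hx => rw [tensor_smul, tensor_smul, map_smul, Finsupp.mapDomain_smul, hx]
  | hd f =>
    rw [one_eq, dia_tensor, one_eq, dia_tensor, addLeft_dia, TLDiagram.one_succ_tensor, dia, dia,
      Finsupp.mapDomain_single]

theorem Negligible.one_tensor {m n : ℕ} {x : TLHom m n} (hx : Negligible d x) (k : ℕ) :
    Negligible d (tensor (one k) x) := by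
  induction k with
  | zero =>
    rw [one_zero_tensor]
    exact hx.cast _ _
  | succ k ih =>
    rw [one_succ_tensor]
    exact Negligible.cast _ _ fun y => (tr_addLeft_comp _ _).trans (ih _)

/-- The negligible morphisms form a tensor ideal. -/
def negligible (d : ℂ) : TLIdeal d where
  hom m n :=
    { carrier := {x | Negligible d x}
      add_mem' := fun hx hy z => by rw [add_comp, map_add, hx z, hy z, add_zero]
      zero_mem' := fun z => by rw [zero_comp, map_zero]
      smul_mem' := fun c x hx z => by rw [smul_comp, map_smul, hx z, smul_zero] }
  comp_mem_left x _ hy := Negligible.comp_left hy x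
  comp_mem_right y hx := Negligible.comp_right hx y
  tensor_mem_left {m n m' n'} x y hy := by
    have h := comp_tensor d x (one m') (one n) y
    rw [one_comp, comp_one] at h
    rw [← h]
    exact Negligible.comp_left (Negligible.one_tensor hy n) _
  tensor_mem_right {m n m' n'} x y hx := by
    have h := comp_tensor d x (one m') (one n) y
    rw [one_comp, comp_one] at h
    rw [← h]
    exact Negligible.comp_right (Negligible.tensor_one hx m') _

theorem tr_one_zero : tr d (one 0) = 1 := by
  rw [one_eq, tr_dia, Conn.closureLoops, Nat.card_of_isEmpty, pow_zero]

theorem tr_jw {s : ℕ} (hs : ∀ k < s, cheb d k ≠ 0) {k : ℕ} (hk : k ≤ s) :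
    tr d (jw d k) = cheb d k := by
  induction k with
  | zero => exact tr_one_zero
  | succ k ih =>
    have h := tr_addStrand_comp (d := d) (one k) (jw d (k + 1))
    rw [addStrand_one, one_comp, one_comp, ptr_jw hs hk, map_smul, ih (by omega), smul_eq_mul,
      div_mul_cancel₀ _ (hs k (by omega))] at h
    exact h

/-- The trace of the critical projector is the vanishing Chebyshev value. -/
theorem negligible_jw {s : ℕ} (hs : ∀ k < s, cheb d k ≠ 0) (h : cheb d s = 0) :
    Negligible d (jw d s) := by
  intro y
  rw [(topKilled_jw hs le_rfl).comp_end, map_smul, tr_jw hs le_rfl, h, smul_zero]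

theorem not_negligible_one_zero : ¬ Negligible d (one 0) := fun h =>
  one_ne_zero (tr_one_zero (d := d) ▸ one_comp d (one 0) ▸ h (one 0))

end TL

/-! ### Factorization through the projectors, and uniqueness of the ideal -/

namespace TLIdeal

open TL

variable {d : ℂ} {s : ℕ}

theorem mem_generated {a b : ℕ} (p : TLHom a b) : p ∈ (generated d p).hom a b := by
  simp only [generated, Submodule.mem_iInf]
  exact fun I hI => hI

theorem generated_le {a b : ℕ} {p : TLHom a b} {I : TLIdeal d} (h : p ∈ I.hom a b) (m n : ℕ) :
    (generated d p).hom m n ≤ I.hom m n :=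
  iInf₂_le I h

/-- The morphisms that are, modulo the ideal `I`, linear combinations of morphisms that factor
through the projectors on fewer than `s` strands. -/
def factored (I : TLIdeal d) (s m n : ℕ) : Submodule ℂ (TLHom m n) :=
  I.hom m n ⊔ Submodule.span ℂ
    {x | ∃ k < s, ∃ (a : TLHom m k) (b : TLHom k n), x = comp d (comp d a (jw d k)) b}

/-- To prove a linear condition for all factored morphisms, it suffices to consider the ideal and
the morphisms that factor through one projector. -/
theorem factored_induction {I : TLIdeal d} {m n : ℕ} {E : Type*} [AddCommGroup E] [Module ℂ E]
    (φ : TLHom m n →ₗ[ℂ] E) (P : Submodule ℂ E) (hI : ∀ x ∈ I.hom m n, φ x ∈ P)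
    (hjw : ∀ k < s, ∀ (a : TLHom m k) (b : TLHom k n), φ (comp d (comp d a (jw d k)) b) ∈ P)
    {x : TLHom m n} (hx : x ∈ I.factored s m n) : φ x ∈ P := by
  have h : I.factored s m n ≤ P.comap φ := by
    refine sup_le hI (Submodule.span_le.2 ?_)
    rintro _ ⟨k, hk, a, b, rfl⟩
    exact hjw k hk a b
  exact h hx

variable {I : TLIdeal d}

theorem comp_mem_factored {k m n : ℕ} (hk : k < s) (a : TLHom m k) (b : TLHom k n) :
    comp d (comp d a (jw d k)) b ∈ I.factored s m n :=
  Submodule.mem_sup_right (Submodule.subset_span ⟨k, hk, a, b, rfl⟩)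

theorem comp_factored {m n k : ℕ} (y : TLHom m n) {x : TLHom n k} (hx : x ∈ I.factored s n k) :
    comp d y x ∈ I.factored s m k := by
  refine factored_induction (compHom d m n k y) _
    (fun x hx => Submodule.mem_sup_left (I.comp_mem_left y hx)) (fun l hl a b => ?_) hx
  change comp d y _ ∈ _
  rw [← assoc, ← assoc]
  exact comp_mem_factored hl _ _

theorem factored_comp {m n k : ℕ} {x : TLHom m n} (y : TLHom n k) (hx : x ∈ I.factored s m n) :
    comp d x y ∈ I.factored s m k := by
  refine factored_induction ((compHom d m n k).flip y) _
    (fun x hx => Submodule.mem_sup_left (I.comp_mem_right y hx)) (fun l hl a b => ?_) hx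
  change comp d _ y ∈ _
  rw [assoc]
  exact comp_mem_factored hl _ _

/-- The recursion for the projectors expresses one more strand next to a projector. -/
theorem addStrand_jw_mem_factored (hs : ∀ k < s, cheb d k ≠ 0) (hI : jw d s ∈ I.hom s s) {k : ℕ}
    (hk : k < s) : addStrand (jw d k) ∈ I.factored s (k + 1) (k + 1) := by
  have h1 : jw d (k + 1) ∈ I.factored s (k + 1) (k + 1) := by
    obtain rfl | hlt := Nat.eq_or_lt_of_le hk
    · exact Submodule.mem_sup_left hI
    · have := comp_mem_factored (I := I) hlt (one _) (one _)
      rwa [one_comp, comp_one] at this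
  cases k with
  | zero =>
    have : addStrand (jw d 0) = jw d (0 + 1) := addStrand_one 0
    rwa [this]
  | succ k =>
    rw [jw_succ_succ, ← assoc, assoc, ← jw_comp_capAt (topKilled_jw hs hk.le)] at h1
    exact (Submodule.sub_mem_iff_left _
      (Submodule.smul_mem _ _ (comp_mem_factored (by omega) _ _))).1 h1

/-- All strands on `n` points factor through the noncritical projectors, modulo an ideal that
contains the critical one. -/
theorem one_mem_factored (hs : ∀ k < s, cheb d k ≠ 0) (h0 : 0 < s) (hI : jw d s ∈ I.hom s s)
    (n : ℕ) : one n ∈ I.factored s n n := by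
  induction n with
  | zero =>
    have := comp_mem_factored (I := I) h0 (one 0) (one 0)
    rwa [one_comp, comp_one] at this
  | succ n ih =>
    rw [← addStrand_one]
    refine factored_induction addStrand _
      (fun x hx => Submodule.mem_sup_left (I.addStrand_mem hx)) (fun k hk a b => ?_) ih
    rw [addStrand_comp, addStrand_comp]
    exact factored_comp _ (comp_factored _ (addStrand_jw_mem_factored hs hI hk))

theorem jw_comp_comp_jw_of_ne (hs : ∀ k < s, cheb d k ≠ 0) {k l : ℕ} (hk : k ≤ s) (hl : l ≤ s)
    (h : k ≠ l) (z : TLHom k l) : comp d (comp d (jw d k) z) (jw d l) = 0 := by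
  rcases lt_or_gt_of_ne h with h | h
  · rw [(botKilled_jw hs hl).comp_of_lt h]
  · rw [(topKilled_jw hs hk).comp_of_lt h, zero_comp]

theorem jw_comp_comp_jw (hs : ∀ k < s, cheb d k ≠ 0) {k : ℕ} (hk : k ≤ s) (z : TLHom k k) :
    comp d (comp d (jw d k) z) (jw d k) = coeff z • jw d k := by
  rw [(topKilled_jw hs hk).comp_end, smul_comp, comp_self_of_topKilled (topKilled_jw hs hk)]

/-- Every proper ideal is contained in every ideal that contains the critical projector: between
projectors, a morphism of the proper ideal is a multiple of a projector, and hence zero. -/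
theorem IsProper.le {I' : TLIdeal d} (hI' : I'.IsProper) (hs : ∀ k < s, cheb d k ≠ 0)
    (h0 : 0 < s) (hI : jw d s ∈ I.hom s s) (m n : ℕ) : I'.hom m n ≤ I.hom m n := by
  intro x hx
  have key : ∀ k < s, ∀ l < s, ∀ z ∈ I'.hom k l, comp d (comp d (jw d k) z) (jw d l) = 0 := by
    intro k hk l hl z hz
    by_cases h : k = l
    · subst h
      have h1 := I'.comp_mem_right (jw d k) (I'.comp_mem_left (jw d k) hz)
      rw [jw_comp_comp_jw hs hk.le] at h1 ⊢
      by_contra h2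
      obtain ⟨h3, -⟩ := smul_ne_zero_iff.1 h2
      obtain ⟨m, n, y, hy⟩ := hI'
      exact hy (I'.mem_of_one_mem (I'.one_mem_of_jw_mem hs hk
        (((I'.hom k k).smul_mem_iff h3).1 h1)) y)
    · exact jw_comp_comp_jw_of_ne hs hk.le hl.le h z
  have h1 : comp d (comp d (one m) x) (one n) ∈ I.hom m n := by
    refine factored_induction (compHom d m n n (comp d (one m) x)) _
      (fun w hw => I.comp_mem_left _ hw) (fun l hl a' b' => ?_) (one_mem_factored hs h0 hI n)
    refine factored_induction ((compHom d m n n).flip (comp d (comp d a' (jw d l)) b') ∘ₗ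
      (compHom d m m n).flip x) _ (fun u hu => I.comp_mem_right _ (I.comp_mem_right _ hu))
      (fun k hk a b => ?_) (one_mem_factored hs h0 hI m)
    have h2 := key k hk l hl (comp d (comp d b x) a')
      (I'.comp_mem_right _ (I'.comp_mem_left _ hx))
    have h3 : comp d (comp d (comp d (comp d a (jw d k)) b) x) (comp d (comp d a' (jw d l)) b') =
        comp d (comp d a (comp d (comp d (jw d k) (comp d (comp d b x) a')) (jw d l))) b' := by
      simp only [assoc]
    change comp d (comp d (comp d (comp d a (jw d k)) b) x) (comp d (comp d a' (jw d l)) b') ∈ _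
    rw [h3, h2, comp_zero, zero_comp]
    exact zero_mem _
  rwa [one_comp, comp_one] at h1

theorem isProper_generated_jw (hs : ∀ k < s, cheb d k ≠ 0) (h : cheb d s = 0) :
    (generated d (jw d s)).IsProper :=
  ⟨0, 0, one 0, fun h1 => not_negligible_one_zero (d := d)
    (generated_le (I := negligible d) (negligible_jw hs h) 0 0 h1)⟩

/-- A proper nonzero ideal contains the critical projector, and is contained in the ideal that it
generates. -/
theorem eq_generated_jw {t : ℂ} (ht : t ≠ 0) (hd : d = t + t⁻¹)
    (hr : IsPrimitiveRoot (t ^ 2) (s + 1)) (h0 : 0 < s) (hs : ∀ k < s, cheb d k ≠ 0)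
    (h1 : I.IsProper) (h2 : I.IsNonzero) : I = generated d (jw d s) :=
  TLIdeal.ext (funext₂ fun m n => le_antisymm (h1.le hs h0 (mem_generated _) m n)
    (generated_le (I.jw_mem ht hd hr hs h2) m n))

/-- The nonzero morphisms of the ideal of the critical projector generate it. -/
theorem generated_eq {t : ℂ} (ht : t ≠ 0) (hd : d = t + t⁻¹)
    (hr : IsPrimitiveRoot (t ^ 2) (s + 1)) (h0 : 0 < s) (hs : ∀ k < s, cheb d k ≠ 0)
    (hc : cheb d s = 0) {m n : ℕ} {p : TLHom m n} (hp : p ∈ (generated d (jw d s)).hom m n)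
    (hp0 : p ≠ 0) : generated d p = generated d (jw d s) := by
  refine eq_generated_jw ht hd hr h0 hs ?_ ⟨m, n, p, mem_generated p, hp0⟩
  obtain ⟨a, b, x, hx⟩ := isProper_generated_jw hs hc
  exact ⟨a, b, x, fun h => hx (generated_le hp a b h)⟩

theorem jw_mem_of_le (h0 : 0 < s) (hI : jw d s ∈ I.hom s s) {k : ℕ} (hk : s ≤ k) :
    jw d k ∈ I.hom k k := by
  induction k, hk using Nat.le_induction with
  | base => exact hI
  | succ k hk ih =>
    obtain ⟨k, rfl⟩ := Nat.exists_eq_add_of_le' (h0.trans_le hk)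
    rw [jw_succ_succ]
    have := I.addStrand_mem ih
    exact sub_mem this (Submodule.smul_mem _ _ (I.comp_mem_left _ this))

theorem jonesWenzl_mem (h0 : 0 < s) (hd : d ≠ 0) (hI : jw d s ∈ I.hom s s) {k : ℕ} (hk : s ≤ k)
    {p : TLHom k k} (hp : IsJonesWenzl d p) : p ∈ I.hom k k := by
  have h1 : TopKilled d p := TopKilled.of_U hd fun a b h => (hp.2.2 a b h).2
  have h2 := h1.comp_end (jw d k)
  rw [coeff_jw, one_smul] at h2
  rw [← h2]
  exact I.comp_mem_left _ (jw_mem_of_le h0 hI hk)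

end TLIdeal

/-! ### Representations of the quotient category -/

namespace TLIdeal

open TL Module

variable {d : ℂ}

/-- The object `n` of the quotient category. -/
def toQuot (I : TLIdeal d) (n : ℕ) : I.Quot := n

/-- The class of a morphism, as a morphism of the quotient category. -/
def quotHom (I : TLIdeal d) {m n : ℕ} (x : TLHom m n) : I.toQuot m ⟶ I.toQuot n := I.cls x

variable {I : TLIdeal d} (F : I.Quot ⥤ ModuleCat.{0} ℂ)

/-- The space that a representation of the quotient attaches to the object `n`. -/
abbrev Sp (n : ℕ) : ModuleCat.{0} ℂ := F.obj (I.toQuot n)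

/-- The action of a linear combination of diagrams on a representation of the quotient. -/
def act [F.Additive] [F.Linear ℂ] {m n : ℕ} : TLHom m n →ₗ[ℂ] Sp F m →ₗ[ℂ] Sp F n where
  toFun x := (F.map (I.quotHom x)).hom
  map_add' x y := congrArg ModuleCat.Hom.hom (F.map_add (f := I.quotHom x) (g := I.quotHom y))
  map_smul' c x := congrArg ModuleCat.Hom.hom (Functor.Linear.map_smul (F := F) (I.quotHom x) c)

variable [F.Additive] [F.Linear ℂ]

theorem act_one {n : ℕ} (v : Sp F n) : act F (one n) v = v :=
  congrArg (fun f => ModuleCat.Hom.hom f v) (F.map_id (I.toQuot n))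

theorem act_comp {m n k : ℕ} (x : TLHom m n) (y : TLHom n k) (v : Sp F m) :
    act F (comp d x y) v = act F y (act F x v) :=
  congrArg (fun f => ModuleCat.Hom.hom f v)
    (F.map_comp (I.quotHom x) (I.quotHom y))

theorem act_of_mem {m n : ℕ} {x : TLHom m n} (hx : x ∈ I.hom m n) : act F x = 0 := by
  have h0 : x - 0 ∈ I.hom m n := by rwa [sub_zero]
  have h : I.quotHom x = I.quotHom 0 := (Submodule.Quotient.eq _).2 h0
  rw [← map_zero (act F (m := m) (n := n))]
  exact congrArg (fun f => ModuleCat.Hom.hom (F.map f)) h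

variable {s : ℕ}

/-- The vectors that are killed by all morphisms to the projectors are zero. -/
theorem eq_zero_of_act (hs : ∀ k < s, cheb d k ≠ 0) (h0 : 0 < s) (hI : jw d s ∈ I.hom s s)
    {n : ℕ} {v : Sp F n}
    (h : ∀ l < s, ∀ a : TLHom n l, act F (jw d l) (act F a v) = 0) : v = 0 := by
  have h1 : (act F).flip v (one n) ∈ (⊥ : Submodule ℂ (Sp F n)) := by
    refine factored_induction _ _ (fun x hx => ?_) (fun k hk a b => ?_)
      (one_mem_factored hs h0 hI n)
    · rw [LinearMap.flip_apply, act_of_mem F hx, LinearMap.zero_apply]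
      exact zero_mem _
    · rw [LinearMap.flip_apply, act_comp, act_comp, h k hk, map_zero]
      exact zero_mem _
  rw [LinearMap.flip_apply, act_one] at h1
  exact h1

/-- The multiplicity space of the projector on `k` strands. -/
def mult (d : ℂ) {I : TLIdeal d} (F : I.Quot ⥤ ModuleCat.{0} ℂ) [F.Additive] [F.Linear ℂ]
    (k : ℕ) : Submodule ℂ (Sp F k) :=
  LinearMap.range (act F (jw d k))

theorem act_jw_of_mem (hs : ∀ k < s, cheb d k ≠ 0) {k : ℕ} (hk : k ≤ s) {v : Sp F k}
    (hv : v ∈ mult d F k) : act F (jw d k) v = v := by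
  obtain ⟨w, rfl⟩ := hv
  rw [← act_comp, comp_self_of_topKilled (topKilled_jw hs hk)]

theorem act_jw_of_ne (hs : ∀ k < s, cheb d k ≠ 0) {k l : ℕ} (hk : k ≤ s) (hl : l ≤ s)
    (h : k ≠ l) {v : Sp F k} (hv : v ∈ mult d F k) (z : TLHom k l) :
    act F (jw d l) (act F z v) = 0 := by
  rw [← act_jw_of_mem F hs hk hv, ← act_comp, ← act_comp, ← assoc,
    jw_comp_comp_jw_of_ne hs hk hl h, map_zero, LinearMap.zero_apply]

theorem act_jw (hs : ∀ k < s, cheb d k ≠ 0) {k : ℕ} (hk : k ≤ s) {v : Sp F k}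
    (hv : v ∈ mult d F k) (z : TLHom k k) : act F (jw d k) (act F z v) = coeff z • v := by
  conv_lhs => rw [← act_jw_of_mem F hs hk hv]
  rw [← act_comp, ← act_comp, ← assoc, jw_comp_comp_jw hs hk, map_smul, LinearMap.smul_apply,
    act_jw_of_mem F hs hk hv]

/-- The subrepresentation generated by a vector. -/
def gen {k : ℕ} (v : Sp F k) : Subrep F where
  space n := LinearMap.range ((act F (m := k) (n := n)).flip v)
  map_mem {m n} f w hw := by
    obtain ⟨g, rfl⟩ := hw
    induction f using Submodule.Quotient.induction_on with
    | H f => exact ⟨comp d g f, act_comp F g f v⟩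

theorem mem_gen {k n : ℕ} {v : Sp F k} {w : Sp F n} :
    w ∈ (gen F v).space (I.toQuot n) ↔ ∃ x : TLHom k n, act F x v = w := Iff.rfl

/-- A nonzero vector of a subrepresentation is detected by a projector, and a projector maps the
spaces of the subrepresentation to multiples of the generating vector. -/
theorem isIrreducible_gen (hs : ∀ k < s, cheb d k ≠ 0) (h0 : 0 < s) (hI : jw d s ∈ I.hom s s)
    {k : ℕ} (hk : k < s) {v : Sp F k} (hv : v ∈ mult d F k) (hv0 : v ≠ 0) :
    (gen F v).IsIrreducible := by
  have hmem : v ∈ (gen F v).space (I.toQuot k) := ⟨one k, act_one F v⟩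
  refine ⟨⟨I.toQuot k, fun h => hv0 ?_⟩, fun T hT => or_iff_not_imp_left.2 fun hne => ?_⟩
  · rw [h] at hmem
    exact hmem
  · obtain ⟨n, hn⟩ : ∃ n : ℕ, T.space (I.toQuot n) ≠ ⊥ := not_forall.1 hne
    obtain ⟨w, hw, hw0⟩ := Submodule.exists_mem_ne_zero_of_ne_bot hn
    have h1 : ∃ l < s, ∃ a : TLHom n l, act F (jw d l) (act F a w) ≠ 0 := by
      by_contra! h
      exact hw0 (eq_zero_of_act F hs h0 hI h)
    obtain ⟨l, hl, a, ha⟩ := h1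
    obtain ⟨g, rfl⟩ := (mem_gen F).1 (hT _ hw)
    have hT' : ∀ {m n : ℕ} (x : TLHom m n) {u : Sp F m}, u ∈ T.space (I.toQuot m) →
        act F x u ∈ T.space (I.toQuot n) := fun x _ hu => T.map_mem (I.quotHom x) hu
    have h2 := hT' (jw d l) (hT' a hw)
    rw [← act_comp F _ a] at ha h2
    by_cases hkl : k = l
    · subst hkl
      rw [act_jw F hs hk.le hv] at ha h2
      have h3 : v ∈ T.space (I.toQuot k) :=
        ((T.space (I.toQuot k)).smul_mem_iff (smul_ne_zero_iff.1 ha).1).1 h2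
      intro m
      refine le_antisymm (hT m) ?_
      rintro _ ⟨x, rfl⟩
      exact hT' x h3
    · exact absurd (act_jw_of_ne F hs hk.le hl.le hkl hv _) ha

/-- The indices of the vectors of bases of the multiplicity spaces. -/
abbrev MultIndex (s : ℕ) : Type :=
  Σ k : Fin s, Basis.ofVectorSpaceIndex ℂ (mult d F k)

/-- The vectors of bases of the multiplicity spaces. -/
def multVec {s : ℕ} (i : MultIndex F s) : mult d F i.1 :=
  Basis.ofVectorSpace ℂ (mult d F i.1) i.2

theorem iSup_gen_multVec (hs : ∀ k < s, cheb d k ≠ 0) (h0 : 0 < s) (hI : jw d s ∈ I.hom s s)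
    (n : ℕ) : ⨆ i : MultIndex F s, (gen F (multVec F i).1).space (I.toQuot n) = ⊤ := by
  set P := ⨆ i : MultIndex F s, (gen F (multVec F i).1).space (I.toQuot n) with hP
  rw [eq_top_iff]
  intro v _
  rw [← act_one F v]
  refine factored_induction ((act F).flip v) P (fun x hx => ?_) (fun k hk a b => ?_)
    (one_mem_factored hs h0 hI n)
  · rw [LinearMap.flip_apply, act_of_mem F hx, LinearMap.zero_apply]
    exact zero_mem _
  · rw [LinearMap.flip_apply, act_comp, act_comp]
    have h1 : (⊤ : Submodule ℂ (mult d F k)) ≤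
        P.comap (act F b ∘ₗ (mult d F k).subtype) := by
      rw [← (Basis.ofVectorSpace ℂ (mult d F k)).span_eq, Submodule.span_le]
      rintro _ ⟨j, rfl⟩
      exact Submodule.mem_iSup_of_mem (p := fun i : MultIndex F s =>
        (gen F (multVec F i).1).space (I.toQuot n)) ⟨⟨k, hk⟩, j⟩ ⟨b, rfl⟩
    exact h1 (x := ⟨_, LinearMap.mem_range_self (act F (jw d k)) (act F a v)⟩) trivial

theorem iSupIndep_gen_multVec (hs : ∀ k < s, cheb d k ≠ 0) (h0 : 0 < s)
    (hI : jw d s ∈ I.hom s s) (n : ℕ) :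
    iSupIndep fun i : MultIndex F s => (gen F (multVec F i).1).space (I.toQuot n) := by
  classical
  rw [iSupIndep_iff_finsetSum_eq_zero_imp_eq_zero]
  intro t v hv hsum i hi
  have hv' : ∀ i ∈ t, ∃ g : TLHom i.1 n, v i = act F g (multVec F i).1 :=
    fun i hi => (hv i hi).imp fun g hg => hg.symm
  refine eq_zero_of_act F hs h0 hI fun l hl a => ?_
  obtain ⟨g, hg⟩ := hv' _ hi
  by_cases hkl : (i.1 : ℕ) = l
  · subst hkl
    -- The coordinate of the component in the multiplicity space vanishes on the other terms.
    let φ : Sp F n →ₗ[ℂ] ℂ := (Basis.ofVectorSpace ℂ (mult d F i.1)).coord i.2 ∘ₗ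
      (act F (jw d i.1)).rangeRestrict ∘ₗ act F a
    have hφ : ∀ (w : Sp F n) (x : mult d F i.1), act F (jw d i.1) (act F a w) = x.1 →
        φ w = (Basis.ofVectorSpace ℂ (mult d F i.1)).coord i.2 x := fun w x h =>
      congrArg ((Basis.ofVectorSpace ℂ (mult d F i.1)).coord i.2) (Subtype.ext h)
    have hact : ∀ (j : Basis.ofVectorSpaceIndex ℂ (mult d F i.1)) (g : TLHom i.1 n),
        φ (act F g (multVec F ⟨i.1, j⟩).1) = if j = i.2 then coeff (comp d g a) else 0 := by
      intro j g
      rw [hφ _ (coeff (comp d g a) • multVec F ⟨i.1, j⟩)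
        (by rw [← act_comp F _ a]; exact act_jw F hs hl.le (multVec F ⟨i.1, j⟩).2 _), map_smul,
        multVec, Basis.coord_apply, Basis.repr_self, Finsupp.single_apply, smul_eq_mul,
        mul_ite, mul_one, mul_zero]
    have h1 : φ (v i) = 0 := by
      rw [← map_zero φ, ← hsum, map_sum]
      refine (Finset.sum_eq_single_of_mem (f := fun j => φ (v j)) _ hi ?_).symm
      rintro ⟨k, j⟩ hj hne
      obtain ⟨g', hg'⟩ := hv' _ hj
      rw [hg']
      by_cases hk : k = i.1
      · subst hk
        rw [hact, if_neg (fun h => hne (by rw [h]))]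
      · rw [hφ _ 0 ?_, map_zero]
        rw [← act_comp F _ a]
        exact act_jw_of_ne F hs k.2.le hl.le (fun h => hk (Fin.ext h)) (multVec F ⟨k, j⟩).2 _
    have h2 := hact i.2 g
    rw [if_pos rfl, ← hg, h1] at h2
    rw [hg, ← act_comp F _ a, act_jw F hs hl.le (multVec F i).2, ← h2, zero_smul]
  · rw [hg, ← act_comp F _ a]
    exact act_jw_of_ne F hs i.1.2.le hl.le hkl (multVec F i).2 _

/-- The representations of the quotient are direct sums of the irreducible subrepresentations
that are generated by the vectors of bases of the multiplicity spaces. -/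
theorem isSemisimple_quot (hs : ∀ k < s, cheb d k ≠ 0) (h0 : 0 < s) (hI : jw d s ∈ I.hom s s) :
    IsSemisimpleLinearCategory I.Quot := fun F _ _ _ =>
  ⟨MultIndex F s, fun i => gen F (multVec F i).1,
    fun i => isIrreducible_gen F hs h0 hI i.1.2 (multVec F i).2 fun h =>
      (Basis.ofVectorSpace ℂ (mult d F i.1)).ne_zero i.2 (Subtype.ext h),
    fun n => ⟨iSupIndep_gen_multVec F hs h0 hI n, iSup_gen_multVec F hs h0 hI n⟩⟩

end TLIdeal

/-! ### Roots of unity -/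

namespace TL

/-- The Chebyshev values are the quantum integers. -/
theorem cheb_mul {t : ℂ} (ht : t ≠ 0) (k : ℕ) :
    cheb (t + t⁻¹) k * (t - t⁻¹) = t ^ (k + 1) - t⁻¹ ^ (k + 1) := by
  induction k using Nat.twoStepInduction with
  | zero => simp [cheb]
  | one => simp only [cheb]; ring
  | more k ih1 ih2 =>
    have h : t * t⁻¹ = 1 := mul_inv_cancel₀ ht
    rw [cheb, sub_mul, mul_assoc, ih2, ih1]
    linear_combination (t ^ (k + 1) - t⁻¹ ^ (k + 1)) * h

theorem cheb_eq_zero_iff {t : ℂ} (ht : t ≠ 0) (h1 : t ^ 2 ≠ 1) (k : ℕ) :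
    cheb (t + t⁻¹) k = 0 ↔ (t ^ 2) ^ (k + 1) = 1 := by
  have h2 : t - t⁻¹ ≠ 0 := by
    intro h
    apply h1
    have : t * (t - t⁻¹) = 0 := by rw [h, mul_zero]
    rw [mul_sub, mul_inv_cancel₀ ht] at this
    linear_combination this
  rw [← mul_eq_zero_iff_right h2, cheb_mul ht, sub_eq_zero, inv_pow,
    ← mul_eq_one_iff_eq_inv₀ (pow_ne_zero _ ht), ← pow_add, ← pow_mul, two_mul]

theorem isPrimitiveRoot_pow_four {r : ℕ} (hr : 3 ≤ r) {A : ℂ}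
    (hA : IsPrimitiveRoot A (4 * r) ∨
      (Odd r ∧ (IsPrimitiveRoot A (2 * r) ∨ IsPrimitiveRoot A r))) :
    IsPrimitiveRoot (A ^ 4) r := by
  rcases hA with h | ⟨ho, h | h⟩
  · exact h.pow (by omega) rfl
  · have h2 : IsPrimitiveRoot (A ^ 2) r := h.pow (by omega) rfl
    have := h2.pow_of_coprime 2 (Nat.coprime_two_left.2 ho)
    rwa [← pow_mul] at this
  · have h2 := h.pow_of_coprime 2 (Nat.coprime_two_left.2 ho)
    have := h2.pow_of_coprime 2 (Nat.coprime_two_left.2 ho)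
    rwa [← pow_mul] at this

end TL

end

theorem mainTheorem1 (r : ℕ) (hr : 3 ≤ r) (A : ℂ)
    (hA : IsPrimitiveRoot A (4 * r) ∨
      (Odd r ∧ (IsPrimitiveRoot A (2 * r) ∨ IsPrimitiveRoot A r)))
    (d : ℂ) (hd : d = -A ^ 2 - (A⁻¹) ^ 2) :
    TL.IsJonesWenzl d (TL.jw d (r - 1)) ∧
    (∀ I : TLIdeal d,
      (I.IsProper ∧ I.IsNonzero) ↔ I = TLIdeal.generated d (TL.jw d (r - 1))) ∧
    (∀ k : ℕ, r - 1 ≤ k →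
      TLIdeal.generated d (TL.jw d k) = TLIdeal.generated d (TL.jw d (r - 1))) ∧
    (∀ k : ℕ, r - 1 ≤ k → ∀ p : TLHom k k, TL.IsJonesWenzl d p →
      TLIdeal.generated d p = TLIdeal.generated d (TL.jw d (r - 1))) ∧
    IsSemisimpleLinearCategory (TLIdeal.generated d (TL.jw d (r - 1))).Quot := by
  obtain ⟨s, rfl⟩ : ∃ s, r = s + 1 := ⟨r - 1, by omega⟩
  rw [Nat.add_sub_cancel]
  have h4 := TL.isPrimitiveRoot_pow_four hr hA
  have hA0 : A ≠ 0 := by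
    rintro rfl
    exact h4.ne_zero (by omega) (zero_pow four_ne_zero)
  obtain ⟨t, ht⟩ : ∃ t, t = -A ^ 2 := ⟨_, rfl⟩
  have ht0 : t ≠ 0 := by rw [ht]; exact neg_ne_zero.2 (pow_ne_zero 2 hA0)
  have hdt : d = t + t⁻¹ := by rw [hd, ht, inv_neg, inv_pow, sub_eq_add_neg]
  have hroot : IsPrimitiveRoot (t ^ 2) (s + 1) := by
    have : t ^ 2 = A ^ 4 := by rw [ht]; ring
    rwa [this]
  have ht1 : t ^ 2 ≠ 1 := hroot.ne_one (by omega)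
  have hcheb := TL.cheb_eq_zero_iff ht0 ht1
  rw [← hdt] at hcheb
  have hs : ∀ k < s, TL.cheb d k ≠ 0 := fun k hk h =>
    hroot.pow_ne_one_of_pos_of_lt (by omega) (by omega) ((hcheb k).1 h)
  have hc : TL.cheb d s = 0 := (hcheb s).2 hroot.pow_eq_one
  have hd0 : d ≠ 0 := hs 1 (by omega)
  have h0 : 0 < s := by omega
  have hJ := TLIdeal.mem_generated (d := d) (TL.jw d s)
  refine ⟨TL.isJonesWenzl_jw hs, fun I => ⟨fun h => ?_, ?_⟩, fun k hk => ?_, fun k hk p hp => ?_,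
    TLIdeal.isSemisimple_quot hs h0 hJ⟩
  · exact TLIdeal.eq_generated_jw ht0 hdt hroot h0 hs h.1 h.2
  · rintro rfl
    exact ⟨TLIdeal.isProper_generated_jw hs hc, s, s, _, hJ, TL.jw_ne_zero s⟩
  · exact TLIdeal.generated_eq ht0 hdt hroot h0 hs hc (TLIdeal.jw_mem_of_le h0 hJ hk)
      (TL.jw_ne_zero k)
  · exact TLIdeal.generated_eq ht0 hdt hroot h0 hs hc (TLIdeal.jonesWenzl_mem h0 hd0 hJ hk hp)
      hp.1
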